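/- Let $p\ge 0$ and $m\ge 1$ be integers, $\alpha_0>0$, and $\beta=(\beta_0,\beta_1)\in\mathbb R\times\mathbb R^p$. For $b=(b_0,b_1)\in\mathbb R\times\mathbb R^p$ and $y\in\mathbb R^p$ put $$\tau_1(y;b)=\frac{e^{b_0+b_1^{\mathsf T}y}}{1+e^{b_0+b_1^{\mathsf T}y}},\qquad \tau_2(y;b)=1-\tau_1(y;b),\qquad \tau=(\tau_1,\tau_2)^{\mathsf T}.$$ Let $(Y_j,Z_j,S_j)$, $j=1,2,\dots$, be independent and identically distributed, where $Y_j\in\mathbb R^p$ is a feature vector with finite second moments and positive definite covariance matrix, $Z_j=(Z_{j1},Z_{j2})$ is the ground-truth class label (coded as a unit vector) with $\Pr(Z_{ji}=1\mid Y_j)=\tau_i(Y_j;\beta)$, $i=1,2$, and $S_j=(S_{j1},S_{j2})$ is the vector of vote counts of $m$ annotators, whose conditional law given $Y_j=y$ is Dirichlet-Multinomial$(m,\alpha_0\,\tau(y;\beta))$. That is, for all nonnegative integers $s_1+s_2=m$, with $a_i=\alpha_0\tau_i(y;\beta)$, $$\Pr(S_j=(s_1,s_2)\mid Y_j=y)=\frac{\Gamma(\alpha_0)\,m!}{\Gamma(m+\alpha_0)}\prod_{i=1}^2\frac{\Gamma(s_i+a_i)}{\Gamma(a_i)\,s_i!}.$$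 Let $\widehat\beta_{G}=\widehat\beta_{G,n}$ and $\widehat\beta_{M}=\widehat\beta_{M,n}$ be random vectors that maximise over $b$, respectively, $$\sum_{j=1}^n\Big[Z_{j1}(b_0+b_1^{\mathsf T}Y_j)-\log\{1+e^{b_0+b_1^{\mathsf T}Y_j}\}\Big],\qquad \sum_{j=1}^n\Big[S_{j1}(b_0+b_1^{\mathsf T}Y_j)-m\log\{1+e^{b_0+b_1^{\mathsf T}Y_j}\}\Big]$$ whenever a maximiser exists (and take arbitrary values otherwise). For a coefficient vector $b$ let $\mathrm{err}(b;\beta)$ be the probability that the rule assigning $y$ to class one if $\tau_1(y;b)\ge\tau_2(y;b)$, and to class two otherwise, misclassifies a new observation $(Y,Z)$ distributed as $(Y_1,Z_1)$. Assume that $b\mapsto\mathrm{err}(b;\beta)$ is differentiable near $\beta$ and twice differentiable at $\beta$, and that its Hessian at $\beta$ is not zero. Then the asymptotic relative efficiency of the rule estimated from the vote counts compared to the rule estimated from the ground-truth labels is $$\mathrm{ARE}=\lim_{n\to\infty}\frac{\mathbb E\{\mathrm{err}(\widehat\beta_{G,n};\beta)\}-\mathrm{err}(\beta;\beta)}{\mathbb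 E\{\mathrm{err}(\widehat\beta_{M,n};\beta)\}-\mathrm{err}(\beta;\beta)}=\frac{m(1+\alpha_0)}{m+\alpha_0}.$$ In particular $\mathrm{ARE}\ge 1$, and $\mathrm{ARE}\to 1+\alpha_0$ as $m\to\infty$. -/

import Mathlib

open MeasureTheory ProbabilityTheory Filter Topology

noncomputable section

namespace NoisyLabels

/-- Feature vectors. -/
abbrev Feature (p : ℕ) : Type := EuclideanSpace ℝ (Fin p)

/-- Logistic regression coefficients: an intercept and a slope vector. -/
abbrev Coef (p : ℕ) : Type := ℝ × Feature p

/-- Vote counts for the two classes (index `0` is class one, index `1` is class two). A class label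
is the count vector `Pi.single i 1` with a single vote. -/
abbrev Counts : Type := Fin 2 → ℕ

/-- The linear predictor `b₀ + b₁ᵀ y`. -/
def linPred {p : ℕ} (b : Coef p) (y : Feature p) : ℝ := b.1 + inner ℝ b.2 y

/-- The two posterior class probabilities in the logistic regression model. -/
def classProb {p : ℕ} (b : Coef p) (y : Feature p) : Fin 2 → ℝ :=
  ![Real.exp (linPred b y) / (1 + Real.exp (linPred b y)),
    1 - Real.exp (linPred b y) / (1 + Real.exp (linPred b y))]

/-- The probability mass function of the Dirichlet-Multinomial distribution with `m` trials and
concentration vector `a` (all entries positive). -/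
def dirichletMultinomialPMF {g : ℕ} (m : ℕ) (a : Fin g → ℝ) (s : Fin g → ℕ) : ℝ :=
  if ∑ i, s i = m then
    Real.Gamma (∑ i, a i) * (m.factorial : ℝ) / Real.Gamma (m + ∑ i, a i) *
      ∏ i, Real.Gamma (s i + a i) / (Real.Gamma (a i) * ((s i).factorial : ℝ))
  else 0

/-- The sampling model: the triples `(Yⱼ, Zⱼ, Sⱼ)` are i.i.d., the features have a positive definite
covariance matrix, the label `Zⱼ` given `Yⱼ` follows the logistic regression model with coefficient
`β`, and the vote counts `Sⱼ` given `Yⱼ = y` are Dirichlet-Multinomial with `m` trials and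
concentration `α₀ τ(y; β)`. Nothing is assumed on the joint law of `Zⱼ` and `Sⱼ` given `Yⱼ`. -/
structure LabelModel {p : ℕ} {Ω : Type*} [MeasurableSpace Ω] (P : Measure Ω) (m : ℕ) (α₀ : ℝ)
    (β : Coef p) (Y : ℕ → Ω → Feature p) (Z S : ℕ → Ω → Counts) : Prop where
  measurable_Y : ∀ j, Measurable (Y j)
  measurable_Z : ∀ j, Measurable (Z j)
  measurable_S : ∀ j, Measurable (S j)
  indep : iIndepFun (fun j ω => (Y j ω, Z j ω, S j ω)) P
  identDistrib : ∀ j, IdentDistrib (fun ω => (Y j ω, Z j ω, S j ω))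
    (fun ω => (Y 0 ω, Z 0 ω, S 0 ω)) P P
  memLp_Y : ∀ j, MemLp (Y j) 2 P
  cov_posDef : ∀ j, (Matrix.of fun a b : Fin p =>
    covariance (fun ω => Y j ω a) (fun ω => Y j ω b) P).PosDef
  law_Z : ∀ j, ∀ i : Fin 2,
    P⟦Z j ⁻¹' {Pi.single i 1} | MeasurableSpace.comap (Y j) inferInstance⟧
      =ᵐ[P] fun ω => classProb β (Y j ω) i
  law_S : ∀ j, ∀ s : Counts,
    P⟦S j ⁻¹' {s} | MeasurableSpace.comap (Y j) inferInstance⟧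
      =ᵐ[P] fun ω => dirichletMultinomialPMF m (α₀ • classProb β (Y j ω)) s

/-- The logistic regression log-likelihood of the first `n` observations, with `k` votes per
observation: `k = 1` for labels, `k = m` for the vote counts of `m` annotators. -/
def logLik {p : ℕ} (k n : ℕ) (y : ℕ → Feature p) (c : ℕ → Counts) (b : Coef p) : ℝ :=
  ∑ j ∈ Finset.range n,
    ((c j 0 : ℝ) * linPred b (y j) - k * Real.log (1 + Real.exp (linPred b (y j))))

/-- `est n` is, for every sample size `n`, a random vector that almost surely maximises the
log-likelihood whenever the log-likelihood has a maximiser (its value is unrestricted otherwise,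
for instance when the classes are separated). -/
structure IsMaxLikEstimator {p : ℕ} {Ω : Type*} [MeasurableSpace Ω] (P : Measure Ω) (k : ℕ)
    (Y : ℕ → Ω → Feature p) (C : ℕ → Ω → Counts) (est : ℕ → Ω → Coef p) : Prop where
  measurable : ∀ n, Measurable (est n)
  isMax : ∀ n, ∀ᵐ ω ∂P,
    (∃ b, ∀ b', logLik k n (fun j => Y j ω) (fun j => C j ω) b' ≤
      logLik k n (fun j => Y j ω) (fun j => C j ω) b) →
    ∀ b', logLik k n (fun j => Y j ω) (fun j => C j ω) b' ≤
      logLik k n (fun j => Y j ω) (fun j => C j ω) (est n ω)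

open Classical in
/-- The classification rule with coefficient `b`: the class of larger estimated posterior
probability (class one in case of a tie). -/
def rule {p : ℕ} (b : Coef p) (y : Feature p) : Fin 2 :=
  if classProb b y 1 ≤ classProb b y 0 then 0 else 1

/-- The conditional error rate of the rule with coefficient `b`: the probability that it
misclassifies a new observation whose feature and label have joint law `ν`. -/
def errorRate {p : ℕ} (ν : Measure (Feature p × Counts)) (b : Coef p) : ℝ :=
  ν.real {x | x.2 ≠ Pi.single (rule b x.1) 1}

/-- The expected excess error rate `E err(β̂ₙ; β) - err(β; β)` at sample size `n`. -/
def expectedExcessError {p : ℕ} {Ω : Type*} [MeasurableSpace Ω] (P : Measure Ω)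
    (ν : Measure (Feature p × Counts)) (β : Coef p) (est : ℕ → Ω → Coef p) (n : ℕ) : ℝ :=
  (∫ ω, errorRate ν (est n ω) ∂P) - errorRate ν β

end NoisyLabels

end

/-! The coefficient `β` gives a Bayes rule (`errorRate_le`), so it is a critical point of the error
rate. The excess error at `β + h` is therefore `q h h + o(‖h‖²)`, with `q` half the Hessian
(`taylor_two_isLittleO`). Dividing counts by the number `k` of votes turns both estimation problems
into logistic regression on the same design, with responses `r` in `[0, 1]` of conditional mean `τ₁`
and conditional variance `v τ₁ τ₂`. Here `v = 1` for labels and `v = (m + α₀) / (m (1 + α₀))` for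
votes (`dirichletMultinomial_moments`).

To first order a maximiser deviates from `β` by `J⁻¹ u`, where `u` is the mean score and `J` is the
information operator, which does not involve the responses. Since `u` is a mean of i.i.d. centered
vectors, the expectation of `n q(J⁻¹ u, J⁻¹ u)` is exactly `E[(r - τ₁)² q(J⁻¹ x, J⁻¹ x)]` for every
`n ≠ 0` (`integral_mul_bilin_sampleMean`). No central limit theorem is needed. Conditioning on the
feature gives `v D` with the same `D` in both problems, and the ratio of excess errors tends to `D /
(v D) = 1 / v`. If `D` were zero, a positive semidefinite form would vanish on a non-degenerate
design, and the Hessian would be zero.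

The work lies in convergence of expectations with only second moments and with estimators that are
arbitrary when no maximiser exists. `tendsto_mul_integral_sub` uses exceptional events of two sizes.
Outside an event of probability `o(1 / n)` a maximiser exists and deviates by at most `C ‖u‖`
(`exists_maximiser_event`); inside it the excess is at most one in absolute value, so it contributes
nothing in the limit. The linearisation holds only with probability tending to one
(`exists_linearisation_event`), but where it fails the scaled excess is still dominated by a
multiple of `n ‖u‖²`, which is uniformly integrable (`tendsto_setIntegral_mul_norm_sampleMean_sq`).
-/

namespace NoisyLabels

/-! ### Sample means. -/

section SampleMean

variable {Ω : Type*}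

/-- The mean of the first `n` terms of a sequence of random vectors. -/
noncomputable def sampleMean {V : Type*} [AddCommGroup V] [Module ℝ V] (X : ℕ → Ω → V) (n : ℕ)
    (ω : Ω) : V :=
  (n : ℝ)⁻¹ • ∑ j ∈ Finset.range n, X j ω

theorem sampleMean_add {V : Type*} [AddCommGroup V] [Module ℝ V] (X X' : ℕ → Ω → V) (n : ℕ)
    (ω : Ω) : sampleMean (fun j ω => X j ω + X' j ω) n ω = sampleMean X n ω + sampleMean X' n ω := by
  simp [sampleMean, Finset.sum_add_distrib]

theorem map_sampleMean {V W F : Type*} [AddCommGroup V] [Module ℝ V] [AddCommGroup W] [Module ℝ W]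
    [FunLike F V W] [LinearMapClass F ℝ V W] (φ : F) (X : ℕ → Ω → V) (n : ℕ) (ω : Ω) :
    φ (sampleMean X n ω) = sampleMean (fun j ω => φ (X j ω)) n ω := by
  simp [sampleMean, map_smul, map_sum]

theorem mul_sampleMean_sq (X : ℕ → Ω → ℝ) (n : ℕ) (ω : Ω) :
    n * sampleMean X n ω ^ 2 = (n : ℝ)⁻¹ * (∑ j ∈ Finset.range n, X j ω) ^ 2 := by
  rcases eq_or_ne n 0 with rfl | hn
  · simp
  · simp only [sampleMean, smul_eq_mul]
    field_simp

end SampleMean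

/-! ### Moments and uniform integrability of scaled means of real variables. -/

section Moments

variable {Ω : Type*} [MeasurableSpace Ω] {P : Measure Ω}

theorem indepFun_sum_range {X : ℕ → Ω → ℝ} (hX : ∀ j, Measurable (X j)) (hind : iIndepFun X P)
    (n : ℕ) : IndepFun (fun ω => ∑ j ∈ Finset.range n, X j ω) (X n) P := by
  have h := hind.indepFun_finsetSum_of_notMem hX (Finset.notMem_range_self (n := n))
  convert h using 1
  ext ω; simp

/-- The second and fourth moments of a sum of independent centered variables bounded by `K`. -/
theorem integral_sum_pow_le [IsProbabilityMeasure P] {X : ℕ → Ω → ℝ} {K : ℝ} (hX : ∀ j, Measurable (X j))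
    (hind : iIndepFun X P) (hb : ∀ j ω, |X j ω| ≤ K) (hc : ∀ j, ∫ ω, X j ω ∂P = 0) (n : ℕ) :
    ∫ ω, (∑ j ∈ Finset.range n, X j ω) ^ 2 ∂P ≤ n * K ^ 2 ∧
      ∫ ω, (∑ j ∈ Finset.range n, X j ω) ^ 4 ∂P ≤ 3 * n ^ 2 * K ^ 4 := by
  have hTm : ∀ n, Measurable fun ω => ∑ j ∈ Finset.range n, X j ω := fun n =>
    Finset.measurable_sum _ fun j _ => hX j
  have hTb : ∀ n ω, |∑ j ∈ Finset.range n, X j ω| ≤ n * K := fun n ω => by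
    refine (Finset.abs_sum_le_sum_abs _ _).trans ?_
    simpa using Finset.sum_le_sum (s := Finset.range n) fun j _ => hb j ω
  have hint : ∀ n a b, Integrable
      (fun ω => (∑ j ∈ Finset.range n, X j ω) ^ a * (X n ω) ^ b) P := fun n a b => by
    refine Integrable.of_bound (((hTm n).pow_const a).mul ((hX n).pow_const b)).aestronglyMeasurable
      ((n * K) ^ a * K ^ b) (ae_of_all _ fun ω => ?_)
    rw [norm_mul, norm_pow, norm_pow]
    have := hTb n ω
    have := hb n ω
    have hnk : 0 ≤ (n : ℝ) * K := (abs_nonneg _).trans (hTb n ω)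
    exact mul_le_mul (pow_le_pow_left₀ (abs_nonneg _) (hTb n ω) a)
      (pow_le_pow_left₀ (abs_nonneg _) (hb n ω) b) (by positivity) (by positivity)
  have hprod : ∀ n a b, ∫ ω, (∑ j ∈ Finset.range n, X j ω) ^ a * (X n ω) ^ b ∂P =
      (∫ ω, (∑ j ∈ Finset.range n, X j ω) ^ a ∂P) * ∫ ω, (X n ω) ^ b ∂P := fun n a b => by
    have h := (indepFun_sum_range hX hind n).comp (measurable_id.pow_const a)
      (measurable_id.pow_const b)
    exact h.integral_fun_mul_eq_mul_integral ((hTm n).pow_const a).aestronglyMeasurable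
      ((hX n).pow_const b).aestronglyMeasurable
  have hpow : ∀ j a, |∫ ω, (X j ω) ^ a ∂P| ≤ K ^ a := fun j a => by
    have h := norm_integral_le_of_norm_le_const (μ := P) (f := fun ω => X j ω ^ a) (C := K ^ a)
      (ae_of_all _ fun ω => by
        rw [norm_pow]
        exact pow_le_pow_left₀ (abs_nonneg _) (hb j ω) a)
    simpa using h
  have hmean : ∀ n, ∫ ω, (∑ j ∈ Finset.range n, X j ω) ^ 1 ∂P = 0 := fun n => by
    simp only [pow_one]
    rw [integral_finsetSum]
    · simp [hc]
    · intro j _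
      exact Integrable.of_bound (hX j).aestronglyMeasurable K (ae_of_all _ fun ω => hb j ω)
  have hX1 : ∀ j, ∫ ω, (X j ω) ^ 1 ∂P = 0 := by simpa using hc
  induction n with
  | zero => simp
  | succ n ih =>
    obtain ⟨ih2, ih4⟩ := ih
    have h2 : ∫ ω, (∑ j ∈ Finset.range (n + 1), X j ω) ^ 2 ∂P =
        ∫ ω, (∑ j ∈ Finset.range n, X j ω) ^ 2 ∂P + ∫ ω, (X n ω) ^ 2 ∂P := by
      have : ∀ ω, (∑ j ∈ Finset.range (n + 1), X j ω) ^ 2 =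
          (∑ j ∈ Finset.range n, X j ω) ^ 2 * (X n ω) ^ 0 +
          2 * ((∑ j ∈ Finset.range n, X j ω) ^ 1 * (X n ω) ^ 1) +
          (∑ j ∈ Finset.range n, X j ω) ^ 0 * (X n ω) ^ 2 := fun ω => by
        rw [Finset.sum_range_succ]; ring
      simp_rw [this]
      rw [integral_add ((hint n 2 0).fun_add ((hint n 1 1).const_mul 2)) (hint n 0 2),
        integral_add (hint n 2 0) ((hint n 1 1).const_mul 2), integral_const_mul, hprod, hprod,
        hprod, hmean]
      simp
    -- In the binomial expansion the cubic-linear and linear-cubic terms vanish, because the factors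
    -- are independent and one of them is centered.
    have h4 : ∫ ω, (∑ j ∈ Finset.range (n + 1), X j ω) ^ 4 ∂P =
        ∫ ω, (∑ j ∈ Finset.range n, X j ω) ^ 4 ∂P +
        6 * ((∫ ω, (∑ j ∈ Finset.range n, X j ω) ^ 2 ∂P) * ∫ ω, (X n ω) ^ 2 ∂P) +
        ∫ ω, (X n ω) ^ 4 ∂P := by
      have : ∀ ω, (∑ j ∈ Finset.range (n + 1), X j ω) ^ 4 =
          (∑ j ∈ Finset.range n, X j ω) ^ 4 * (X n ω) ^ 0 +
          4 * ((∑ j ∈ Finset.range n, X j ω) ^ 3 * (X n ω) ^ 1) +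
          6 * ((∑ j ∈ Finset.range n, X j ω) ^ 2 * (X n ω) ^ 2) +
          4 * ((∑ j ∈ Finset.range n, X j ω) ^ 1 * (X n ω) ^ 3) +
          (∑ j ∈ Finset.range n, X j ω) ^ 0 * (X n ω) ^ 4 := fun ω => by
        rw [Finset.sum_range_succ]; ring
      simp_rw [this]
      have i1 := hint n 4 0
      have i2 := i1.fun_add ((hint n 3 1).const_mul 4)
      have i3 := i2.fun_add ((hint n 2 2).const_mul 6)
      have i4 := i3.fun_add ((hint n 1 3).const_mul 4)
      rw [integral_add i4 (hint n 0 4), integral_add i3 ((hint n 1 3).const_mul 4),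
        integral_add i2 ((hint n 2 2).const_mul 6), integral_add i1 ((hint n 3 1).const_mul 4),
        integral_const_mul, integral_const_mul, integral_const_mul, hprod, hprod,
        hprod, hprod, hprod, hmean, hX1]
      simp
    have b2 := (le_abs_self _).trans (hpow n 2)
    have b4 := (le_abs_self _).trans (hpow n 4)
    have p2 : 0 ≤ ∫ ω, (X n ω) ^ 2 ∂P := integral_nonneg fun ω => sq_nonneg _
    rw [h2, h4]
    push_cast
    -- The fourth moment closes because `3 n² + 6 n + 1 ≤ 3 (n + 1)²`.
    have h5 := mul_le_mul ih2 b2 p2 (by positivity)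
    constructor
    · linarith
    · nlinarith [pow_nonneg (sq_nonneg K) 2]


theorem measurable_sampleMean {V : Type*} [NormedAddCommGroup V] [NormedSpace ℝ V]
    [MeasurableSpace V] [BorelSpace V] [SecondCountableTopology V] {X : ℕ → Ω → V}
    (hX : ∀ j, Measurable (X j)) (n : ℕ) : Measurable (sampleMean X n) :=
  (Finset.measurable_sum _ fun j _ => hX j).const_smul _

theorem memLp_sampleMean {V : Type*} [NormedAddCommGroup V] [NormedSpace ℝ V] {X : ℕ → Ω → V}
    {p : ENNReal} (hX : ∀ j, MemLp (X j) p P) (n : ℕ) : MemLp (sampleMean X n) p P :=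
  (memLp_finsetSum _ fun j _ => hX j).const_smul _

theorem integral_mul_sampleMean_sq [IsProbabilityMeasure P] {X : ℕ → Ω → ℝ}
    (hind : iIndepFun X P) (hid : ∀ j, IdentDistrib (X j) (X 0) P P) (hL : MemLp (X 0) 2 P)
    (hc : ∫ ω, X 0 ω ∂P = 0) {n : ℕ} (hn : n ≠ 0) :
    ∫ ω, n * sampleMean X n ω ^ 2 ∂P = ∫ ω, X 0 ω ^ 2 ∂P := by
  have hLj : ∀ j, MemLp (X j) 2 P := fun j => (hid j).memLp_iff.2 hL
  have hcj : ∀ j, ∫ ω, X j ω ∂P = 0 := fun j => (hid j).integral_eq.trans hc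
  have hv := IndepFun.variance_sum (s := Finset.range n) (fun j _ => hLj j)
    (fun i _ j _ hij => hind.indepFun hij)
  have hs : (∑ j ∈ Finset.range n, X j) = fun ω => ∑ j ∈ Finset.range n, X j ω := by
    ext ω; simp
  rw [hs, variance_of_integral_eq_zero] at hv
  · simp_rw [mul_sampleMean_sq]
    rw [integral_const_mul, hv, Finset.sum_congr rfl fun j _ => (hid j).variance_eq,
      variance_of_integral_eq_zero hL.aestronglyMeasurable.aemeasurable hc]
    have : (n : ℝ) ≠ 0 := by exact_mod_cast hn
    simp [this]
  · exact (memLp_finsetSum _ fun j _ => hLj j).aestronglyMeasurable.aemeasurable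
  · rw [integral_finsetSum _ fun j _ => (hLj j).integrable one_le_two]
    simp [hcj]

/-- Dominated convergence: the integrand is at most `X²` and is zero once `M` exceeds `|X ω|`. -/
theorem tendsto_integral_sub_truncation {X : Ω → ℝ} (hXm : Measurable X) (hX : MemLp X 2 P) :
    Tendsto (fun M : ℕ => ∫ ω, (X ω - (Set.Icc (-M : ℝ) M).indicator id (X ω)) ^ 2 ∂P) atTop
      (𝓝 0) := by
  have h := tendsto_integral_of_dominated_convergence (μ := P)
    (F := fun (M : ℕ) ω => (X ω - (Set.Icc (-M : ℝ) M).indicator id (X ω)) ^ 2) (f := fun _ => 0)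
    (fun ω => X ω ^ 2) ?_ hX.integrable_sq ?_ ?_
  · simpa using h
  · intro M
    exact ((hXm.sub ((measurable_id.indicator measurableSet_Icc).comp hXm)).pow_const
      2).aestronglyMeasurable
  · refine fun M => ae_of_all _ fun ω => ?_
    by_cases h : X ω ∈ Set.Icc (-M : ℝ) M
    · simp [Set.indicator_of_mem h, sq_nonneg]
    · simp [Set.indicator_of_notMem h]
  · refine ae_of_all _ fun ω => tendsto_const_nhds.congr' ?_
    obtain ⟨M₀, hM₀⟩ := exists_nat_ge |X ω|
    filter_upwards [eventually_ge_atTop M₀] with M hM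
    have h : X ω ∈ Set.Icc (-M : ℝ) M := by
      rw [Set.mem_Icc, ← abs_le]
      exact hM₀.trans (by exact_mod_cast hM)
    simp [Set.indicator_of_mem h]

/-- Uniform integrability of `√n`-scaled squared means of i.i.d. centered real variables with finite
variance. -/
theorem tendsto_setIntegral_mul_sampleMean_sq [IsProbabilityMeasure P] {X : ℕ → Ω → ℝ}
    (hX : ∀ j, Measurable (X j)) (hind : iIndepFun X P) (hid : ∀ j, IdentDistrib (X j) (X 0) P P)
    (hL : MemLp (X 0) 2 P) (hc : ∫ ω, X 0 ω ∂P = 0) {A : ℕ → Set Ω}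
    (hA0 : Tendsto (fun n => P.real (A n)) atTop (𝓝 0)) :
    Tendsto (fun n : ℕ => ∫ ω in A n, n * sampleMean X n ω ^ 2 ∂P) atTop (𝓝 0) := by
  have hLj : ∀ j, MemLp (X j) 2 P := fun j => (hid j).memLp_iff.2 hL
  refine Metric.tendsto_atTop'.2 fun ε hε => ?_
  obtain ⟨M, hM⟩ := ((tendsto_integral_sub_truncation (hX 0) hL).eventually
    (gt_mem_nhds (show (0 : ℝ) < ε / 8 by positivity))).exists
  let g : ℝ → ℝ := (Set.Icc (-M : ℝ) M).indicator id
  have hg : Measurable g := measurable_id.indicator measurableSet_Icc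
  have hgb : ∀ t, |g t| ≤ M := fun t => by
    by_cases h : t ∈ Set.Icc (-M : ℝ) M
    · simp only [g, Set.indicator_of_mem h, id]
      exact abs_le.2 h
    · simp [g, Set.indicator_of_notMem h]
  have hgL : MemLp (fun ω => g (X 0 ω)) 2 P :=
    MemLp.of_bound (hg.comp (hX 0)).aestronglyMeasurable M (ae_of_all _ fun ω => hgb _)
  set μ := ∫ ω, g (X 0 ω) ∂P with hμ
  have hμb : |μ| ≤ M := by
    have h := norm_integral_le_of_norm_le_const (μ := P) (f := fun ω => g (X 0 ω)) (C := M)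
      (ae_of_all _ fun ω => hgb _)
    simpa using h
  have hg1 : Measurable fun t => g t - μ := hg.sub_const μ
  have hg2 : Measurable fun t => t - g t + μ := (measurable_id.sub hg).add_const μ
  -- Each variable splits into a bounded part and a part of small variance. Both are recentered by
  -- `μ`, so that the moment bounds for centered sums apply to each.
  let X₁ : ℕ → Ω → ℝ := fun j ω => g (X j ω) - μ
  let X₂ : ℕ → Ω → ℝ := fun j ω => X j ω - g (X j ω) + μ
  have hX₁ : ∀ j, Measurable (X₁ j) := fun j => hg1.comp (hX j)
  have hid₁ : ∀ j, IdentDistrib (X₁ j) (X₁ 0) P P := fun j => (hid j).comp hg1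
  have hid₂ : ∀ j, IdentDistrib (X₂ j) (X₂ 0) P P := fun j => (hid j).comp hg2
  have hind₁ : iIndepFun X₁ P := hind.comp (fun _ t => g t - μ) fun _ => hg1
  have hind₂ : iIndepFun X₂ P := hind.comp (fun _ t => t - g t + μ) fun _ => hg2
  have hc₁ : ∫ ω, X₁ 0 ω ∂P = 0 := by
    simp only [X₁]
    rw [integral_sub (hgL.integrable one_le_two) (integrable_const _)]
    simp [hμ]
  have hc₂ : ∫ ω, X₂ 0 ω ∂P = 0 := by
    simp only [X₂]
    have hi : Integrable (fun ω => X 0 ω - g (X 0 ω)) P :=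
      (hL.integrable one_le_two).sub (hgL.integrable one_le_two)
    rw [integral_add hi (integrable_const _), integral_sub (hL.integrable one_le_two) (hgL.integrable one_le_two)]
    simp [hμ, hc]
  have hL₂ : MemLp (X₂ 0) 2 P := (hL.sub hgL).add (memLp_const _)
  have hL₁ : MemLp (X₁ 0) 2 P := hgL.sub (memLp_const _)
  have hvar : ∫ ω, X₂ 0 ω ^ 2 ∂P ≤ ε / 8 := by
    have hm : ∫ ω, (X 0 ω - g (X 0 ω)) ∂P = -μ := by
      rw [integral_sub (hL.integrable one_le_two) (hgL.integrable one_le_two)]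
      simp [hμ, hc]
    have h1 : ∫ ω, X₂ 0 ω ^ 2 ∂P = Var[fun ω => X 0 ω - g (X 0 ω); P] := by
      rw [variance_eq_integral (X := fun ω => X 0 ω - g (X 0 ω)) (hL.sub hgL).aestronglyMeasurable.aemeasurable, hm]
      simp [X₂]
    rw [h1]
    exact (variance_le_expectation_sq (hL.sub hgL).aestronglyMeasurable).trans hM.le
  let K : ℝ := 2 * M
  have hb₁ : ∀ j ω, |X₁ j ω| ≤ K := fun j ω => by
    have := abs_sub (g (X j ω)) μ
    have := hgb (X j ω)
    simp only [X₁, K]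
    linarith
  have hcj₁ : ∀ j, ∫ ω, X₁ j ω ∂P = 0 := fun j => (hid₁ j).integral_eq.trans hc₁
  -- The weight in `y ≤ l y² + 1 / (4 l)`, small enough for the fourth moment term to cost at most
  -- `ε / 4`. The `+ 1` covers `K = 0`.
  let l : ℝ := ε / (24 * K ^ 4 + 1)
  have hK4 : 0 ≤ K ^ 4 := by positivity
  have hl : 0 < l := by positivity
  have hlK : 2 * (3 * l * K ^ 4) ≤ ε / 4 := by
    have : l * (24 * K ^ 4 + 1) = ε := by simp only [l]; field_simp
    nlinarith
  have hi : ∀ n : ℕ, Integrable (fun ω => n * sampleMean X n ω ^ 2) P := fun n =>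
    (memLp_sampleMean hLj n).integrable_sq.const_mul _
  have hi₂ : ∀ n : ℕ, Integrable (fun ω => n * sampleMean X₂ n ω ^ 2) P := fun n =>
    (memLp_sampleMean (fun j => (hid₂ j).memLp_iff.2 hL₂) n).integrable_sq.const_mul _
  have hT4 : ∀ n : ℕ, Integrable (fun ω => (n * sampleMean X₁ n ω ^ 2) ^ 2) P := fun n => by
    refine Integrable.of_bound (((measurable_sampleMean hX₁ n).pow_const 2).const_mul _ |>.pow_const
      2).aestronglyMeasurable ((n * ((n : ℝ)⁻¹ * (n * K)) ^ 2) ^ 2) (ae_of_all _ fun ω => ?_)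
    rw [norm_pow, norm_mul, norm_pow, RCLike.norm_natCast]
    gcongr
    simp only [sampleMean, smul_eq_mul, norm_mul, norm_inv, RCLike.norm_natCast]
    gcongr
    refine (Finset.abs_sum_le_sum_abs _ _).trans ?_
    simpa using Finset.sum_le_sum (s := Finset.range n) fun j _ => hb₁ j ω
  have hT4b : ∀ n : ℕ, ∫ ω, (n * sampleMean X₁ n ω ^ 2) ^ 2 ∂P ≤ 3 * K ^ 4 := fun n => by
    rcases eq_or_ne n 0 with rfl | hn
    · simp only [CharP.cast_eq_zero, zero_mul, ne_eq, OfNat.ofNat_ne_zero, not_false_eq_true,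
        zero_pow, integral_zero]
      positivity
    have hn' : (0 : ℝ) < n := by exact_mod_cast Nat.pos_of_ne_zero hn
    simp_rw [mul_sampleMean_sq, mul_pow, ← pow_mul]
    rw [integral_const_mul]
    calc ((n : ℝ)⁻¹ ^ 2) * ∫ ω, (∑ j ∈ Finset.range n, X₁ j ω) ^ (2 * 2) ∂P
        ≤ ((n : ℝ)⁻¹ ^ 2) * (3 * n ^ 2 * K ^ 4) := by
          gcongr
          exact (integral_sum_pow_le hX₁ hind₁ hb₁ hcj₁ n).2
      _ = 3 * K ^ 4 := by field_simp
  have hev := (hA0.eventually (gt_mem_nhds (show (0 : ℝ) < l * ε by positivity)))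
  obtain ⟨N, hN⟩ := eventually_atTop.1 hev
  refine ⟨N + 1, fun n hn => ?_⟩
  have hn0 : n ≠ 0 := by omega
  have hnN := hN n (by omega)
  -- The bounded part is traded for its square, controlled by fourth moments uniformly in `n`, plus
  -- a constant whose integral over `A n` is proportional to the probability of `A n`.
  have hpt : ∀ ω, n * sampleMean X n ω ^ 2 ≤
      2 * (l * (n * sampleMean X₁ n ω ^ 2) ^ 2 + 1 / (4 * l)) +
        2 * (n * sampleMean X₂ n ω ^ 2) := fun ω => by
    have h1 : sampleMean X n ω = sampleMean X₁ n ω + sampleMean X₂ n ω := by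
      rw [← sampleMean_add]
      simp [X₁, X₂]
    have h2 : ∀ y : ℝ, y ≤ l * y ^ 2 + 1 / (4 * l) := fun y => by
      have : l * y ^ 2 + 1 / (4 * l) - y = l * (y - 1 / (2 * l)) ^ 2 := by field_simp; ring
      have : 0 ≤ l * (y - 1 / (2 * l)) ^ 2 := by positivity
      linarith
    have h3 := h2 (n * sampleMean X₁ n ω ^ 2)
    have h4 : n * sampleMean X n ω ^ 2 ≤
        2 * (n * sampleMean X₁ n ω ^ 2) + 2 * (n * sampleMean X₂ n ω ^ 2) := by
      rw [h1]
      have : (0 : ℝ) ≤ n * (sampleMean X₁ n ω - sampleMean X₂ n ω) ^ 2 := by positivity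
      linarith
    linarith
  have hnn : 0 ≤ ∫ ω in A n, n * sampleMean X n ω ^ 2 ∂P :=
    integral_nonneg fun ω => by positivity
  rw [Real.dist_eq, sub_zero, abs_of_nonneg hnn]
  calc ∫ ω in A n, n * sampleMean X n ω ^ 2 ∂P
      ≤ ∫ ω in A n, (2 * (l * (n * sampleMean X₁ n ω ^ 2) ^ 2 + 1 / (4 * l)) +
        2 * (n * sampleMean X₂ n ω ^ 2)) ∂P := by
        refine integral_mono (hi n).integrableOn ?_ hpt
        exact (((((hT4 n).const_mul l).add (integrable_const _)).const_mul 2).add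
          ((hi₂ n).const_mul 2)).integrableOn
    _ = 2 * (l * (∫ ω in A n, (n * sampleMean X₁ n ω ^ 2) ^ 2 ∂P) + P.real (A n) / (4 * l)) +
        2 * ∫ ω in A n, (n * sampleMean X₂ n ω ^ 2) ∂P := by
        rw [integral_add _ ((hi₂ n).const_mul 2).integrableOn, integral_const_mul,
          integral_const_mul, integral_add ((hT4 n).const_mul l).integrableOn
          (integrable_const _), integral_const_mul]
        · simp [div_eq_mul_inv]
        · exact ((((hT4 n).const_mul l).add (integrable_const _)).const_mul 2).integrableOn
    _ ≤ 2 * (l * (3 * K ^ 4) + P.real (A n) / (4 * l)) + 2 * (ε / 8) := by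
        gcongr
        · exact (setIntegral_le_integral (hT4 n) (ae_of_all _ fun ω => by positivity)).trans
            (hT4b n)
        · refine (setIntegral_le_integral (hi₂ n) (ae_of_all _ fun ω => by positivity)).trans ?_
          rw [integral_mul_sampleMean_sq hind₂ hid₂ hL₂ hc₂ hn0]
          exact hvar
    _ < ε := by
        have : P.real (A n) / (4 * l) < ε / 4 := by
          rw [div_lt_iff₀ (by positivity)]
          linarith
        linarith

end Moments

/-! ### The same bounds for random vectors, and deviation probabilities. -/

section VectorMoments

/-- Expansion in a basis and Cauchy–Schwarz. This reduces statements about `n ‖u‖²` to the real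
case, one coordinate at a time. -/
theorem exists_coord_norm_sq_le (V : Type*) [NormedAddCommGroup V] [NormedSpace ℝ V]
    [FiniteDimensional ℝ V] : ∃ (d : ℕ) (φ : Fin d → V →L[ℝ] ℝ) (C : ℝ), 0 ≤ C ∧
      ∀ v, ‖v‖ ^ 2 ≤ C * ∑ i, φ i v ^ 2 := by
  let b := Module.finBasis ℝ V
  refine ⟨_, fun i => LinearMap.toContinuousLinearMap (b.coord i), ∑ i, ‖b i‖ ^ 2, by positivity,
    fun v => ?_⟩
  have h : ‖v‖ ≤ ∑ i, ‖b i‖ * |b.coord i v| := by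
    conv_lhs => rw [← b.sum_repr v]
    refine (norm_sum_le _ _).trans (Finset.sum_le_sum fun i _ => ?_)
    rw [norm_smul, mul_comm]
    rfl
  calc ‖v‖ ^ 2 ≤ (∑ i, ‖b i‖ * |b.coord i v|) ^ 2 := by gcongr
    _ ≤ (∑ i, ‖b i‖ ^ 2) * ∑ i, |b.coord i v| ^ 2 := Finset.sum_mul_sq_le_sq_mul_sq _ _ _
    _ = _ := by simp

theorem integrable_mul_norm_sampleMean_sq {Ω V : Type*} [MeasurableSpace Ω] {P : Measure Ω}
    [NormedAddCommGroup V] [NormedSpace ℝ V] [MeasurableSpace V] [BorelSpace V] {X : ℕ → Ω → V}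
    (hid : ∀ j, IdentDistrib (X j) (X 0) P P)
    (hL : MemLp (X 0) 2 P) (n : ℕ) : Integrable (fun ω => n * ‖sampleMean X n ω‖ ^ 2) P :=
  (memLp_sampleMean (fun j => (hid j).memLp_iff.2 hL) n).norm.integrable_sq.const_mul _

variable {Ω : Type*} [MeasurableSpace Ω] {P : Measure Ω} [IsProbabilityMeasure P]
  {V : Type*} [NormedAddCommGroup V] [NormedSpace ℝ V] [FiniteDimensional ℝ V]
  [MeasurableSpace V] [BorelSpace V] {X : ℕ → Ω → V}

theorem integral_mul_map_sampleMean_sq (hind : iIndepFun X P)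
    (hid : ∀ j, IdentDistrib (X j) (X 0) P P) (hL : MemLp (X 0) 2 P)
    (hc : ∫ ω, X 0 ω ∂P = 0) (φ : V →L[ℝ] ℝ) {n : ℕ} (hn : n ≠ 0) :
    ∫ ω, n * φ (sampleMean X n ω) ^ 2 ∂P = ∫ ω, φ (X 0 ω) ^ 2 ∂P := by
  have hφ : Measurable φ := φ.measurable
  simp_rw [map_sampleMean]
  refine integral_mul_sampleMean_sq (X := fun j ω => φ (X j ω)) (hind.comp (fun _ => φ) fun _ => hφ)
    (fun j => (hid j).comp hφ) (φ.comp_memLp' hL) ?_ hn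
  rw [φ.integral_comp_comm (hL.integrable one_le_two), hc, map_zero]

/-- The scaled quadratic form of the mean of i.i.d. centered vectors has a constant expectation. -/
theorem integral_mul_bilin_sampleMean (hind : iIndepFun X P)
    (hid : ∀ j, IdentDistrib (X j) (X 0) P P) (hL : MemLp (X 0) 2 P)
    (hc : ∫ ω, X 0 ω ∂P = 0) (q : V →L[ℝ] V →L[ℝ] ℝ) {n : ℕ} (hn : n ≠ 0) :
    ∫ ω, n * q (sampleMean X n ω) (sampleMean X n ω) ∂P = ∫ ω, q (X 0 ω) (X 0 ω) ∂P := by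
  let b := Module.finBasis ℝ V
  let c := fun i => LinearMap.toContinuousLinearMap (b.coord i)
  -- Polarization of the coordinate products, so that only squares of linear functionals remain and
  -- the variance identity for real variables applies.
  have hq : ∀ v, q v v = ∑ i, ∑ j, q (b i) (b j) / 4 *
      ((c i + c j) v ^ 2 - (c i - c j) v ^ 2) := fun v => by
    have hv : v = ∑ i, c i v • b i := (b.sum_repr v).symm
    conv_lhs => rw [hv]
    simp only [map_sum, map_smul, sum_apply, smul_apply,
      smul_eq_mul, Finset.mul_sum, add_apply, sub_apply]
    rw [Finset.sum_comm]
    refine Finset.sum_congr rfl fun i _ => Finset.sum_congr rfl fun j _ => ?_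
    ring
  have hLj : ∀ j, MemLp (X j) 2 P := fun j => (hid j).memLp_iff.2 hL
  have hint : ∀ φ : V →L[ℝ] ℝ, Integrable (fun ω => n * φ (sampleMean X n ω) ^ 2) P := fun φ =>
    (φ.comp_memLp' (memLp_sampleMean hLj n)).integrable_sq.const_mul _
  have hint0 : ∀ φ : V →L[ℝ] ℝ, Integrable (fun ω => φ (X 0 ω) ^ 2) P := fun φ =>
    (φ.comp_memLp' hL).integrable_sq
  have hl : ∀ ω, n * q (sampleMean X n ω) (sampleMean X n ω) = ∑ i, ∑ j, q (b i) (b j) / 4 *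
      (n * (c i + c j) (sampleMean X n ω) ^ 2 - n * (c i - c j) (sampleMean X n ω) ^ 2) :=
    fun ω => by
    rw [hq, Finset.mul_sum]
    refine Finset.sum_congr rfl fun i _ => ?_
    rw [Finset.mul_sum]
    refine Finset.sum_congr rfl fun j _ => ?_
    ring
  simp_rw [hl]
  simp_rw [hq (X 0 _)]
  have h1 : ∀ i j, Integrable (fun ω => q (b i) (b j) / 4 *
      (n * (c i + c j) (sampleMean X n ω) ^ 2 - n * (c i - c j) (sampleMean X n ω) ^ 2)) P :=
    fun i j => ((hint _).sub (hint _)).const_mul _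
  have h2 : ∀ i j, Integrable (fun ω => q (b i) (b j) / 4 *
      ((c i + c j) (X 0 ω) ^ 2 - (c i - c j) (X 0 ω) ^ 2)) P :=
    fun i j => ((hint0 _).sub (hint0 _)).const_mul _
  rw [integral_finsetSum _ fun i _ => integrable_finsetSum _ fun j _ => h1 i j,
    integral_finsetSum _ fun i _ => integrable_finsetSum _ fun j _ => h2 i j]
  refine Finset.sum_congr rfl fun i _ => ?_
  rw [integral_finsetSum _ fun j _ => h1 i j, integral_finsetSum _ fun j _ => h2 i j]
  refine Finset.sum_congr rfl fun j _ => ?_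
  rw [integral_const_mul, integral_const_mul, integral_sub (hint _) (hint _),
    integral_sub (hint0 _) (hint0 _), integral_mul_map_sampleMean_sq hind hid hL hc _ hn,
    integral_mul_map_sampleMean_sq hind hid hL hc _ hn]

theorem exists_integral_mul_norm_sampleMean_sq_le (hind : iIndepFun X P)
    (hid : ∀ j, IdentDistrib (X j) (X 0) P P) (hL : MemLp (X 0) 2 P) (hc : ∫ ω, X 0 ω ∂P = 0) :
    ∃ C, ∀ n : ℕ, ∫ ω, n * ‖sampleMean X n ω‖ ^ 2 ∂P ≤ C := by
  obtain ⟨d, φ, C, hC, h⟩ := exists_coord_norm_sq_le V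
  have hLj : ∀ j, MemLp (X j) 2 P := fun j => (hid j).memLp_iff.2 hL
  have hint : ∀ (n : ℕ) (φ : V →L[ℝ] ℝ), Integrable (fun ω => n * φ (sampleMean X n ω) ^ 2) P :=
    fun n φ => (φ.comp_memLp' (memLp_sampleMean hLj n)).integrable_sq.const_mul _
  refine ⟨C * ∑ i, ∫ ω, φ i (X 0 ω) ^ 2 ∂P, fun n => ?_⟩
  have hnn : 0 ≤ C * ∑ i, ∫ ω, φ i (X 0 ω) ^ 2 ∂P :=
    mul_nonneg hC (Finset.sum_nonneg fun i _ => integral_nonneg fun ω => sq_nonneg _)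
  rcases eq_or_ne n 0 with rfl | hn
  · simpa using hnn
  calc ∫ ω, n * ‖sampleMean X n ω‖ ^ 2 ∂P
      ≤ ∫ ω, C * ∑ i, n * φ i (sampleMean X n ω) ^ 2 ∂P := by
        refine integral_mono (integrable_mul_norm_sampleMean_sq hid hL n)
          ((integrable_finsetSum _ fun i _ => hint n _).const_mul C) fun ω => ?_
        have h1 : (0 : ℝ) ≤ n := n.cast_nonneg
        have h2 := mul_le_mul_of_nonneg_left (h (sampleMean X n ω)) h1
        simp only [← Finset.mul_sum]
        linarith
    _ = _ := by
        rw [integral_const_mul, integral_finsetSum _ fun i _ => hint n _]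
        simp_rw [integral_mul_map_sampleMean_sq hind hid hL hc _ hn]

/-- Uniform integrability of the scaled squared norms of means of i.i.d. centered vectors. -/
theorem tendsto_setIntegral_mul_norm_sampleMean_sq (hX : ∀ j, Measurable (X j))
    (hind : iIndepFun X P) (hid : ∀ j, IdentDistrib (X j) (X 0) P P)
    (hL : MemLp (X 0) 2 P) (hc : ∫ ω, X 0 ω ∂P = 0) {A : ℕ → Set Ω}
    (hA0 : Tendsto (fun n => P.real (A n)) atTop (𝓝 0)) :
    Tendsto (fun n : ℕ => ∫ ω in A n, n * ‖sampleMean X n ω‖ ^ 2 ∂P) atTop (𝓝 0) := by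
  obtain ⟨d, φ, C, hC, h⟩ := exists_coord_norm_sq_le V
  have hLj : ∀ j, MemLp (X j) 2 P := fun j => (hid j).memLp_iff.2 hL
  have hint : ∀ (n : ℕ) (φ : V →L[ℝ] ℝ), Integrable (fun ω => n * φ (sampleMean X n ω) ^ 2) P :=
    fun n φ => (φ.comp_memLp' (memLp_sampleMean hLj n)).integrable_sq.const_mul _
  have hlim : Tendsto (fun n : ℕ => C * ∑ i, ∫ ω in A n, n * φ i (sampleMean X n ω) ^ 2 ∂P) atTop
      (𝓝 0) := by
    have : (0 : ℝ) = C * ∑ i : Fin d, 0 := by simp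
    rw [this]
    refine (tendsto_finsetSum _ fun i _ => ?_).const_mul C
    have hφ : Measurable (φ i) := (φ i).measurable
    simp_rw [map_sampleMean]
    refine tendsto_setIntegral_mul_sampleMean_sq (X := fun j ω => φ i (X j ω))
      (fun j => hφ.comp (hX j)) (hind.comp (fun _ => φ i) fun _ => hφ)
      (fun j => (hid j).comp hφ) ((φ i).comp_memLp' hL) ?_ hA0
    rw [(φ i).integral_comp_comm (hL.integrable one_le_two), hc, map_zero]
  refine squeeze_zero (fun n => integral_nonneg fun ω => by positivity) (fun n => ?_) hlim
  calc ∫ ω in A n, n * ‖sampleMean X n ω‖ ^ 2 ∂P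
      ≤ ∫ ω in A n, C * ∑ i, n * φ i (sampleMean X n ω) ^ 2 ∂P := by
        refine integral_mono (integrable_mul_norm_sampleMean_sq hid hL n).integrableOn
          ((integrable_finsetSum _ fun i _ => hint n _).const_mul C).integrableOn fun ω => ?_
        have h1 : (0 : ℝ) ≤ n := n.cast_nonneg
        have h2 := mul_le_mul_of_nonneg_left (h (sampleMean X n ω)) h1
        simp only [← Finset.mul_sum]
        linarith
    _ = _ := by
        rw [integral_const_mul, integral_finsetSum _ fun i _ => (hint n _).integrableOn]

/-- Deviation probabilities of means of i.i.d. centered square integrable vectors are `o(1 / n)`. -/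
theorem tendsto_mul_measure_norm_sampleMean_ge (hX : ∀ j, Measurable (X j))
    (hind : iIndepFun X P) (hid : ∀ j, IdentDistrib (X j) (X 0) P P)
    (hL : MemLp (X 0) 2 P) (hc : ∫ ω, X 0 ω ∂P = 0) {ε : ℝ} (hε : 0 < ε) :
    Tendsto (fun n : ℕ => n * P.real {ω | ε ≤ ‖sampleMean X n ω‖}) atTop (𝓝 0) := by
  obtain ⟨C, hC⟩ := exists_integral_mul_norm_sampleMean_sq_le hind hid hL hc
  have hm : ∀ n, MeasurableSet {ω | ε ≤ ‖sampleMean X n ω‖} := fun n =>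
    measurableSet_le measurable_const (measurable_sampleMean hX n).norm
  -- Chebyshev, keeping the integral over the deviation event. Bounding that integral by a constant
  -- gives probability `O(1 / n)`; the events thus become negligible, and uniform integrability
  -- improves the rate to `o(1 / n)`.
  have hset : ∀ n : ℕ, n * P.real {ω | ε ≤ ‖sampleMean X n ω‖} ≤
      (ε ^ 2)⁻¹ * ∫ ω in {ω | ε ≤ ‖sampleMean X n ω‖}, n * ‖sampleMean X n ω‖ ^ 2 ∂P := fun n => by
    rw [inv_mul_eq_div, le_div_iff₀ (by positivity)]
    calc n * P.real {ω | ε ≤ ‖sampleMean X n ω‖} * ε ^ 2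
        = ∫ ω in {ω | ε ≤ ‖sampleMean X n ω‖}, n * ε ^ 2 ∂P := by simp; ring
      _ ≤ _ := by
        refine setIntegral_mono_on (integrable_const _)
          (integrable_mul_norm_sampleMean_sq hid hL n).integrableOn (hm n) fun ω hω => ?_
        have : ε ≤ ‖sampleMean X n ω‖ := hω
        gcongr
  have h0 : Tendsto (fun n : ℕ => P.real {ω | ε ≤ ‖sampleMean X n ω‖}) atTop (𝓝 0) := by
    have h1 : Tendsto (fun n : ℕ => ((ε ^ 2)⁻¹ * C) / (n : ℝ)) atTop (𝓝 0) :=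
      tendsto_const_div_atTop_nhds_zero_nat _
    refine squeeze_zero' (Eventually.of_forall fun n => measureReal_nonneg) ?_ h1
    filter_upwards [eventually_gt_atTop 0] with n hn
    rw [le_div_iff₀ (by exact_mod_cast hn), mul_comm]
    refine (hset n).trans ?_
    gcongr
    exact (setIntegral_le_integral (integrable_mul_norm_sampleMean_sq hid hL n)
      (ae_of_all _ fun ω => by positivity)).trans (hC n)
  have h2 := (tendsto_setIntegral_mul_norm_sampleMean_sq hX hind hid hL hc h0).const_mul
    ((ε ^ 2)⁻¹)
  rw [mul_zero] at h2
  exact squeeze_zero (fun n => by positivity) hset h2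

end VectorMoments

/-! ### Deterministic analysis of the logistic log-likelihood. -/

section Logistic

open Real (sigmoid)

theorem hasDerivAt_softplus (t : ℝ) :
    HasDerivAt (fun t => Real.log (1 + Real.exp t)) (sigmoid t) t := by
  have h := ((Real.hasDerivAt_exp t).const_add 1).log (by positivity)
  convert h using 1
  rw [Real.sigmoid_def, Real.exp_neg]
  field_simp
  ring

theorem exp_div_one_add_exp (t : ℝ) : Real.exp t / (1 + Real.exp t) = sigmoid t := by
  rw [Real.sigmoid_def, Real.exp_neg]
  field_simp
  ring

/-- The product is `sigmoid t * sigmoid (-t)`, and both arguments are at least `-T`. -/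
theorem sq_sigmoid_neg_le {T t : ℝ} (ht : |t| ≤ T) :
    sigmoid (-T) ^ 2 ≤ sigmoid t * (1 - sigmoid t) := by
  rw [← Real.sigmoid_neg, sq]
  obtain ⟨h1, h2⟩ := abs_le.1 ht
  exact mul_le_mul (Real.sigmoid_le h1) (Real.sigmoid_le (by linarith)) (Real.sigmoid_nonneg _)
    (Real.sigmoid_nonneg _)

/-- Strong convexity of the softplus function on bounded intervals. -/
theorem le_softplus_bregman {T t s : ℝ} (ht : |t| ≤ T) (hts : |t + s| ≤ T) :
    sigmoid (-T) ^ 2 / 2 * s ^ 2 ≤ Real.log (1 + Real.exp (t + s)) - Real.log (1 + Real.exp t) -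
      sigmoid t * s := by
  set c := sigmoid (-T) ^ 2 / 2 with hc
  -- On `[-T, T]` the second derivative of softplus is at least `2 c`, so `g` is convex there. The
  -- claim is its tangent line inequality at `t`.
  let g : ℝ → ℝ := fun u => Real.log (1 + Real.exp u) - c * u ^ 2
  have hg : ∀ u, HasDerivAt g (sigmoid u - 2 * c * u) u := fun u => by
    have h : HasDerivAt g _ u := (hasDerivAt_softplus u).sub ((hasDerivAt_pow 2 u).const_mul c)
    refine h.congr_deriv ?_
    push_cast
    ring
  have hgd : deriv g = fun u => sigmoid u - 2 * c * u := funext fun u => (hg u).deriv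
  have hg' : ∀ u, HasDerivAt (fun u => sigmoid u - 2 * c * u)
      (sigmoid u * (1 - sigmoid u) - 2 * c) u := fun u => by
    have h : HasDerivAt (fun u => sigmoid u - 2 * c * u) _ u :=
      (Real.hasDerivAt_sigmoid u).sub ((hasDerivAt_id u).const_mul (2 * c))
    exact h.congr_deriv (by ring)
  have hconv : ConvexOn ℝ (Set.Icc (-T) T) g := by
    refine convexOn_of_deriv2_nonneg' (convex_Icc _ _)
      (fun u _ => (hg u).differentiableAt.differentiableWithinAt) ?_ fun u hu => ?_
    · rw [hgd]
      exact fun u _ => (hg' u).differentiableAt.differentiableWithinAt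
    · rw [Function.iterate_succ, Function.iterate_one, Function.comp_apply, hgd, (hg' u).deriv]
      have := sq_sigmoid_neg_le (abs_le.2 hu)
      linarith
  have ht' : t ∈ Set.Icc (-T) T := abs_le.1 ht
  have hts' : t + s ∈ Set.Icc (-T) T := abs_le.1 hts
  have key : (sigmoid t - 2 * c * t) * s ≤ g (t + s) - g t := by
    rcases lt_trichotomy s 0 with hs | rfl | hs
    · have h := hconv.slope_le_of_hasDerivAt hts' ht' (by linarith) (hg t)
      rw [slope_def_field, show t - (t + s) = -s by ring, div_le_iff₀ (by linarith)] at h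
      linarith
    · simp
    · have h := hconv.le_slope_of_hasDerivAt ht' hts' (by linarith) (hg t)
      rw [slope_def_field, show t + s - t = s by ring, le_div_iff₀ hs] at h
      linarith
  simp only [g] at key
  nlinarith

theorem softplus_bregman_nonneg (t s : ℝ) :
    0 ≤ Real.log (1 + Real.exp (t + s)) - Real.log (1 + Real.exp t) - sigmoid t * s :=
  (by positivity : (0 : ℝ) ≤ sigmoid (-(max |t| |t + s|)) ^ 2 / 2 * s ^ 2).trans
    (le_softplus_bregman (le_max_left _ _) (le_max_right _ _))

theorem concaveOn_neg_softplus :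
    ConcaveOn ℝ Set.univ (fun t : ℝ => -Real.log (1 + Real.exp t)) := by
  refine ConvexOn.neg ?_
  refine MonotoneOn.convexOn_of_deriv convex_univ
    (fun t _ => (hasDerivAt_softplus t).continuousAt.continuousWithinAt)
    (fun t _ => (hasDerivAt_softplus t).differentiableAt.differentiableWithinAt) ?_
  rw [funext fun t => (hasDerivAt_softplus t).deriv]
  exact Real.sigmoid_monotone.monotoneOn _

/-- The mean value theorem, applied on the interval between `t` and `t + s` according to the sign of
`s`. -/
theorem exists_sigmoid_sub_eq (t s : ℝ) : ∃ u, |u - t| ≤ |s| ∧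
    sigmoid (t + s) - sigmoid t = sigmoid u * (1 - sigmoid u) * s := by
  rcases lt_trichotomy s 0 with hs | rfl | hs
  · obtain ⟨u, hu, h⟩ := exists_hasDerivAt_eq_slope sigmoid (fun u => sigmoid u * (1 - sigmoid u))
      (show t + s < t by linarith) continuous_sigmoid.continuousOn
      fun u _ => Real.hasDerivAt_sigmoid u
    refine ⟨u, ?_, ?_⟩
    · rw [abs_of_neg hs, abs_of_neg (by linarith [hu.2])]
      linarith [hu.1]
    · rw [h, show t - (t + s) = -s by ring]
      have := hs.ne
      field_simp
      ring
  · exact ⟨t, by simp⟩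
  · obtain ⟨u, hu, h⟩ := exists_hasDerivAt_eq_slope sigmoid (fun u => sigmoid u * (1 - sigmoid u))
      (show t < t + s by linarith) continuous_sigmoid.continuousOn
      fun u _ => Real.hasDerivAt_sigmoid u
    refine ⟨u, ?_, ?_⟩
    · rw [abs_of_pos hs, abs_of_pos (by linarith [hu.1])]
      linarith [hu.2]
    · rw [h, show t + s - t = s by ring]
      field_simp

theorem sigmoid_mul_one_sub_mem (t : ℝ) : sigmoid t * (1 - sigmoid t) ∈ Set.Icc 0 1 := by
  have h0 := Real.sigmoid_nonneg t
  have h1 := Real.sigmoid_le_one t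
  constructor <;> nlinarith

theorem abs_sigmoid_sub_le (t s : ℝ) : |sigmoid (t + s) - sigmoid t| ≤ |s| := by
  obtain ⟨u, -, h⟩ := exists_sigmoid_sub_eq t s
  obtain ⟨h0, h1⟩ := sigmoid_mul_one_sub_mem u
  rw [h, abs_mul, abs_of_nonneg h0]
  exact mul_le_of_le_one_left (abs_nonneg _) h1

/-- The first order Taylor remainder of the sigmoid function. -/
theorem abs_sigmoid_taylor_le (t s : ℝ) :
    |sigmoid (t + s) - sigmoid t - sigmoid t * (1 - sigmoid t) * s| ≤ |s| * min 1 |s| := by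
  obtain ⟨u, hu, h⟩ := exists_sigmoid_sub_eq t s
  rw [h, ← sub_mul, abs_mul, mul_comm]
  gcongr
  refine le_min ?_ ?_
  · obtain ⟨h0, h1⟩ := sigmoid_mul_one_sub_mem u
    obtain ⟨h2, h3⟩ := sigmoid_mul_one_sub_mem t
    exact abs_le.2 ⟨by linarith, by linarith⟩
  · have h1 := abs_sigmoid_sub_le t (u - t)
    rw [add_sub_cancel] at h1
    -- The map `p ↦ p (1 - p)` is 1-Lipschitz on `[0, 1]`.
    have h2 : sigmoid u * (1 - sigmoid u) - sigmoid t * (1 - sigmoid t) =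
        (sigmoid u - sigmoid t) * (1 - sigmoid u - sigmoid t) := by ring
    have h3 : |1 - sigmoid u - sigmoid t| ≤ 1 := by
      have := Real.sigmoid_nonneg t
      have := Real.sigmoid_nonneg u
      have := Real.sigmoid_le_one t
      have := Real.sigmoid_le_one u
      exact abs_le.2 ⟨by linarith, by linarith⟩
    rw [h2, abs_mul]
    exact (mul_le_of_le_one_right (abs_nonneg _) h3).trans (h1.trans hu)

variable {E : Type*} [NormedAddCommGroup E] [InnerProductSpace ℝ E]

/-- The logistic log-likelihood of `n` responses `r` with design vectors `x`. -/
noncomputable def logisticObjective (n : ℕ) (x : ℕ → E) (r : ℕ → ℝ) (b : E) : ℝ :=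
  ∑ j ∈ Finset.range n, (r j * inner ℝ b (x j) - Real.log (1 + Real.exp (inner ℝ b (x j))))

/-- The score, i.e. the gradient of the logistic log-likelihood. -/
noncomputable def logisticScore (n : ℕ) (x : ℕ → E) (r : ℕ → ℝ) (b : E) : E :=
  ∑ j ∈ Finset.range n, (r j - sigmoid (inner ℝ b (x j))) • x j

variable {n : ℕ} {x : ℕ → E} {r : ℕ → ℝ} {β : E}

theorem concaveOn_logisticObjective : ConcaveOn ℝ Set.univ (logisticObjective n x r) := by
  have h : logisticObjective n x r = ∑ j ∈ Finset.range n, fun b =>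
      (r j * inner ℝ b (x j) - Real.log (1 + Real.exp (inner ℝ b (x j)))) := by
    ext b; simp [logisticObjective]
  rw [h]
  refine Finset.sum_induction _ (ConcaveOn ℝ Set.univ) (fun f g => ConcaveOn.add)
    (concaveOn_const 0 convex_univ) fun j _ => ?_
  have h1 := concaveOn_neg_softplus.comp_linearMap ((innerSL ℝ (x j)).toLinearMap)
  have h2 : ConcaveOn ℝ Set.univ (fun b : E => r j * inner ℝ b (x j)) := by
    have := (((r j) • (innerSL ℝ (x j)).toLinearMap).concaveOn (convex_univ (𝕜 := ℝ) (E := E)))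
    refine (congrArg (ConcaveOn ℝ Set.univ) (funext fun b => ?_)).mp this
    simp [real_inner_comm]
  refine (congrArg (ConcaveOn ℝ Set.univ) (funext fun b => ?_)).mp (h2.add h1)
  simp [real_inner_comm, sub_eq_add_neg]

theorem continuous_logisticObjective : Continuous (logisticObjective n x r) := by
  unfold logisticObjective
  refine continuous_finsetSum _ fun j _ => ?_
  have h : Continuous fun t : ℝ => Real.log (1 + Real.exp t) :=
    continuous_iff_continuousAt.2 fun t => (hasDerivAt_softplus t).continuousAt
  have h' : Continuous fun b : E => (inner ℝ b (x j) : ℝ) := by fun_prop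
  exact (h'.const_mul (r j)).sub (h.comp h')

/-- The remainder is a sum of Bregman divergences of softplus that does not involve the responses,
so strong concavity depends on the design alone. -/
theorem logisticObjective_add (h : E) :
    logisticObjective n x r (β + h) = logisticObjective n x r β +
      inner ℝ (logisticScore n x r β) h - ∑ j ∈ Finset.range n,
        (Real.log (1 + Real.exp (inner ℝ β (x j) + inner ℝ h (x j))) -
          Real.log (1 + Real.exp (inner ℝ β (x j))) - sigmoid (inner ℝ β (x j)) *
          inner ℝ h (x j)) := by
  simp only [logisticObjective, logisticScore, sum_inner, ← Finset.sum_add_distrib,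
    ← Finset.sum_sub_distrib]
  refine Finset.sum_congr rfl fun j _ => ?_
  rw [inner_add_left, real_inner_smul_left, real_inner_comm h (x j)]
  ring

/-- If the log-likelihood is strongly concave in the unit ball around `β` and the score at `β` is
small then the log-likelihood has a maximiser, and all maximisers are close to `β`. -/
theorem exists_maximiser [FiniteDimensional ℝ E] {c : ℝ} (hc : 0 < c)
    (hD : ∀ h : E, ‖h‖ ≤ 1 → c * ‖h‖ ^ 2 ≤ ∑ j ∈ Finset.range n,
        (Real.log (1 + Real.exp (inner ℝ β (x j) + inner ℝ h (x j))) -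
          Real.log (1 + Real.exp (inner ℝ β (x j))) - sigmoid (inner ℝ β (x j)) *
          inner ℝ h (x j)))
    (hU : ‖logisticScore n x r β‖ < c) :
    (∃ b, ∀ b', logisticObjective n x r b' ≤ logisticObjective n x r b) ∧
    ∀ b, (∀ b', logisticObjective n x r b' ≤ logisticObjective n x r b) →
      ‖b - β‖ ≤ ‖logisticScore n x r β‖ / c := by
  set L := logisticObjective n x r with hL
  set U := logisticScore n x r β with hUdef
  have hle : ∀ h : E, ‖h‖ ≤ 1 → L (β + h) ≤ L β + ‖U‖ * ‖h‖ - c * ‖h‖ ^ 2 := fun h hh => by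
    have h1 := real_inner_le_norm U h
    have h2 := hD h hh
    rw [hL, logisticObjective_add]
    linarith
  -- By concavity, a value at least `L β` outside the unit ball would force such a value at the
  -- point of the unit sphere in the same direction. There `hle` gives at most `L β + ‖U‖ - c < L
  -- β`.
  have hout : ∀ h : E, 1 < ‖h‖ → L (β + h) < L β := fun h hh => by
    by_contra! hcon
    have hpos : 0 < ‖h‖ := by linarith
    have hconc := concaveOn_logisticObjective (n := n) (x := x) (r := r)
    have hinv : 0 ≤ 1 - ‖h‖⁻¹ := sub_nonneg.2 (inv_le_one_of_one_le₀ hh.le)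
    have h1 := hconc.2 (Set.mem_univ β) (Set.mem_univ (β + h)) hinv (inv_nonneg.2 hpos.le)
      (sub_add_cancel _ _)
    have h2 : (1 - ‖h‖⁻¹) • β + ‖h‖⁻¹ • (β + h) = β + ‖h‖⁻¹ • h := by module
    have h3 : ‖(‖h‖⁻¹ • h)‖ = 1 := by
      rw [norm_smul, norm_inv, norm_norm, inv_mul_cancel₀ hpos.ne']
    have h4 := hle _ h3.le
    rw [h3] at h4
    rw [h2] at h1
    simp only [smul_eq_mul] at h1
    have h5 : 0 ≤ ‖h‖⁻¹ * (L (β + h) - L β) := mul_nonneg (by positivity) (by linarith)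
    change (1 - ‖h‖⁻¹) * L β + ‖h‖⁻¹ * L (β + h) ≤ L (β + ‖h‖⁻¹ • h) at h1
    nlinarith
  have hin : ∀ b, (∀ b', L b' ≤ L b) → ‖b - β‖ ≤ 1 := fun b hb => by
    by_contra! hcon
    have h1 := hout _ hcon
    rw [add_sub_cancel] at h1
    exact absurd (hb β) (not_le.2 h1)
  refine ⟨?_, fun b hb => ?_⟩
  · obtain ⟨b, hb, hmax⟩ := (isCompact_closedBall β 1).exists_isMaxOn
      ⟨β, Metric.mem_closedBall_self zero_le_one⟩
      (continuous_logisticObjective (n := n) (x := x) (r := r)).continuousOn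
    refine ⟨b, fun b' => ?_⟩
    by_cases h : b' ∈ Metric.closedBall β 1
    · exact hmax h
    · have h1 := hout (b' - β) (by simpa [dist_eq_norm] using h)
      rw [add_sub_cancel] at h1
      exact h1.le.trans (hmax (Metric.mem_closedBall_self zero_le_one))
  · have h1 := hle _ (hin b hb)
    rw [add_sub_cancel] at h1
    have h2 := hb β
    rw [le_div_iff₀ hc]
    rcases (norm_nonneg (b - β)).eq_or_lt with h0 | h0
    · rw [← h0]; simp
    · nlinarith

theorem logisticScore_eq_zero {b : E}
    (hb : ∀ b', logisticObjective n x r b' ≤ logisticObjective n x r b) :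
    logisticScore n x r b = 0 := by
  have h : ∀ v : E, inner ℝ (logisticScore n x r b) v = 0 := fun v => by
    have hd : HasDerivAt (fun s : ℝ => logisticObjective n x r (b + s • v))
        (inner ℝ (logisticScore n x r b) v) 0 := by
      simp only [logisticObjective, logisticScore, sum_inner]
      refine HasDerivAt.fun_sum fun j _ => ?_
      have hl : HasDerivAt (fun s : ℝ => (inner ℝ (b + s • v) (x j) : ℝ)) (inner ℝ v (x j)) 0 := by
        simp only [inner_add_left, real_inner_smul_left]
        simpa using ((hasDerivAt_id (0 : ℝ)).mul_const (inner ℝ v (x j) : ℝ)).const_add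
          (inner ℝ b (x j) : ℝ)
      have hs := (hasDerivAt_softplus (inner ℝ (b + (0 : ℝ) • v) (x j))).comp 0 hl
      refine ((hl.const_mul (r j)).sub hs).congr_deriv ?_
      rw [real_inner_smul_left, zero_smul, add_zero, real_inner_comm v (x j)]
      ring
    refine IsLocalMax.hasDerivAt_eq_zero (Eventually.of_forall fun s => ?_) hd
    simpa using hb _
  exact inner_self_eq_zero.1 (h _)

/-- The score at `β` is, up to a Taylor remainder, the information applied to the deviation of a
maximiser from `β`. -/
theorem norm_logisticScore_sub_le {b : E}
    (hb : ∀ b', logisticObjective n x r b' ≤ logisticObjective n x r b) :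
    ‖logisticScore n x r β - ∑ j ∈ Finset.range n, (sigmoid (inner ℝ β (x j)) *
      (1 - sigmoid (inner ℝ β (x j))) * inner ℝ (b - β) (x j)) • x j‖ ≤
      ‖b - β‖ * ∑ j ∈ Finset.range n, ‖x j‖ ^ 2 * min 1 (‖b - β‖ * ‖x j‖) := by
  have h0 := logisticScore_eq_zero hb
  have h1 : logisticScore n x r β - ∑ j ∈ Finset.range n, (sigmoid (inner ℝ β (x j)) *
      (1 - sigmoid (inner ℝ β (x j))) * inner ℝ (b - β) (x j)) • x j =
      ∑ j ∈ Finset.range n, (sigmoid (inner ℝ β (x j) + inner ℝ (b - β) (x j)) -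
        sigmoid (inner ℝ β (x j)) - sigmoid (inner ℝ β (x j)) *
        (1 - sigmoid (inner ℝ β (x j))) * inner ℝ (b - β) (x j)) • x j := by
    -- Subtracting the vanishing score at `b` cancels the responses and leaves only sigmoid
    -- increments.
    rw [← sub_zero (logisticScore n x r β), ← h0]
    simp only [logisticScore, ← Finset.sum_sub_distrib, ← sub_smul]
    refine Finset.sum_congr rfl fun j _ => ?_
    rw [← inner_add_left, add_sub_cancel]
    congr 1
    ring
  rw [h1, Finset.mul_sum]
  refine (norm_sum_le _ _).trans (Finset.sum_le_sum fun j _ => ?_)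
  have h2 : |inner ℝ (b - β) (x j)| ≤ ‖b - β‖ * ‖x j‖ := abs_real_inner_le_norm _ _
  rw [norm_smul]
  calc _ ≤ (‖b - β‖ * ‖x j‖ * min 1 (‖b - β‖ * ‖x j‖)) * ‖x j‖ := by
        refine mul_le_mul_of_nonneg_right ((abs_sigmoid_taylor_le _ _).trans ?_) (norm_nonneg _)
        gcongr
    _ = _ := by ring

end Logistic

/-! ### Weak law of large numbers. -/

section WeakLaw

variable {Ω : Type*} [MeasurableSpace Ω] {P : Measure Ω} [IsProbabilityMeasure P]
  {V : Type*} [NormedAddCommGroup V] [NormedSpace ℝ V] [CompleteSpace V]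
  [SecondCountableTopology V] [MeasurableSpace V] [BorelSpace V] {X : ℕ → Ω → V}

/-- The strong law implies convergence in measure. First moments suffice, at the price of having no
rate. -/
theorem tendsto_measure_norm_sampleMean_sub_ge (hX : ∀ j, Measurable (X j)) (hind : iIndepFun X P)
    (hid : ∀ j, IdentDistrib (X j) (X 0) P P) (hi : Integrable (X 0) P) {ε : ℝ} (hε : 0 < ε) :
    Tendsto (fun n : ℕ => P.real {ω | ε ≤ ‖sampleMean X n ω - ∫ ω, X 0 ω ∂P‖}) atTop (𝓝 0) := by
  have h := strong_law_ae X hi (fun i j hij => hind.indepFun hij) hid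
  have h1 := tendstoInMeasure_of_tendsto_ae (μ := P) (f := sampleMean X)
    (g := fun _ => ∫ ω, X 0 ω ∂P) (fun n => (measurable_sampleMean hX n).aestronglyMeasurable) h
  exact tendstoInMeasure_iff_measureReal_norm.1 h1 ε hε

end WeakLaw

/-! ### Gram operators of the design. -/

section Gram

theorem measurable_indicator_closedBall {E : Type*} [NormedAddCommGroup E] [MeasurableSpace E]
    [BorelSpace E] (R : ℝ) :
    Measurable ((Metric.closedBall (0 : E) R).indicator fun _ => (1 : ℝ)) :=
  measurable_const.indicator measurableSet_closedBall

/-- The cap at one makes `‖x‖²` a dominating function, so no third moment of the design is needed to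
make the Taylor remainder of the score small. -/
theorem eventually_integral_norm_sq_min_lt {E Ω : Type*} [NormedAddCommGroup E]
    [MeasurableSpace E] [BorelSpace E] [MeasurableSpace Ω] {P : Measure Ω} {x : Ω → E}
    (hxm : Measurable x) (hx : MemLp x 2 P) {η : ℝ}
    (hη : 0 < η) : ∀ᶠ k : ℕ in atTop,
      ∫ ω, ‖x ω‖ ^ 2 * min 1 (1 / ((k : ℝ) + 1) * ‖x ω‖) ∂P < η := by
  have h : Tendsto (fun k : ℕ => ∫ ω, ‖x ω‖ ^ 2 * min 1 (1 / ((k : ℝ) + 1) * ‖x ω‖) ∂P) atTop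
      (𝓝 (∫ _, (0 : ℝ) ∂P)) := by
    refine tendsto_integral_of_dominated_convergence (fun ω => ‖x ω‖ ^ 2) (fun k => ?_)
      hx.norm.integrable_sq (fun k => ae_of_all _ fun ω => ?_) (ae_of_all _ fun ω => ?_)
    · have := hxm.norm
      exact ((this.pow_const 2).mul
        (measurable_const.min (this.const_mul _))).aestronglyMeasurable
    · rw [Real.norm_of_nonneg (by positivity)]
      exact mul_le_of_le_one_right (by positivity) (min_le_left _ _)
    · have h1 := (tendsto_one_div_add_atTop_nhds_zero_nat (𝕜 := ℝ)).mul_const ‖x ω‖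
      rw [zero_mul] at h1
      have h2 := ((tendsto_const_nhds (x := (1 : ℝ))).min h1).const_mul (‖x ω‖ ^ 2)
      simpa using h2
  rw [integral_zero] at h
  exact h.eventually (gt_mem_nhds hη)

variable {E : Type*} [NormedAddCommGroup E] [InnerProductSpace ℝ E]

open InnerProductSpace (rankOne)

theorem continuous_rankOne_self : Continuous fun x : E => rankOne ℝ x x :=
  (rankOne ℝ (E := E) (F := E)).continuous.clm_apply continuous_id

theorem inner_rankOne_self (x h : E) : inner ℝ (rankOne ℝ x x h) h = (inner ℝ h x : ℝ) ^ 2 := by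
  rw [InnerProductSpace.rankOne_apply, real_inner_smul_left, real_inner_comm, sq]

theorem norm_rankOne_self (x : E) : ‖rankOne ℝ x x‖ = ‖x‖ ^ 2 := by
  rw [InnerProductSpace.norm_rankOne, sq]

/-- The quadratic form attains a positive minimum on the compact unit sphere; homogeneity does the
rest. -/
theorem exists_mul_norm_sq_le_inner [FiniteDimensional ℝ E] (T : E →L[ℝ] E)
    (hT : ∀ h, h ≠ 0 → 0 < inner ℝ (T h) h) :
    ∃ κ > 0, ∀ h, κ * ‖h‖ ^ 2 ≤ inner ℝ (T h) h := by
  rcases subsingleton_or_nontrivial E with hE | hE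
  · exact ⟨1, one_pos, fun h => by simp [Subsingleton.elim h 0]⟩
  have hcont : Continuous fun h : E => (inner ℝ (T h) h : ℝ) := by fun_prop
  obtain ⟨h₀, hh₀, hmin⟩ := (isCompact_sphere (0 : E) 1).exists_isMinOn
    (NormedSpace.sphere_nonempty.2 zero_le_one) hcont.continuousOn
  have hne : h₀ ≠ 0 := by
    rintro rfl
    simp at hh₀
  refine ⟨_, hT h₀ hne, fun h => ?_⟩
  rcases eq_or_ne h 0 with rfl | hh
  · simp
  have hpos : 0 < ‖h‖ := norm_pos_iff.2 hh
  have h1 : ‖h‖⁻¹ • h ∈ Metric.sphere (0 : E) 1 := by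
    simp [norm_smul, hpos.ne']
  have h2 : (inner ℝ (T h₀) h₀ : ℝ) ≤ inner ℝ (T (‖h‖⁻¹ • h)) (‖h‖⁻¹ • h) := hmin h1
  rw [map_smul, real_inner_smul_left, real_inner_smul_right] at h2
  calc (inner ℝ (T h₀) h₀ : ℝ) * ‖h‖ ^ 2
      ≤ (‖h‖⁻¹ * (‖h‖⁻¹ * inner ℝ (T h) h)) * ‖h‖ ^ 2 := by gcongr
    _ = inner ℝ (T h) h := by field_simp

variable [FiniteDimensional ℝ E] {Ω : Type*} [MeasurableSpace Ω] {P : Measure Ω}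
  [MeasurableSpace E] [BorelSpace E] {x : Ω → E}

theorem measurable_smul_rankOne {w : E → ℝ} (hw : Measurable w) :
    Measurable fun y : E => w y • rankOne ℝ y y :=
  hw.smul continuous_rankOne_self.measurable

theorem integrable_smul_rankOne (hxm : Measurable x) (hx : MemLp x 2 P) {w : E → ℝ}
    (hw : Measurable w) (hw1 : ∀ y, w y ∈ Set.Icc 0 1) :
    Integrable (fun ω => w (x ω) • rankOne ℝ (x ω) (x ω)) P := by
  refine hx.norm.integrable_sq.mono' ?_ (ae_of_all _ fun ω => ?_)
  · exact ((measurable_smul_rankOne hw).comp hxm).aestronglyMeasurable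
  · rw [norm_smul, norm_rankOne_self, Real.norm_of_nonneg (hw1 _).1]
    exact mul_le_of_le_one_left (by positivity) (hw1 _).2

theorem inner_integral_rankOne (hxm : Measurable x) (hx : MemLp x 2 P) {w : E → ℝ}
    (hw : Measurable w) (hw1 : ∀ y, w y ∈ Set.Icc 0 1) (h : E) :
    inner ℝ ((∫ ω, w (x ω) • rankOne ℝ (x ω) (x ω) ∂P) h) h =
      ∫ ω, w (x ω) * (inner ℝ h (x ω) : ℝ) ^ 2 ∂P := by
  have hi := integrable_smul_rankOne hxm hx hw hw1
  rw [ContinuousLinearMap.integral_apply hi, real_inner_comm,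
    ← integral_inner (hi.apply_continuousLinearMap h)]
  refine integral_congr_ae (ae_of_all _ fun ω => ?_)
  simp only [smul_apply]
  rw [real_inner_smul_right, real_inner_comm, inner_rankOne_self]

/-- A weighted Gram operator with positive weights of a non-degenerate random vector is positive
definite. -/
theorem inner_integral_rankOne_pos (hxm : Measurable x) (hx : MemLp x 2 P)
    (hnd : ∀ h, (∀ᵐ ω ∂P, inner ℝ h (x ω) = (0 : ℝ)) → h = 0) {w : E → ℝ}
    (hw : Measurable w) (hw1 : ∀ y, w y ∈ Set.Icc 0 1) (hw0 : ∀ y, 0 < w y) {h : E} (hh : h ≠ 0) :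
    0 < inner ℝ ((∫ ω, w (x ω) • rankOne ℝ (x ω) (x ω) ∂P) h) h := by
  rw [inner_integral_rankOne hxm hx hw hw1]
  have hnn : ∀ ω, 0 ≤ w (x ω) * (inner ℝ h (x ω) : ℝ) ^ 2 := fun ω =>
    mul_nonneg (hw0 _).le (sq_nonneg _)
  refine (integral_nonneg hnn).lt_of_ne fun h0 => hh (hnd h ?_)
  have hint : Integrable (fun ω => w (x ω) * (inner ℝ h (x ω) : ℝ) ^ 2) P := by
    refine ((hx.const_inner h).integrable_sq).mono' ?_ (ae_of_all _ fun ω => ?_)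
    · exact ((hw.comp hxm).mul ((hxm.const_inner (c := h)).pow_const 2)).aestronglyMeasurable
    · rw [Real.norm_of_nonneg (hnn ω)]
      exact mul_le_of_le_one_left (sq_nonneg _) (hw1 _).2
  have := (integral_eq_zero_iff_of_nonneg hnn hint).1 h0.symm
  filter_upwards [this] with ω hω
  simpa [(hw0 (x ω)).ne'] using hω

/-- Positive definiteness gives injectivity, which is invertibility in finite dimension. -/
theorem exists_equiv_integral_rankOne (hxm : Measurable x) (hx : MemLp x 2 P)
    (hnd : ∀ h, (∀ᵐ ω ∂P, inner ℝ h (x ω) = (0 : ℝ)) → h = 0) {w : E → ℝ}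
    (hw : Measurable w) (hw1 : ∀ y, w y ∈ Set.Icc 0 1) (hw0 : ∀ y, 0 < w y) :
    ∃ J : E ≃L[ℝ] E, (J : E →L[ℝ] E) = ∫ ω, w (x ω) • rankOne ℝ (x ω) (x ω) ∂P := by
  set T := ∫ ω, w (x ω) • rankOne ℝ (x ω) (x ω) ∂P with hT
  have hinj : Function.Injective (T : E →ₗ[ℝ] E) := by
    rw [injective_iff_map_eq_zero]
    intro h hh
    by_contra hne
    have := inner_integral_rankOne_pos hxm hx hnd hw hw1 hw0 hne
    rw [← hT, show T h = 0 from hh] at this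
    simp at this
  refine ⟨(LinearEquiv.ofInjectiveEndo (T : E →ₗ[ℝ] E) hinj).toContinuousLinearEquiv, ?_⟩
  ext h
  rfl

/-- For a non-degenerate random vector the Gram operator of a truncation is positive definite. -/
theorem exists_truncated_gram_lower_bound (hxm : Measurable x) (hx : MemLp x 2 P)
    (hnd : ∀ h, (∀ᵐ ω ∂P, inner ℝ h (x ω) = (0 : ℝ)) → h = 0) :
    ∃ (R : ℝ) (κ : ℝ), 0 ≤ R ∧ 0 < κ ∧ ∀ h, κ * ‖h‖ ^ 2 ≤
      inner ℝ ((∫ ω, (Metric.closedBall (0 : E) R).indicator (fun _ => (1 : ℝ)) (x ω) •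
        rankOne ℝ (x ω) (x ω) ∂P) h) h := by
  set T := ∫ ω, (1 : ℝ) • rankOne ℝ (x ω) (x ω) ∂P with hT
  obtain ⟨κ, hκ, hκT⟩ := exists_mul_norm_sq_le_inner T fun h hh =>
    inner_integral_rankOne_pos hxm hx hnd (w := fun _ => 1) measurable_const (by simp) (by simp) hh
  have hw1 : ∀ (R : ℝ) y, (Metric.closedBall (0 : E) R).indicator (fun _ => (1 : ℝ)) y ∈
      Set.Icc (0 : ℝ) 1 := fun R y => by
    by_cases h : y ∈ Metric.closedBall (0 : E) R
    · simp [Set.indicator_of_mem h]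
    · simp [Set.indicator_of_notMem h]
  -- The truncated operators converge in norm to the full one, whose lower bound is `κ`. Once they
  -- are within `κ / 2`, half of the bound survives.
  have hlim : Tendsto (fun R : ℕ => ∫ ω, (Metric.closedBall (0 : E) R).indicator
      (fun _ => (1 : ℝ)) (x ω) • rankOne ℝ (x ω) (x ω) ∂P) atTop (𝓝 T) := by
    refine tendsto_integral_of_dominated_convergence (fun ω => ‖x ω‖ ^ 2)
      (fun R => (integrable_smul_rankOne hxm hx (measurable_indicator_closedBall R) (hw1 R)).aestronglyMeasurable)
      hx.norm.integrable_sq (fun R => ae_of_all _ fun ω => ?_) (ae_of_all _ fun ω => ?_)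
    · rw [norm_smul, norm_rankOne_self, Real.norm_of_nonneg (hw1 R _).1]
      exact mul_le_of_le_one_left (by positivity) (hw1 R _).2
    · refine tendsto_const_nhds.congr' ?_
      obtain ⟨M₀, hM₀⟩ := exists_nat_ge ‖x ω‖
      filter_upwards [eventually_ge_atTop M₀] with M hM
      have : x ω ∈ Metric.closedBall (0 : E) M := by
        rw [mem_closedBall_zero_iff]
        exact hM₀.trans (by exact_mod_cast hM)
      rw [Set.indicator_of_mem this]
  obtain ⟨R, hR⟩ := (hlim.eventually (Metric.ball_mem_nhds T (half_pos hκ))).exists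
  refine ⟨R, κ / 2, R.cast_nonneg, half_pos hκ, fun h => ?_⟩
  set TR := ∫ ω, (Metric.closedBall (0 : E) R).indicator
      (fun _ => (1 : ℝ)) (x ω) • rankOne ℝ (x ω) (x ω) ∂P
  have h1 : ‖T - TR‖ ≤ κ / 2 := by
    rw [← dist_eq_norm, dist_comm]
    exact (Metric.mem_ball.1 hR).le
  have h2 : (inner ℝ ((T - TR) h) h : ℝ) ≤ κ / 2 * ‖h‖ ^ 2 := by
    refine (real_inner_le_norm _ _).trans ?_
    rw [sq, ← mul_assoc]
    gcongr
    exact (ContinuousLinearMap.le_opNorm _ _).trans (by gcongr)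
  rw [sub_apply, inner_sub_left] at h2
  have h3 := hκT h
  linarith

end Gram

/-! ### Existence and rate of maximisers for random samples. -/

section Asymptotics

open Real (sigmoid)
open InnerProductSpace (rankOne)

section Weight

variable {E : Type*} [NormedAddCommGroup E] [InnerProductSpace ℝ E]

/-- The weight of a design vector in the Fisher information of the logistic model. -/
noncomputable def logisticWeight (β y : E) : ℝ :=
  sigmoid (inner ℝ β y) * (1 - sigmoid (inner ℝ β y))

theorem logisticWeight_mem (β y : E) : logisticWeight β y ∈ Set.Icc (0 : ℝ) 1 :=
  sigmoid_mul_one_sub_mem _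

theorem logisticWeight_pos (β y : E) : 0 < logisticWeight β y :=
  mul_pos (Real.sigmoid_pos _) (sub_pos.2 (Real.sigmoid_lt_one _))

variable [MeasurableSpace E] [BorelSpace E]

theorem measurable_sigmoid_inner (β : E) : Measurable fun y : E => sigmoid (inner ℝ β y) :=
  continuous_sigmoid.measurable.comp (continuous_const.inner continuous_id).measurable

theorem measurable_logisticWeight (β : E) : Measurable (logisticWeight β) :=
  (measurable_sigmoid_inner β).mul ((measurable_sigmoid_inner β).const_sub 1)

theorem measurable_scoreFun (β : E) :
    Measurable fun y : E × ℝ => (y.2 - sigmoid (inner ℝ β y.1)) • y.1 :=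
  (measurable_snd.sub ((measurable_sigmoid_inner β).comp measurable_fst)).smul measurable_fst

end Weight

variable {Ω : Type*} [MeasurableSpace Ω] {P : Measure Ω} {E : Type*} [NormedAddCommGroup E]
  [InnerProductSpace ℝ E] [MeasurableSpace E]

/-- An i.i.d. sample of design vectors `x` and responses `r` in the unit interval with a
non-degenerate square integrable design, whose logistic score at `β` is centered. -/
structure LogisticSample (P : Measure Ω) (β : E) (x : ℕ → Ω → E) (r : ℕ → Ω → ℝ) : Prop where
  measurable_x : ∀ j, Measurable (x j)
  measurable_r : ∀ j, Measurable (r j)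
  indep : iIndepFun (fun j ω => (x j ω, r j ω)) P
  identDistrib : ∀ j, IdentDistrib (fun ω => (x j ω, r j ω)) (fun ω => (x 0 ω, r 0 ω)) P P
  memLp_x : MemLp (x 0) 2 P
  r_mem : ∀ᵐ ω ∂P, r 0 ω ∈ Set.Icc (0 : ℝ) 1
  nondegenerate : ∀ h, (∀ᵐ ω ∂P, inner ℝ h (x 0 ω) = (0 : ℝ)) → h = 0
  integral_score : ∫ ω, (r 0 ω - sigmoid (inner ℝ β (x 0 ω))) • x 0 ω ∂P = 0

/-- The residual is at most one in absolute value, so the score is dominated by the design vector.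
-/
theorem memLp_score_of_mem [BorelSpace E] [FiniteDimensional ℝ E] {β : E} {x : Ω → E} {r : Ω → ℝ}
    (hxm : Measurable x) (hrm : Measurable r) (hx : MemLp x 2 P)
    (hr : ∀ᵐ ω ∂P, r ω ∈ Set.Icc (0 : ℝ) 1) :
    MemLp (fun ω => (r ω - sigmoid (inner ℝ β (x ω))) • x ω) 2 P := by
  refine hx.mono ((measurable_scoreFun β).comp (hxm.prodMk hrm)).aestronglyMeasurable ?_
  filter_upwards [hr] with ω hω
  rw [norm_smul]
  refine mul_le_of_le_one_left (norm_nonneg _) (abs_le.2 ?_)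
  have := Real.sigmoid_nonneg (inner ℝ β (x ω))
  have := Real.sigmoid_le_one (inner ℝ β (x ω))
  constructor <;> linarith [hω.1, hω.2]

namespace LogisticSample

variable {β : E} {x : ℕ → Ω → E} {r : ℕ → Ω → ℝ}

theorem iIndepFun_x (hs : LogisticSample P β x r) {V : Type*} [MeasurableSpace V] {g : E → V}
    (hg : Measurable g) : iIndepFun (fun j ω => g (x j ω)) P :=
  hs.indep.comp (fun _ y => g y.1) fun _ => hg.comp measurable_fst

theorem identDistrib_x (hs : LogisticSample P β x r) {V : Type*} [MeasurableSpace V] {g : E → V}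
    (hg : Measurable g) (j : ℕ) :
    IdentDistrib (fun ω => g (x j ω)) (fun ω => g (x 0 ω)) P P :=
  (hs.identDistrib j).comp (hg.comp measurable_fst)

variable [BorelSpace E] [FiniteDimensional ℝ E]

theorem memLp_score (hs : LogisticSample P β x r) :
    MemLp (fun ω => (r 0 ω - sigmoid (inner ℝ β (x 0 ω))) • x 0 ω) 2 P :=
  memLp_score_of_mem (hs.measurable_x 0) (hs.measurable_r 0) hs.memLp_x hs.r_mem

variable [IsProbabilityMeasure P]

/-- Bounded terms are square integrable, which yields the rate `o(1 / n)`. The bare rank-one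
operators `x ⊗ x` would require fourth moments of the design, hence the truncating weight in the
application. -/
theorem tendsto_mul_measure_gram_ge (hs : LogisticSample P β x r) {w : E → ℝ} (hw : Measurable w)
    {C : ℝ} (hC : ∀ y, ‖w y • rankOne ℝ y y‖ ≤ C) {T : E →L[ℝ] E}
    (hT : T = ∫ ω, w (x 0 ω) • rankOne ℝ (x 0 ω) (x 0 ω) ∂P) {ε : ℝ} (hε : 0 < ε) :
    Tendsto (fun n : ℕ => n * P.real {ω | ε ≤ ‖sampleMean (fun j ω =>
      w (x j ω) • rankOne ℝ (x j ω) (x j ω) - T) n ω‖}) atTop (𝓝 0) := by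
  have hg : Measurable fun y : E => w y • rankOne ℝ y y - T :=
    (measurable_smul_rankOne hw).sub_const T
  have hL' : MemLp (fun ω => w (x 0 ω) • rankOne ℝ (x 0 ω) (x 0 ω)) 2 P :=
    MemLp.of_bound ((measurable_smul_rankOne hw).comp (hs.measurable_x 0)).aestronglyMeasurable C
      (ae_of_all _ fun ω => hC _)
  have hL : MemLp (fun ω => w (x 0 ω) • rankOne ℝ (x 0 ω) (x 0 ω) - T) 2 P :=
    hL'.sub (memLp_const T)
  have hc : ∫ ω, (w (x 0 ω) • rankOne ℝ (x 0 ω) (x 0 ω) - T) ∂P = 0 := by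
    rw [integral_sub (hL'.integrable one_le_two) (integrable_const _), ← hT]
    simp
  exact tendsto_mul_measure_norm_sampleMean_ge
    (X := fun j ω => w (x j ω) • rankOne ℝ (x j ω) (x j ω) - T)
    (fun j => hg.comp (hs.measurable_x j)) (hs.iIndepFun_x hg) (hs.identDistrib_x hg) hL hc hε

/-- Outside an event of probability `o(1 / n)`, the log-likelihood has a maximiser, and all
maximisers are within a constant multiple of the mean score from `β`. -/
theorem exists_maximiser_event (hs : LogisticSample P β x r) :
    ∃ (C : ℝ) (N : ℕ → Set Ω), 0 < C ∧ (∀ n, MeasurableSet (N n)) ∧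
      Tendsto (fun n : ℕ => n * P.real (N n)) atTop (𝓝 0) ∧
      ∀ n : ℕ, n ≠ 0 → ∀ ω ∉ N n,
        (∃ b, ∀ b', logisticObjective n (fun j => x j ω) (fun j => r j ω) b' ≤
          logisticObjective n (fun j => x j ω) (fun j => r j ω) b) ∧
        ∀ b, (∀ b', logisticObjective n (fun j => x j ω) (fun j => r j ω) b' ≤
          logisticObjective n (fun j => x j ω) (fun j => r j ω) b) →
          ‖b - β‖ ≤ C * ‖sampleMean
            (fun j ω => (r j ω - sigmoid (inner ℝ β (x j ω))) • x j ω) n ω‖ := by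
  obtain ⟨R, κ, hR, hκ, hT⟩ := exists_truncated_gram_lower_bound (hs.measurable_x 0) hs.memLp_x
    hs.nondegenerate
  set w : E → ℝ := (Metric.closedBall (0 : E) R).indicator (fun _ => (1 : ℝ)) with hw
  set T := ∫ ω, w (x 0 ω) • rankOne ℝ (x 0 ω) (x 0 ω) ∂P with hTdef
  set ξ : ℕ → Ω → E := fun j ω => (r j ω - sigmoid (inner ℝ β (x j ω))) • x j ω with hξ
  set κ' : ℕ → Ω → E →L[ℝ] E := fun j ω => w (x j ω) • rankOne ℝ (x j ω) (x j ω) - T with hκ'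
  -- For design vectors in the ball of radius `R` and `‖h‖ ≤ 1`, both linear predictors are at most
  -- `(‖β‖ + 1) * R` in absolute value, so `c₀` bounds the curvature of softplus.
  let c₀ := sigmoid (-((‖β‖ + 1) * R)) ^ 2 / 2
  have hc₀ : 0 < c₀ := by
    have := Real.sigmoid_pos (-((‖β‖ + 1) * R))
    positivity
  let c := c₀ * (κ / 2)
  have hc : 0 < c := by positivity
  have hκm : ∀ j, Measurable (κ' j) := fun j =>
    ((measurable_smul_rankOne (measurable_indicator_closedBall R)).sub_const T).comp (hs.measurable_x j)
  have hξm : ∀ j, Measurable (ξ j) := fun j => (measurable_scoreFun β).comp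
    ((hs.measurable_x j).prodMk (hs.measurable_r j))
  have hwC : ∀ y, ‖w y • rankOne ℝ y y‖ ≤ R ^ 2 := fun y => by
    by_cases h : y ∈ Metric.closedBall (0 : E) R
    · rw [hw, Set.indicator_of_mem h, one_smul, norm_rankOne_self]
      have := mem_closedBall_zero_iff.1 h
      gcongr
    · rw [hw, Set.indicator_of_notMem h, zero_smul, norm_zero]
      positivity
  -- Off the first event the empirical truncated Gram operator keeps the lower bound `κ / 2`; off
  -- the second the mean score is smaller than the resulting curvature `c`.
  refine ⟨c⁻¹, fun n => {ω | κ / 2 ≤ ‖sampleMean κ' n ω‖} ∪ {ω | c ≤ ‖sampleMean ξ n ω‖},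
    inv_pos.2 hc, fun n => ?_, ?_, ?_⟩
  · exact (measurableSet_le measurable_const (measurable_sampleMean hκm n).norm).union
      (measurableSet_le measurable_const (measurable_sampleMean hξm n).norm)
  · have h1 := hs.tendsto_mul_measure_gram_ge (measurable_indicator_closedBall R) hwC hTdef (half_pos hκ)
    have h2 := tendsto_mul_measure_norm_sampleMean_ge hξm
      (hs.indep.comp (fun _ y => (y.2 - sigmoid (inner ℝ β y.1)) • y.1)
        fun _ => measurable_scoreFun β)
      (fun j => (hs.identDistrib j).comp (measurable_scoreFun β)) hs.memLp_score
      hs.integral_score hc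
    have h3 := h1.add h2
    rw [add_zero] at h3
    refine squeeze_zero (fun n => by positivity) (fun n => ?_) h3
    rw [← mul_add]
    gcongr
    exact measureReal_union_le _ _
  · intro n hn ω hω
    have hn0 : (0 : ℝ) < n := by exact_mod_cast Nat.pos_of_ne_zero hn
    simp only [Set.mem_union, Set.mem_ofPred_eq, not_or, not_le] at hω
    have hU : logisticScore n (fun j => x j ω) (fun j => r j ω) β = (n : ℝ) • sampleMean ξ n ω := by
      simp only [logisticScore, sampleMean, hξ]
      rw [smul_smul, mul_inv_cancel₀ hn0.ne', one_smul]
    have hD : ∀ h : E, ‖h‖ ≤ 1 → n * c * ‖h‖ ^ 2 ≤ ∑ j ∈ Finset.range n,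
        (Real.log (1 + Real.exp (inner ℝ β (x j ω) + inner ℝ h (x j ω))) -
          Real.log (1 + Real.exp (inner ℝ β (x j ω))) - sigmoid (inner ℝ β (x j ω)) *
          inner ℝ h (x j ω)) := fun h hh => by
      -- Observations outside the ball only help: their divergences are nonnegative and are dropped.
      have h1 : ∀ j, c₀ * (w (x j ω) * (inner ℝ h (x j ω) : ℝ) ^ 2) ≤
          Real.log (1 + Real.exp (inner ℝ β (x j ω) + inner ℝ h (x j ω))) -
          Real.log (1 + Real.exp (inner ℝ β (x j ω))) - sigmoid (inner ℝ β (x j ω)) *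
          inner ℝ h (x j ω) := fun j => by
        by_cases hj : x j ω ∈ Metric.closedBall (0 : E) R
        · have hj' := mem_closedBall_zero_iff.1 hj
          rw [hw, Set.indicator_of_mem hj, one_mul]
          refine le_softplus_bregman ?_ ?_
          · refine (abs_real_inner_le_norm _ _).trans ?_
            have : ‖β‖ * ‖x j ω‖ ≤ ‖β‖ * R := by gcongr
            linarith
          · rw [← inner_add_left]
            refine (abs_real_inner_le_norm _ _).trans ?_
            gcongr
            exact (norm_add_le _ _).trans (by gcongr)
        · rw [hw, Set.indicator_of_notMem hj, zero_mul, mul_zero]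
          exact softplus_bregman_nonneg _ _
      refine le_trans ?_ (Finset.sum_le_sum fun j _ => h1 j)
      have h2 : ∑ j ∈ Finset.range n, w (x j ω) * (inner ℝ h (x j ω) : ℝ) ^ 2 =
          n * inner ℝ ((sampleMean κ' n ω + T) h) h := by
        have h3 : sampleMean κ' n ω + T = (n : ℝ)⁻¹ • ∑ j ∈ Finset.range n,
            w (x j ω) • rankOne ℝ (x j ω) (x j ω) := by
          simp only [sampleMean, hκ', Finset.sum_sub_distrib, smul_sub]
          simp only [Finset.sum_const, Finset.card_range, ← Nat.cast_smul_eq_nsmul ℝ, smul_smul,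
            inv_mul_cancel₀ hn0.ne', one_smul, sub_add_cancel]
        rw [h3, smul_apply, real_inner_smul_left, ← mul_assoc, mul_inv_cancel₀ hn0.ne', one_mul,
          sum_apply, sum_inner]
        refine Finset.sum_congr rfl fun j _ => ?_
        rw [smul_apply, real_inner_smul_left, inner_rankOne_self]
      have h4 : -(κ / 2 * ‖h‖ ^ 2) ≤ inner ℝ (sampleMean κ' n ω h) h := by
        have h5 := abs_real_inner_le_norm (sampleMean κ' n ω h) h
        have h6 : ‖sampleMean κ' n ω h‖ * ‖h‖ ≤ κ / 2 * ‖h‖ ^ 2 := by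
          rw [sq, ← mul_assoc]
          gcongr
          exact (ContinuousLinearMap.le_opNorm _ _).trans (by gcongr; exact hω.1.le)
        linarith [neg_abs_le (inner ℝ (sampleMean κ' n ω h) h : ℝ)]
      rw [← Finset.mul_sum, h2, add_apply, inner_add_left]
      have h7 := hT h
      have h8 : κ / 2 * ‖h‖ ^ 2 ≤ inner ℝ (sampleMean κ' n ω h) h + inner ℝ (T h) h := by linarith
      calc n * c * ‖h‖ ^ 2 = c₀ * (n * (κ / 2 * ‖h‖ ^ 2)) := by simp only [c]; ring
        _ ≤ _ := by gcongr
    have hUn : ‖logisticScore n (fun j => x j ω) (fun j => r j ω) β‖ = n * ‖sampleMean ξ n ω‖ := by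
      rw [hU, norm_smul, RCLike.norm_natCast]
    have hlt : ‖logisticScore n (fun j => x j ω) (fun j => r j ω) β‖ < n * c := by
      rw [hUn]
      exact mul_lt_mul_of_pos_left hω.2 hn0
    obtain ⟨hex, hall⟩ := exists_maximiser (by positivity) hD hlt
    refine ⟨hex, fun b hb => (hall b hb).trans_eq ?_⟩
    rw [hUn]
    field_simp

end LogisticSample

end Asymptotics

/-! ### Expected excess of a function with a quadratic expansion. -/

section Excess

open Real (sigmoid)
open InnerProductSpace (rankOne)

/-- The null sequence `e` may depend on `η` while `C` may not: `η` is fixed first, then `n` grows.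
-/
theorem tendsto_of_forall_abs_sub_le {a : ℕ → ℝ} {l C : ℝ}
    (h : ∀ η > 0, ∃ e : ℕ → ℝ, Tendsto e atTop (𝓝 0) ∧ ∀ᶠ n in atTop, |a n - l| ≤ η * C + e n) :
    Tendsto a atTop (𝓝 l) := by
  refine Metric.tendsto_nhds.2 fun ε hε => ?_
  obtain ⟨e, he, hle⟩ := h (ε / (2 * (|C| + 1))) (by positivity)
  filter_upwards [hle, he.eventually (gt_mem_nhds (half_pos hε))] with n h1 h2
  have h3 : ε / (2 * (|C| + 1)) * C ≤ ε / 2 := by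
    rw [div_mul_eq_mul_div, div_le_iff₀ (by positivity)]
    nlinarith [le_abs_self C]
  rw [Real.dist_eq]
  linarith

theorem abs_bilin_self_le {E : Type*} [NormedAddCommGroup E] [NormedSpace ℝ E]
    (q : E →L[ℝ] E →L[ℝ] ℝ) (v : E) : |q v v| ≤ ‖q‖ * ‖v‖ ^ 2 := by
  rw [sq, ← mul_assoc]
  exact q.le_opNorm₂ v v

theorem abs_bilin_self_sub_le {E : Type*} [NormedAddCommGroup E] [NormedSpace ℝ E]
    (q : E →L[ℝ] E →L[ℝ] ℝ) (h v : E) :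
    |q h h - q v v| ≤ ‖q‖ * ‖h - v‖ * (‖h‖ + ‖v‖) := by
  have h1 : q h h - q v v = q (h - v) h + q v (h - v) := by
    simp only [map_sub, sub_apply]
    ring
  rw [h1]
  refine (abs_add_le _ _).trans ?_
  have h2 := q.le_opNorm₂ (h - v) h
  have h3 := q.le_opNorm₂ v (h - v)
  rw [Real.norm_eq_abs] at h2 h3
  linarith

/-- A bounded function with a second order expansion without a linear term has quadratic
increments. -/
theorem exists_abs_sub_le_mul_norm_sq {E : Type*} [NormedAddCommGroup E] [NormedSpace ℝ E]
    {f : E → ℝ} {β : E} (hf01 : ∀ b, f b ∈ Set.Icc (0 : ℝ) 1) {q : E →L[ℝ] E →L[ℝ] ℝ}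
    (hf : (fun h => f (β + h) - f β - q h h) =o[𝓝 0] fun h => ‖h‖ ^ 2) :
    ∃ C, 0 ≤ C ∧ ∀ h, |f (β + h) - f β| ≤ C * ‖h‖ ^ 2 := by
  obtain ⟨δ, hδ, hball⟩ := Metric.eventually_nhds_iff.1 (hf.bound one_pos)
  -- The terms `1 + ‖q‖` serve the ball where the expansion holds; `(δ ^ 2)⁻¹` serves its
  -- complement, where the increment is at most one.
  refine ⟨1 + ‖q‖ + (δ ^ 2)⁻¹, by positivity, fun h => ?_⟩
  by_cases hh : ‖h‖ < δ
  · have h1 := hball (show dist h 0 < δ by simpa using hh)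
    rw [Real.norm_eq_abs, norm_pow, norm_norm, one_mul] at h1
    have h2 := abs_bilin_self_le q h
    have h3 := abs_add_le (f (β + h) - f β - q h h) (q h h)
    rw [sub_add_cancel] at h3
    have h4 : 0 ≤ (δ ^ 2)⁻¹ * ‖h‖ ^ 2 := by positivity
    linarith
  · push Not at hh
    have h1 : |f (β + h) - f β| ≤ 1 := by
      have := hf01 (β + h)
      have := hf01 β
      exact abs_le.2 ⟨by linarith [this.2, (hf01 (β + h)).1], by linarith [this.1, (hf01 (β + h)).2]⟩
    have h2 : 1 ≤ (δ ^ 2)⁻¹ * ‖h‖ ^ 2 := by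
      rw [inv_mul_eq_div, one_le_div (by positivity)]
      gcongr
    have h3 : 0 ≤ (1 + ‖q‖) * ‖h‖ ^ 2 := by positivity
    linarith

variable {Ω : Type*} [MeasurableSpace Ω] {P : Measure Ω} {E : Type*} [NormedAddCommGroup E]
  [InnerProductSpace ℝ E] [MeasurableSpace E] [BorelSpace E] [FiniteDimensional ℝ E]
  [IsProbabilityMeasure P] {β : E} {x : ℕ → Ω → E} {r : ℕ → Ω → ℝ}

namespace LogisticSample

/-- With probability tending to one, the deviation of a maximiser from `β` is given to first order
by the mean score. -/
theorem exists_linearisation_event (hs : LogisticSample P β x r) {J : E →L[ℝ] E}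
    (hJ : J = ∫ ω, logisticWeight β (x 0 ω) • rankOne ℝ (x 0 ω) (x 0 ω) ∂P) {η : ℝ} (hη : 0 < η) :
    ∀ᶠ k : ℕ in atTop, ∃ M : ℕ → Set Ω, (∀ n, MeasurableSet (M n)) ∧
      Tendsto (fun n => P.real (M n)) atTop (𝓝 0) ∧
      ∀ n : ℕ, n ≠ 0 → ∀ ω ∉ M n, ∀ b,
        (∀ b', logisticObjective n (fun j => x j ω) (fun j => r j ω) b' ≤
          logisticObjective n (fun j => x j ω) (fun j => r j ω) b) →
        ‖b - β‖ ≤ 1 / ((k : ℝ) + 1) →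
        ‖sampleMean (fun j ω => (r j ω - sigmoid (inner ℝ β (x j ω))) • x j ω) n ω -
          J (b - β)‖ ≤ 2 * η * ‖b - β‖ := by
  filter_upwards [eventually_integral_norm_sq_min_lt (hs.measurable_x 0) hs.memLp_x (half_pos hη)]
    with k hk
  set δ : ℝ := 1 / ((k : ℝ) + 1) with hδ
  have hδ0 : 0 < δ := by positivity
  let g : E → ℝ := fun y => ‖y‖ ^ 2 * min 1 (δ * ‖y‖)
  have hg : Measurable g := (measurable_norm.pow_const 2).mul
    (measurable_const.min (measurable_norm.const_mul _))
  have hgi : Integrable (fun ω => g (x 0 ω)) P := by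
    refine hs.memLp_x.norm.integrable_sq.mono' (hg.comp (hs.measurable_x 0)).aestronglyMeasurable
      (ae_of_all _ fun ω => ?_)
    rw [Real.norm_of_nonneg (by simp only [g]; positivity)]
    exact mul_le_of_le_one_right (by positivity) (min_le_left _ _)
  have hw := measurable_smul_rankOne (measurable_logisticWeight β)
  have hwi := integrable_smul_rankOne (hs.measurable_x 0) hs.memLp_x (measurable_logisticWeight β)
    (logisticWeight_mem β)
  let Jn : ℕ → Ω → E →L[ℝ] E :=
    sampleMean fun j ω => logisticWeight β (x j ω) • rankOne ℝ (x j ω) (x j ω)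
  let gn : ℕ → Ω → ℝ := sampleMean fun j ω => g (x j ω)
  have h1 : Tendsto (fun n => P.real {ω | η ≤ ‖Jn n ω - J‖}) atTop (𝓝 0) := by
    rw [hJ]
    exact tendsto_measure_norm_sampleMean_sub_ge
      (X := fun j ω => logisticWeight β (x j ω) • rankOne ℝ (x j ω) (x j ω))
      (fun j => hw.comp (hs.measurable_x j)) (hs.iIndepFun_x hw) (hs.identDistrib_x hw) hwi hη
  have h2 : Tendsto (fun n => P.real {ω | η / 2 ≤ ‖gn n ω - ∫ ω, g (x 0 ω) ∂P‖}) atTop (𝓝 0) :=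
    tendsto_measure_norm_sampleMean_sub_ge (X := fun j ω => g (x j ω))
      (fun j => hg.comp (hs.measurable_x j)) (hs.iIndepFun_x hg) (hs.identDistrib_x hg) hgi
      (half_pos hη)
  -- One weak law controls the empirical information, the other the average Taylor remainder factor;
  -- each contributes `η ‖b - β‖`.
  refine ⟨fun n => {ω | η ≤ ‖Jn n ω - J‖} ∪ {ω | η / 2 ≤ ‖gn n ω - ∫ ω, g (x 0 ω) ∂P‖},
    fun n => ?_, ?_, ?_⟩
  · have m1 : Measurable (Jn n) := measurable_sampleMean (fun j => hw.comp (hs.measurable_x j)) n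
    have m2 : Measurable (gn n) := measurable_sampleMean (fun j => hg.comp (hs.measurable_x j)) n
    exact (measurableSet_le measurable_const (m1.sub_const _).norm).union
      (measurableSet_le measurable_const (m2.sub_const _).norm)
  · have h3 := h1.add h2
    rw [add_zero] at h3
    exact squeeze_zero (fun n => measureReal_nonneg) (fun n => measureReal_union_le _ _) h3
  · intro n hn ω hω b hb hbδ
    have hn0 : (0 : ℝ) < n := by exact_mod_cast Nat.pos_of_ne_zero hn
    simp only [Set.mem_union, Set.mem_ofPred_eq, not_or, not_le] at hω
    obtain ⟨hωJ, hωg⟩ := hω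
    have hgη : gn n ω ≤ η := by
      have h3 : ∫ ω, g (x 0 ω) ∂P < η / 2 := hk
      have h4 := (abs_lt.1 hωg).2
      linarith
    have hrem := norm_logisticScore_sub_le (β := β) hb
    have e1 : sampleMean (fun j ω => (r j ω - sigmoid (inner ℝ β (x j ω))) • x j ω) n ω -
        Jn n ω (b - β) = (n : ℝ)⁻¹ • (logisticScore n (fun j => x j ω) (fun j => r j ω) β -
          ∑ j ∈ Finset.range n, (sigmoid (inner ℝ β (x j ω)) *
          (1 - sigmoid (inner ℝ β (x j ω))) * inner ℝ (b - β) (x j ω)) • x j ω) := by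
      rw [smul_sub]
      congr 1
      simp only [Jn, sampleMean, smul_apply, sum_apply]
      congr 1
      refine Finset.sum_congr rfl fun j _ => ?_
      rw [InnerProductSpace.rankOne_apply, smul_smul, real_inner_comm]
      rfl
    have h5 : ‖sampleMean (fun j ω => (r j ω - sigmoid (inner ℝ β (x j ω))) • x j ω) n ω -
        Jn n ω (b - β)‖ ≤ ‖b - β‖ * gn n ω := by
      rw [e1, norm_smul, norm_inv, RCLike.norm_natCast]
      calc (n : ℝ)⁻¹ * _ ≤ (n : ℝ)⁻¹ * (‖b - β‖ * ∑ j ∈ Finset.range n,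
            ‖x j ω‖ ^ 2 * min 1 (‖b - β‖ * ‖x j ω‖)) := by gcongr
        _ ≤ (n : ℝ)⁻¹ * (‖b - β‖ * ∑ j ∈ Finset.range n, g (x j ω)) := by
            simp only [g]
            gcongr
        _ = ‖b - β‖ * gn n ω := by simp only [gn, sampleMean, smul_eq_mul]; ring
    have h6 : ‖Jn n ω (b - β) - J (b - β)‖ ≤ η * ‖b - β‖ := by
      rw [← sub_apply]
      exact (ContinuousLinearMap.le_opNorm _ _).trans (by gcongr)
    have h7 := norm_sub_le_norm_sub_add_norm_sub
      (sampleMean (fun j ω => (r j ω - sigmoid (inner ℝ β (x j ω))) • x j ω) n ω)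
      (Jn n ω (b - β)) (J (b - β))
    have h8 : ‖b - β‖ * gn n ω ≤ ‖b - β‖ * η := by gcongr
    linarith

/-- The asymptotic expected excess of a bounded function with a second order expansion at `β`,
evaluated at a maximum likelihood estimator. -/
theorem tendsto_mul_integral_sub (hs : LogisticSample P β x r) {J : E ≃L[ℝ] E}
    (hJ : (J : E →L[ℝ] E) = ∫ ω, logisticWeight β (x 0 ω) • rankOne ℝ (x 0 ω) (x 0 ω) ∂P)
    {f : E → ℝ} (hf01 : ∀ b, f b ∈ Set.Icc (0 : ℝ) 1) {q : E →L[ℝ] E →L[ℝ] ℝ}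
    (hf : (fun h => f (β + h) - f β - q h h) =o[𝓝 0] fun h => ‖h‖ ^ 2)
    {est : ℕ → Ω → E} (hfm : ∀ n, AEStronglyMeasurable (fun ω => f (est n ω)) P)
    (hest : ∀ n, ∀ᵐ ω ∂P,
      (∃ b, ∀ b', logisticObjective n (fun j => x j ω) (fun j => r j ω) b' ≤
        logisticObjective n (fun j => x j ω) (fun j => r j ω) b) →
      ∀ b', logisticObjective n (fun j => x j ω) (fun j => r j ω) b' ≤
        logisticObjective n (fun j => x j ω) (fun j => r j ω) (est n ω)) :
    Tendsto (fun n : ℕ => n * ((∫ ω, f (est n ω) ∂P) - f β)) atTop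
      (𝓝 (∫ ω, (r 0 ω - sigmoid (inner ℝ β (x 0 ω))) ^ 2 *
        q (J.symm (x 0 ω)) (J.symm (x 0 ω)) ∂P)) := by
  obtain ⟨C, N, hC, hNm, hN0, hN⟩ := hs.exists_maximiser_event
  obtain ⟨Cf, hCf0, hCf⟩ := exists_abs_sub_le_mul_norm_sq hf01 hf
  set ξ : ℕ → Ω → E := fun j ω => (r j ω - sigmoid (inner ℝ β (x j ω))) • x j ω with hξ
  have hξm : ∀ j, Measurable (ξ j) := fun j => (measurable_scoreFun β).comp
    ((hs.measurable_x j).prodMk (hs.measurable_r j))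
  have hξind : iIndepFun ξ P := hs.indep.comp (fun _ y => (y.2 - sigmoid (inner ℝ β y.1)) • y.1)
    fun _ => measurable_scoreFun β
  have hξid : ∀ j, IdentDistrib (ξ j) (ξ 0) P P :=
    fun j => (hs.identDistrib j).comp (measurable_scoreFun β)
  have hξL : MemLp (ξ 0) 2 P := hs.memLp_score
  have hξc : ∫ ω, ξ 0 ω ∂P = 0 := hs.integral_score
  let A : E →L[ℝ] E := J.symm
  let Q : E →L[ℝ] E →L[ℝ] ℝ := q.bilinearComp A A
  obtain ⟨C₅, hC₅⟩ := exists_integral_mul_norm_sampleMean_sq_le hξind hξid hξL hξc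
  let u : ℕ → Ω → E := sampleMean ξ
  -- `C₄` is the crude domination constant, valid whenever a maximiser exists near `β`. `C₃`
  -- collects the two errors of order `η` on the good event: the Taylor remainder, and the
  -- replacement of the deviation by `A u`.
  let C₄ : ℝ := Cf * C ^ 2 + ‖Q‖
  have hC₄ : 0 ≤ C₄ := by positivity
  let C₃ : ℝ := C ^ 2 + ‖q‖ * (‖A‖ * (2 * C)) * (C + ‖A‖)
  have hC₃ : 0 ≤ C₃ := by positivity
  have hlim : ∫ ω, (r 0 ω - sigmoid (inner ℝ β (x 0 ω))) ^ 2 *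
        q (J.symm (x 0 ω)) (J.symm (x 0 ω)) ∂P = ∫ ω, Q (ξ 0 ω) (ξ 0 ω) ∂P := by
    refine integral_congr_ae (ae_of_all _ fun ω => ?_)
    simp only [Q, A, hξ, ContinuousLinearMap.bilinearComp_apply, map_smul, smul_apply, smul_eq_mul,
      ContinuousLinearEquiv.coe_coe]
    ring
  rw [hlim]
  refine tendsto_of_forall_abs_sub_le (C := C₃ * C₅) fun η hη => ?_
  obtain ⟨δ, hδ, hball⟩ := Metric.eventually_nhds_iff.1 (hf.bound hη)
  obtain ⟨k, hkδ, M, hMm, hM0, hM⟩ := (((tendsto_one_div_add_atTop_nhds_zero_nat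
    (𝕜 := ℝ)).eventually (gt_mem_nhds hδ)).and (hs.exists_linearisation_event hJ hη)).exists
  set δ' : ℝ := 1 / ((k : ℝ) + 1) with hδ'
  have hδ'0 : 0 < δ' := by positivity
  have hum : ∀ n, Measurable (u n) := fun n => measurable_sampleMean hξm n
  have hDlim : Tendsto (fun n => P.real {ω | δ' / C ≤ ‖u n ω‖}) atTop (𝓝 0) := by
    have := tendsto_measure_norm_sampleMean_sub_ge hξm hξind hξid (hξL.integrable one_le_two)
      (div_pos hδ'0 hC)
    simpa only [hξc, sub_zero] using this
  have hN0' : Tendsto (fun n => P.real (N n)) atTop (𝓝 0) := by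
    refine squeeze_zero' (Eventually.of_forall fun n => measureReal_nonneg) ?_ hN0
    filter_upwards [eventually_ge_atTop 1] with n hn
    have : (1 : ℝ) ≤ n := by exact_mod_cast hn
    exact le_mul_of_one_le_left measureReal_nonneg this
  -- Off the last event, `‖h‖ ≤ C ‖u‖ < δ'`, which puts the deviation in the range of both the
  -- linearisation and the Taylor expansion.
  let B : ℕ → Set Ω := fun n => N n ∪ (M n ∪ {ω | δ' / C ≤ ‖u n ω‖})
  have hBm : ∀ n, MeasurableSet (B n) := fun n => (hNm n).union ((hMm n).union
    (measurableSet_le measurable_const (hum n).norm))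
  have hB0 : Tendsto (fun n => P.real (B n)) atTop (𝓝 0) := by
    have h3 := hN0'.add (hM0.add hDlim)
    simp only [add_zero] at h3
    refine squeeze_zero (fun n => measureReal_nonneg) (fun n => ?_) h3
    exact (measureReal_union_le _ _).trans (by gcongr; exact measureReal_union_le _ _)
  have hUI := tendsto_setIntegral_mul_norm_sampleMean_sq hξm hξind hξid hξL hξc hB0
  refine ⟨fun n => C₄ * (∫ ω in B n, n * ‖u n ω‖ ^ 2 ∂P) + n * P.real (N n), ?_, ?_⟩
  · have := (hUI.const_mul C₄).add hN0
    simpa using this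
  filter_upwards [eventually_ne_atTop 0] with n hn
  have hn0 : (0 : ℝ) < n := by exact_mod_cast Nat.pos_of_ne_zero hn
  have hfi : Integrable (fun ω => f (est n ω)) P := Integrable.of_bound (hfm n) 1
    (ae_of_all _ fun ω => by rw [Real.norm_of_nonneg (hf01 _).1]; exact (hf01 _).2)
  have hQi : Integrable (fun ω => n * Q (u n ω) (u n ω)) P := by
    refine ((integrable_mul_norm_sampleMean_sq hξid hξL n).const_mul ‖Q‖).mono' ?_
      (ae_of_all _ fun ω => ?_)
    · have : Continuous fun v : E => Q v v := by fun_prop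
      exact ((this.measurable.comp (hum n)).const_mul _).aestronglyMeasurable
    · rw [norm_mul, RCLike.norm_natCast]
      have := abs_bilin_self_le Q (u n ω)
      calc (n : ℝ) * ‖Q (u n ω) (u n ω)‖ ≤ n * (‖Q‖ * ‖u n ω‖ ^ 2) := by gcongr; exact this
        _ = _ := by simp only [u]; ring
  -- Three regimes: on `N n` only boundedness of `f` is available, on the rest of `B n` the excess
  -- is dominated by `‖u‖²`, and elsewhere the expansion is accurate up to `η`.
  have hpt : ∀ᵐ ω ∂P, |n * (f (est n ω) - f β) - n * Q (u n ω) (u n ω)| ≤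
      η * C₃ * (n * ‖u n ω‖ ^ 2) + C₄ * (B n).indicator (fun ω => n * ‖u n ω‖ ^ 2) ω +
        (N n).indicator (fun _ => (n : ℝ)) ω := by
    filter_upwards [hest n] with ω hω
    rw [← mul_sub, abs_mul, Nat.abs_cast]
    have hQb := abs_bilin_self_le Q (u n ω)
    have hnn : 0 ≤ n * ‖u n ω‖ ^ 2 := by positivity
    by_cases hωN : ω ∈ N n
    · have hωB : ω ∈ B n := Or.inl hωN
      rw [Set.indicator_of_mem hωN, Set.indicator_of_mem hωB]
      have h1 : |f (est n ω) - f β| ≤ 1 := by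
        have h2 := hf01 (est n ω)
        have h3 := hf01 β
        exact abs_le.2 ⟨by linarith [h2.1, h3.2], by linarith [h2.2, h3.1]⟩
      have h4 := abs_sub (f (est n ω) - f β) (Q (u n ω) (u n ω))
      have h5 : |f (est n ω) - f β - Q (u n ω) (u n ω)| ≤ 1 + C₄ * ‖u n ω‖ ^ 2 := by
        have : 0 ≤ Cf * C ^ 2 * ‖u n ω‖ ^ 2 := by positivity
        simp only [C₄]
        linarith
      have h6 := mul_le_mul_of_nonneg_left h5 hn0.le
      have h7 : 0 ≤ η * C₃ * (n * ‖u n ω‖ ^ 2) := by positivity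
      linarith
    · obtain ⟨hex, hall⟩ := hN n hn ω hωN
      have hmax := hω hex
      have hle : ‖est n ω - β‖ ≤ C * ‖u n ω‖ := hall _ hmax
      rw [Set.indicator_of_notMem hωN, add_zero]
      set h := est n ω - β with hh
      have hfe : f (est n ω) = f (β + h) := by rw [hh, add_sub_cancel]
      by_cases hωB : ω ∈ B n
      · rw [Set.indicator_of_mem hωB]
        have h1 : |f (est n ω) - f β| ≤ Cf * C ^ 2 * ‖u n ω‖ ^ 2 := by
          rw [hfe, mul_assoc, ← mul_pow]
          exact (hCf h).trans (by gcongr)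
        have h4 := abs_sub (f (est n ω) - f β) (Q (u n ω) (u n ω))
        have h5 : |f (est n ω) - f β - Q (u n ω) (u n ω)| ≤ C₄ * ‖u n ω‖ ^ 2 := by
          simp only [C₄]
          linarith
        have h6 := mul_le_mul_of_nonneg_left h5 hn0.le
        have h7 : 0 ≤ η * C₃ * (n * ‖u n ω‖ ^ 2) := by positivity
        linarith
      · rw [Set.indicator_of_notMem hωB, mul_zero, add_zero]
        simp only [B, Set.mem_union, Set.mem_ofPred_eq, not_or, not_le] at hωB
        obtain ⟨-, hωM, hωu⟩ := hωB
        have hhδ : ‖h‖ ≤ δ' := by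
          rw [lt_div_iff₀ hC] at hωu
          linarith
        have hlin : ‖u n ω - J h‖ ≤ 2 * η * ‖h‖ := hM n hn ω hωM _ hmax hhδ
        set v := A (u n ω) with hv
        have hhv : ‖h - v‖ ≤ ‖A‖ * (2 * C) * η * ‖u n ω‖ := by
          have e : v - h = A (u n ω - J h) := by
            rw [map_sub, hv]
            simp [A]
          rw [norm_sub_rev, e]
          calc ‖A (u n ω - J h)‖ ≤ ‖A‖ * (2 * η * (C * ‖u n ω‖)) :=
                (ContinuousLinearMap.le_opNorm _ _).trans (by gcongr; exact hlin.trans (by gcongr))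
            _ = _ := by ring
        have hvn : ‖v‖ ≤ ‖A‖ * ‖u n ω‖ := ContinuousLinearMap.le_opNorm _ _
        have h1 : |f (β + h) - f β - q h h| ≤ η * (C * ‖u n ω‖) ^ 2 := by
          have := hball (show dist h 0 < δ by simpa using hhδ.trans_lt hkδ)
          rw [Real.norm_eq_abs, norm_pow, norm_norm] at this
          exact this.trans (by gcongr)
        have h2 : |q h h - q v v| ≤
            ‖q‖ * (‖A‖ * (2 * C) * η * ‖u n ω‖) * (C * ‖u n ω‖ + ‖A‖ * ‖u n ω‖) :=
          (abs_bilin_self_sub_le q h v).trans (by gcongr)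
        have h3 : Q (u n ω) (u n ω) = q v v := rfl
        have h4 := abs_add_le (f (β + h) - f β - q h h) (q h h - q v v)
        have h5 : |f (est n ω) - f β - Q (u n ω) (u n ω)| ≤ η * C₃ * ‖u n ω‖ ^ 2 := by
          rw [hfe, h3, ← sub_add_sub_cancel _ (q h h) _]
          refine (h4.trans (add_le_add h1 h2)).trans_eq ?_
          simp only [C₃]
          ring
        have h6 := mul_le_mul_of_nonneg_left h5 hn0.le
        linarith
  have hui := integrable_mul_norm_sampleMean_sq hξid hξL n
  have hI1 : Integrable (fun ω => η * C₃ * (n * ‖u n ω‖ ^ 2)) P := hui.const_mul _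
  have hI2 : Integrable (fun ω => C₄ * (B n).indicator (fun ω => n * ‖u n ω‖ ^ 2) ω) P :=
    (hui.indicator (hBm n)).const_mul _
  have hI3 : Integrable ((N n).indicator (fun _ => (n : ℝ))) P :=
    (integrable_const _).indicator (hNm n)
  have hI12 : Integrable (fun ω => η * C₃ * (n * ‖u n ω‖ ^ 2) +
      C₄ * (B n).indicator (fun ω => n * ‖u n ω‖ ^ 2) ω) P := hI1.add hI2
  have hfi' : Integrable (fun ω => n * (f (est n ω) - f β)) P :=
    (hfi.sub (integrable_const _)).const_mul _
  -- The limit equals the expectation of the scaled quadratic form at this very `n`, so the whole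
  -- difference becomes one integral of the pointwise error.
  have e1 : n * ((∫ ω, f (est n ω) ∂P) - f β) - ∫ ω, Q (ξ 0 ω) (ξ 0 ω) ∂P =
      ∫ ω, (n * (f (est n ω) - f β) - n * Q (u n ω) (u n ω)) ∂P := by
    rw [integral_sub hfi' hQi, integral_const_mul, integral_sub hfi (integrable_const _)]
    congr 1
    · simp
    · exact (integral_mul_bilin_sampleMean hξind hξid hξL hξc Q hn).symm
  rw [e1]
  refine (abs_integral_le_integral_abs).trans ?_
  refine (integral_mono_ae (hfi'.sub hQi).abs (hI12.add hI3) hpt).trans ?_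
  have e2 : ∫ ω, ((fun ω => η * C₃ * (n * ‖u n ω‖ ^ 2) +
      C₄ * (B n).indicator (fun ω => n * ‖u n ω‖ ^ 2) ω) + (N n).indicator (fun _ => (n : ℝ))) ω ∂P
      = η * C₃ * (∫ ω, n * ‖u n ω‖ ^ 2 ∂P) + C₄ * (∫ ω in B n, n * ‖u n ω‖ ^ 2 ∂P) +
        n * P.real (N n) := by
    rw [integral_add' hI12 hI3, integral_add hI1 hI2, integral_const_mul (η * C₃), integral_const_mul C₄,
      integral_indicator (hBm n), integral_indicator (hNm n)]
    simp [mul_comm]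
  rw [e2, ← mul_assoc]
  have h9 := mul_le_mul_of_nonneg_left (hC₅ n) (show 0 ≤ η * C₃ by positivity)
  have h10 : ∫ ω, n * ‖u n ω‖ ^ 2 ∂P = ∫ ω, n * ‖sampleMean ξ n ω‖ ^ 2 ∂P := rfl
  rw [h10]
  linarith

end LogisticSample

end Excess

open Finset.HasAntidiagonal (antidiagonal mem_antidiagonal)

/-! ### Moments of the Dirichlet-Multinomial distribution. -/

section DirichletMultinomial

/-- The coefficient `Γ(k + a) / (Γ(a) k!)` of `tᵏ` in the expansion of `(1 - t)⁻ᵃ`. -/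
noncomputable def risingCoeff (a : ℝ) (k : ℕ) : ℝ :=
  Real.Gamma (k + a) / (Real.Gamma a * (k.factorial : ℝ))

variable {a b : ℝ}

theorem risingCoeff_zero (ha : 0 < a) : risingCoeff a 0 = 1 := by
  have := (Real.Gamma_pos_of_pos ha).ne'
  simp [risingCoeff, this]

theorem risingCoeff_pos (ha : 0 < a) (k : ℕ) : 0 < risingCoeff a k := by
  have := Real.Gamma_pos_of_pos ha
  have : 0 < Real.Gamma (k + a) := Real.Gamma_pos_of_pos (by positivity)
  unfold risingCoeff
  positivity

theorem succ_mul_risingCoeff_succ (ha : 0 < a) (k : ℕ) :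
    ((k : ℝ) + 1) * risingCoeff a (k + 1) = (k + a) * risingCoeff a k := by
  have h0 := (Real.Gamma_pos_of_pos ha).ne'
  have h1 : ((k + 1 : ℕ) : ℝ) + a = (k + a) + 1 := by push_cast; ring
  have h2 : (k : ℝ) + a ≠ 0 := by positivity
  have h3 : (k.factorial : ℝ) ≠ 0 := by positivity
  have h4 : (k : ℝ) + 1 ≠ 0 := by positivity
  rw [risingCoeff, risingCoeff, h1, Real.Gamma_add_one h2, Nat.factorial_succ]
  push_cast
  field_simp

theorem succ_mul_risingCoeff_succ' (ha : 0 < a) (k : ℕ) :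
    ((k : ℝ) + 1) * risingCoeff a (k + 1) = a * risingCoeff (a + 1) k := by
  have h0 := (Real.Gamma_pos_of_pos ha).ne'
  have h1 : ((k + 1 : ℕ) : ℝ) + a = k + (a + 1) := by push_cast; ring
  have h3 : (k.factorial : ℝ) ≠ 0 := by positivity
  have h4 : (k : ℝ) + 1 ≠ 0 := by positivity
  rw [risingCoeff, risingCoeff, h1, Real.Gamma_add_one ha.ne', Nat.factorial_succ]
  push_cast
  field_simp

/-- The factor `i` is absorbed by raising the parameter from `a` to `a + 1` and lowering the index;
the term `i = 0` vanishes. Iterating this yields the factorial moments. -/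
theorem sum_mul_risingCoeff (ha : 0 < a) (n : ℕ) (f : ℕ × ℕ → ℝ) :
    ∑ ij ∈ antidiagonal (n + 1), (ij.1 : ℝ) * risingCoeff a ij.1 * f ij =
      a * ∑ ij ∈ antidiagonal n, risingCoeff (a + 1) ij.1 * f (ij.1 + 1, ij.2) := by
  rw [Finset.Nat.sum_antidiagonal_succ, Finset.mul_sum]
  simp only [Nat.cast_zero, zero_mul, zero_add]
  refine Finset.sum_congr rfl fun ij _ => ?_
  push_cast
  rw [succ_mul_risingCoeff_succ' ha]
  ring

/-- The Vandermonde convolution of rising factorials. -/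
theorem sum_risingCoeff_mul (ha : 0 < a) (hb : 0 < b) (n : ℕ) :
    ∑ ij ∈ antidiagonal n, risingCoeff a ij.1 * risingCoeff b ij.2 =
      risingCoeff (a + b) n := by
  induction n with
  | zero => simp [risingCoeff_zero, ha, hb, add_pos ha hb]
  | succ n ih =>
    have hn : (n : ℝ) + 1 ≠ 0 := by positivity
    refine mul_left_cancel₀ hn ?_
    rw [succ_mul_risingCoeff_succ (add_pos ha hb), ← ih]
    -- On the antidiagonal `n + 1 = i + j`. Splitting the sum accordingly and lowering `i` or `j` by
    -- one produces the factors `i + a` and `j + b`, whose sum is `n + a + b`.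
    have h1 : ((n : ℝ) + 1) * ∑ ij ∈ antidiagonal (n + 1),
        risingCoeff a ij.1 * risingCoeff b ij.2 =
        ∑ ij ∈ antidiagonal (n + 1), (ij.1 : ℝ) * risingCoeff a ij.1 * risingCoeff b ij.2 +
        ∑ ij ∈ antidiagonal (n + 1),
          risingCoeff a ij.1 * ((ij.2 : ℝ) * risingCoeff b ij.2) := by
      rw [Finset.mul_sum, ← Finset.sum_add_distrib]
      refine Finset.sum_congr rfl fun ij hij => ?_
      have : (ij.1 : ℝ) + ij.2 = n + 1 := by exact_mod_cast mem_antidiagonal.1 hij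
      rw [← this]
      ring
    rw [h1, Finset.Nat.sum_antidiagonal_succ, Finset.Nat.sum_antidiagonal_succ', Finset.mul_sum]
    simp only [Nat.cast_zero, zero_mul, mul_zero, zero_add]
    rw [← Finset.sum_add_distrib]
    refine Finset.sum_congr rfl fun ij hij => ?_
    have : (ij.1 : ℝ) + ij.2 = n := by exact_mod_cast mem_antidiagonal.1 hij
    push_cast
    rw [succ_mul_risingCoeff_succ ha, succ_mul_risingCoeff_succ hb, ← this]
    ring

theorem sum_fst_mul_risingCoeff (ha : 0 < a) (hb : 0 < b) {n : ℕ} (hn : n ≠ 0) :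
    ∑ ij ∈ antidiagonal n, (ij.1 : ℝ) * (risingCoeff a ij.1 * risingCoeff b ij.2) =
      n * (a / (a + b)) * risingCoeff (a + b) n := by
  obtain ⟨k, rfl⟩ := Nat.exists_eq_succ_of_ne_zero hn
  have h := sum_mul_risingCoeff ha k fun ij => risingCoeff b ij.2
  simp only [mul_assoc] at h
  have hab : 0 < a + b := by positivity
  rw [h, sum_risingCoeff_mul (by positivity) hb]
  have h2 := succ_mul_risingCoeff_succ' hab k
  push_cast
  calc a * risingCoeff (a + 1 + b) k = a / (a + b) * ((a + b) * risingCoeff (a + b + 1) k) := by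
        rw [show a + 1 + b = a + b + 1 by ring]
        field_simp
    _ = _ := by rw [← h2]; ring

theorem sum_fst_mul_pred_mul_risingCoeff (ha : 0 < a) (hb : 0 < b) {n : ℕ} (hn : n ≠ 0) :
    ∑ ij ∈ antidiagonal n, (ij.1 : ℝ) * ((ij.1 : ℝ) - 1) *
      (risingCoeff a ij.1 * risingCoeff b ij.2) =
      n * (n - 1) * (a * (a + 1) / ((a + b) * (a + b + 1))) * risingCoeff (a + b) n := by
  obtain ⟨k, rfl⟩ := Nat.exists_eq_succ_of_ne_zero hn
  have h := sum_mul_risingCoeff ha k fun ij => ((ij.1 : ℝ) - 1) * risingCoeff b ij.2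
  have hab : 0 < a + b := by positivity
  have e : ∑ ij ∈ antidiagonal (k + 1), (ij.1 : ℝ) * ((ij.1 : ℝ) - 1) *
      (risingCoeff a ij.1 * risingCoeff b ij.2) =
      a * ∑ ij ∈ antidiagonal k,
        (ij.1 : ℝ) * (risingCoeff (a + 1) ij.1 * risingCoeff b ij.2) := by
    rw [Finset.sum_congr rfl fun ij _ => show (ij.1 : ℝ) * ((ij.1 : ℝ) - 1) *
      (risingCoeff a ij.1 * risingCoeff b ij.2) = (ij.1 : ℝ) * risingCoeff a ij.1 *
        (((ij.1 : ℝ) - 1) * risingCoeff b ij.2) by ring, h]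
    congr 1
    refine Finset.sum_congr rfl fun ij _ => ?_
    push_cast
    ring
  rw [e]
  rcases eq_or_ne k 0 with rfl | hk
  · simp
  rw [sum_fst_mul_risingCoeff (by positivity) hb hk]
  have h2 := succ_mul_risingCoeff_succ' hab k
  push_cast
  rw [show a + 1 + b = a + b + 1 by ring]
  calc a * (k * ((a + 1) / (a + b + 1)) * risingCoeff (a + b + 1) k)
      = k * (a * (a + 1) / ((a + b) * (a + b + 1))) *
        ((a + b) * risingCoeff (a + b + 1) k) := by field_simp
    _ = _ := by rw [← h2]; ring

/-- The normalising constant is the reciprocal of the rising coefficient of the total concentration,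
so the Vandermonde convolution gives total mass one. -/
theorem dirichletMultinomialPMF_eq {m : ℕ} {c : Fin 2 → ℝ} {ij : ℕ × ℕ}
    (hij : ij ∈ antidiagonal m) :
    dirichletMultinomialPMF m c ![ij.1, ij.2] =
      (risingCoeff (c 0 + c 1) m)⁻¹ * (risingCoeff (c 0) ij.1 * risingCoeff (c 1) ij.2) := by
  have h := mem_antidiagonal.1 hij
  simp only [dirichletMultinomialPMF, Fin.sum_univ_two, Fin.prod_univ_two, Matrix.cons_val_zero,
    Matrix.cons_val_one, h, if_true, risingCoeff, inv_div]

/-- Total mass, mean and variance of the proportion of votes for class one under the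
Dirichlet-Multinomial distribution with two classes. -/
theorem dirichletMultinomial_moments {m : ℕ} (hm : m ≠ 0) {α t : ℝ} (hα : 0 < α) (ht : 0 < t)
    (ht1 : t < 1) :
    ∑ ij ∈ antidiagonal m, dirichletMultinomialPMF m (α • ![t, 1 - t]) ![ij.1, ij.2] = 1 ∧
    ∑ ij ∈ antidiagonal m, dirichletMultinomialPMF m (α • ![t, 1 - t]) ![ij.1, ij.2] *
      ((ij.1 : ℝ) / m - t) = 0 ∧
    ∑ ij ∈ antidiagonal m, dirichletMultinomialPMF m (α • ![t, 1 - t]) ![ij.1, ij.2] *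
      ((ij.1 : ℝ) / m - t) ^ 2 = (m + α) / (m * (1 + α)) * (t * (1 - t)) := by
  have ha : 0 < α * t := by positivity
  have hb : 0 < α * (1 - t) := mul_pos hα (by linarith)
  have hab : α * t + α * (1 - t) = α := by ring
  have hd := (risingCoeff_pos hα m).ne'
  have hm0 : (m : ℝ) ≠ 0 := by exact_mod_cast hm
  have hpmf : ∀ ij ∈ antidiagonal m,
      dirichletMultinomialPMF m (α • ![t, 1 - t]) ![ij.1, ij.2] =
      (risingCoeff α m)⁻¹ * (risingCoeff (α * t) ij.1 * risingCoeff (α * (1 - t)) ij.2) :=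
    fun ij hij => by
    rw [dirichletMultinomialPMF_eq hij]
    simp [hab]
  have s0 := sum_risingCoeff_mul ha hb m
  have s1 := sum_fst_mul_risingCoeff ha hb hm
  have s2 := sum_fst_mul_pred_mul_risingCoeff ha hb hm
  rw [hab] at s0 s1 s2
  refine ⟨?_, ?_, ?_⟩
  · rw [Finset.sum_congr rfl hpmf, ← Finset.mul_sum, s0, inv_mul_cancel₀ hd]
  · rw [Finset.sum_congr rfl fun ij hij => show _ = (risingCoeff α m)⁻¹ *
      ((m : ℝ)⁻¹ * ((ij.1 : ℝ) * (risingCoeff (α * t) ij.1 * risingCoeff (α * (1 - t)) ij.2)) -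
        t * (risingCoeff (α * t) ij.1 * risingCoeff (α * (1 - t)) ij.2)) by rw [hpmf ij hij]; ring]
    rw [← Finset.mul_sum, Finset.sum_sub_distrib, ← Finset.mul_sum, ← Finset.mul_sum, s0, s1]
    field_simp
    ring
  -- The square is expanded in the factorial moments of orders two, one and zero, using `i² = i (i -
  -- 1) + i`.
  · rw [Finset.sum_congr rfl fun ij hij => show _ = (risingCoeff α m)⁻¹ *
      ((m : ℝ)⁻¹ ^ 2 * ((ij.1 : ℝ) * ((ij.1 : ℝ) - 1) *
        (risingCoeff (α * t) ij.1 * risingCoeff (α * (1 - t)) ij.2)) +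
        ((m : ℝ)⁻¹ ^ 2 - 2 * t * (m : ℝ)⁻¹) * ((ij.1 : ℝ) *
        (risingCoeff (α * t) ij.1 * risingCoeff (α * (1 - t)) ij.2)) +
        t ^ 2 * (risingCoeff (α * t) ij.1 * risingCoeff (α * (1 - t)) ij.2)) by
        rw [hpmf ij hij]; ring]
    rw [← Finset.mul_sum, Finset.sum_add_distrib, Finset.sum_add_distrib, ← Finset.mul_sum,
      ← Finset.mul_sum, ← Finset.mul_sum, s0, s1, s2]
    have h1 : (1 : ℝ) + α ≠ 0 := by positivity
    have h2 : α + 1 ≠ 0 := by positivity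
    field_simp
    ring

end DirichletMultinomial

/-! ### Second order expansion and positive semidefinite forms. -/

section Taylor

variable {F : Type*} [NormedAddCommGroup F] [NormedSpace ℝ F] {f : F → ℝ} {β : F}

/-- The second order Taylor expansion, with Peano remainder, at a critical point. -/
theorem taylor_two_isLittleO (hdiff : ∀ᶠ b in 𝓝 β, DifferentiableAt ℝ f b)
    (hdiff₂ : DifferentiableAt ℝ (fderiv ℝ f) β) (h0 : fderiv ℝ f β = 0) :
    (fun h => f (β + h) - f β - ((1 / 2 : ℝ) • fderiv ℝ (fderiv ℝ f) β) h h) =o[𝓝 0]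
      fun h => ‖h‖ ^ 2 := by
  set H := fderiv ℝ (fderiv ℝ f) β with hH
  have hsymm : ∀ v w, H v w = H w v :=
    second_derivative_symmetric_of_eventually (hdiff.mono fun b hb => hb.hasFDerivAt)
      hdiff₂.hasFDerivAt
  refine Asymptotics.isLittleO_iff.2 fun c hc => ?_
  have hd := (hasFDerivAt_iff_isLittleO_nhds_zero.1 hdiff₂.hasFDerivAt).bound hc
  have hdiff' : ∀ᶠ h in 𝓝 (0 : F), DifferentiableAt ℝ f (β + h) := by
    have : Tendsto (fun h : F => β + h) (𝓝 0) (𝓝 β) := by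
      simpa using (tendsto_const_nhds (x := β)).add (tendsto_id (α := F) (x := 𝓝 0))
    exact this.eventually hdiff
  obtain ⟨δ, hδ, hball⟩ := Metric.eventually_nhds_iff.1 (hd.and hdiff')
  filter_upwards [Metric.ball_mem_nhds (0 : F) hδ] with h hh
  rw [mem_ball_zero_iff] at hh
  -- By symmetry of `H` the derivative of `g` at `k` is `fderiv ℝ f (β + k) - H k`, of norm at most
  -- `c ‖k‖` since `β` is critical. The mean value inequality on the ball of radius `‖h‖` then gives
  -- `c ‖h‖²`.
  let g : F → ℝ := fun k => f (β + k) - (1 / 2 : ℝ) * H k k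
  have hg : ∀ k, ‖k‖ < δ → HasFDerivAt g (fderiv ℝ f (β + k) - H k) k := fun k hk => by
    have h1 : HasFDerivAt (fun k => f (β + k)) (fderiv ℝ f (β + k)) k :=
      ((hball (show dist k 0 < δ by simpa using hk)).2.hasFDerivAt).comp k
        ((hasFDerivAt_id k).const_add β)
    have h2 : HasFDerivAt (fun k => H k k) (H k + H.flip k) k := by
      have := H.hasFDerivAt_of_bilinear (hasFDerivAt_id k) (hasFDerivAt_id k)
      refine this.congr_fderiv ?_
      ext v
      simp
    refine (h1.sub (h2.const_mul (1 / 2))).congr_fderiv ?_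
    ext v
    simp only [sub_apply, smul_apply, add_apply, ContinuousLinearMap.flip_apply, smul_eq_mul]
    rw [hsymm v k]
    ring
  have hmv := (convex_closedBall (0 : F) ‖h‖).norm_image_sub_le_of_norm_hasFDerivWithin_le
    (f := g) (f' := fun k => fderiv ℝ f (β + k) - H k) (C := c * ‖h‖) (x := 0) (y := h)
    (fun k hk => (hg k ((mem_closedBall_zero_iff.1 hk).trans_lt hh)).hasFDerivWithinAt)
    (fun k hk => by
      have hk' := mem_closedBall_zero_iff.1 hk
      have h3 := (hball (show dist k 0 < δ by simpa using hk'.trans_lt hh)).1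
      rw [h0, sub_zero] at h3
      exact h3.trans (by gcongr))
    (Metric.mem_closedBall_self (norm_nonneg h)) (by simp)
  have e : f (β + h) - f β - ((1 / 2 : ℝ) • H) h h = g h - g 0 := by
    simp [g, smul_apply]
    ring
  rw [e, norm_pow, norm_norm]
  calc ‖g h - g 0‖ ≤ c * ‖h‖ * ‖h - 0‖ := hmv
    _ = c * ‖h‖ ^ 2 := by rw [sub_zero]; ring

theorem bilin_self_nonneg_of_isMin {q : F →L[ℝ] F →L[ℝ] ℝ}
    (hf : (fun h => f (β + h) - f β - q h h) =o[𝓝 0] fun h => ‖h‖ ^ 2) (hmin : ∀ b, f β ≤ f b)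
    (v : F) : 0 ≤ q v v := by
  by_contra! hneg
  -- With this constant the remainder along `t • v` is at most half of `t² |q v v|`, too small to
  -- offset the negative quadratic term. The `+ 1` keeps the denominator positive without a case
  -- distinction.
  have hc : 0 < -q v v / (2 * (‖v‖ ^ 2 + 1)) := by
    have : 0 < -q v v := by linarith
    positivity
  have ht : Tendsto (fun t : ℝ => t • v) (𝓝[>] 0) (𝓝 0) := by
    have : Tendsto (fun t : ℝ => t • v) (𝓝 0) (𝓝 ((0 : ℝ) • v)) :=
      (continuous_id.smul continuous_const).tendsto 0
    rw [zero_smul] at this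
    exact this.mono_left nhdsWithin_le_nhds
  obtain ⟨t, hb, htpos⟩ := ((ht.eventually (hf.bound hc)).and self_mem_nhdsWithin).exists
  have htpos : 0 < t := htpos
  rw [norm_pow, norm_norm, norm_smul, Real.norm_of_nonneg htpos.le, Real.norm_eq_abs] at hb
  simp only [map_smul, smul_apply, smul_eq_mul] at hb
  have h1 := hmin (β + t • v)
  have h2 := (le_abs_self _).trans hb
  have h3 : -q v v / (2 * (‖v‖ ^ 2 + 1)) * (t * ‖v‖) ^ 2 ≤ t ^ 2 * (-q v v / 2) := by
    rw [div_mul_eq_mul_div, div_le_iff₀ (by positivity)]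
    have : 0 ≤ t ^ 2 * (-q v v) := by
      have : 0 < -q v v := by linarith
      positivity
    nlinarith
  have h4 : 0 < t ^ 2 * (-q v v) := by
    have : 0 < -q v v := by linarith
    positivity
  nlinarith

/-- Along `w + t • v` the form is affine in `t`, and a nonnegative affine function has slope zero.
-/
theorem bilin_eq_zero_of_self_eq_zero {q : F →L[ℝ] F →L[ℝ] ℝ} (hsymm : ∀ v w, q v w = q w v)
    (hpos : ∀ v, 0 ≤ q v v) {v : F} (hv : q v v = 0) (w : F) : q v w = 0 := by
  have h : ∀ t : ℝ, 0 ≤ q w w + 2 * t * q v w := fun t => by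
    have := hpos (w + t • v)
    simp only [map_add, map_smul, add_apply, smul_apply, smul_eq_mul, hv] at this
    rw [hsymm w v] at this
    linarith
  by_contra hne
  -- At this `t` the affine function equals `-1`.
  have := h (-(q w w + 1) / (2 * q v w))
  field_simp at this
  linarith

/-- A positive semidefinite bilinear form which vanishes on a non-degenerate random vector is
zero. -/
theorem bilin_eq_zero_of_ae_eq_zero {Ω E : Type*} [MeasurableSpace Ω] {P : Measure Ω}
    [NormedAddCommGroup E] [InnerProductSpace ℝ E] [CompleteSpace E] {x : Ω → E}
    (hnd : ∀ h, (∀ᵐ ω ∂P, inner ℝ h (x ω) = (0 : ℝ)) → h = 0) {q : E →L[ℝ] E →L[ℝ] ℝ}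
    (hsymm : ∀ v w, q v w = q w v) (hpos : ∀ v, 0 ≤ q v v)
    (hq : ∀ᵐ ω ∂P, q (x ω) (x ω) = 0) : q = 0 := by
  ext w v
  obtain ⟨z, hz⟩ := (InnerProductSpace.toDual ℝ E).surjective (q w)
  have hz' : ∀ v, inner ℝ z v = q w v := fun v => by
    rw [← hz, InnerProductSpace.toDual_apply_apply]
  have h0 : z = 0 := by
    refine hnd z ?_
    filter_upwards [hq] with ω hω
    rw [hz', hsymm]
    exact bilin_eq_zero_of_self_eq_zero hsymm hpos hω w
  rw [← hz', h0]
  simp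

end Taylor

/-! ### Integration against a conditional law of counts. -/

section ConditionalLaw

variable {Ω : Type*} [MeasurableSpace Ω] {P : Measure Ω} {𝒴 : Type*} [MeasurableSpace 𝒴] {Y : Ω → 𝒴} {C : Ω → Counts} {k : ℕ} {p : ℕ × ℕ → 𝒴 → ℝ}

theorem integrable_indicator_mul (hC : Measurable C) (s : Counts) {g : Ω → ℝ}
    (hg : Integrable g P) :
    Integrable (fun ω => g ω * (C ⁻¹' {s}).indicator (fun _ => (1 : ℝ)) ω) P := by
  have h := hg.indicator (hC (measurableSet_singleton s))
  refine h.congr (ae_of_all _ fun ω => ?_)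
  by_cases hω : ω ∈ C ⁻¹' {s}
  · simp [Set.indicator_of_mem hω]
  · simp [Set.indicator_of_notMem hω]

variable [IsProbabilityMeasure P]

/-- The product `q * g` is a version of a conditional expectation, so its integrability comes for
free, with no bound or measurability assumed for `q`. -/
theorem condLaw_pull_out (hY : Measurable Y) (hC : Measurable C) {s : Counts} {q : 𝒴 → ℝ}
    (hlaw : P⟦C ⁻¹' {s} | MeasurableSpace.comap Y inferInstance⟧ =ᵐ[P] fun ω => q (Y ω))
    {g : 𝒴 → ℝ} (hg : Measurable g) (hgi : Integrable (fun ω => g (Y ω)) P) :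
    Integrable (fun ω => q (Y ω) * g (Y ω)) P ∧
    ∫ ω, g (Y ω) * (C ⁻¹' {s}).indicator (fun _ => (1 : ℝ)) ω ∂P =
      ∫ ω, q (Y ω) * g (Y ω) ∂P := by
  have hsm : StronglyMeasurable[MeasurableSpace.comap Y inferInstance] fun ω => g (Y ω) :=
    (hg.comp (comap_measurable Y)).stronglyMeasurable
  have hprod := integrable_indicator_mul hC s hgi
  have hind : Integrable ((C ⁻¹' {s}).indicator fun _ => (1 : ℝ)) P :=
    (integrable_const _).indicator (hC (measurableSet_singleton s))
  have h := condExp_mul_of_stronglyMeasurable_left hsm hprod hind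
  have h' : P[(fun ω => g (Y ω)) * (C ⁻¹' {s}).indicator (fun _ => (1 : ℝ)) |
      MeasurableSpace.comap Y inferInstance] =ᵐ[P] fun ω => q (Y ω) * g (Y ω) := by
    filter_upwards [h, hlaw] with ω h1 h2
    rw [h1, Pi.mul_apply, h2, mul_comm]
  refine ⟨(integrable_condExp (μ := P)).congr h', ?_⟩
  rw [← integral_congr_ae h', integral_condExp hY.comap_le]
  rfl

/-- The conditional probabilities of the antidiagonal already sum to one, so no mass is left for
other counts. -/
theorem ae_add_eq_of_condLaw
    (hY : Measurable Y) (hC : Measurable C)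
    (hlaw : ∀ ij ∈ antidiagonal k, P⟦C ⁻¹' {![ij.1, ij.2]} |
      MeasurableSpace.comap Y inferInstance⟧ =ᵐ[P] fun ω => p ij (Y ω))
    (hsum : ∀ y, ∑ ij ∈ antidiagonal k, p ij y = 1) :
    ∀ᵐ ω ∂P, C ω 0 + C ω 1 = k := by
  have hm : ∀ ij : ℕ × ℕ, MeasurableSet (C ⁻¹' {![ij.1, ij.2]}) := fun ij =>
    hC (measurableSet_singleton _)
  have hset : {ω | C ω 0 + C ω 1 = k} =
      ⋃ ij ∈ antidiagonal k, C ⁻¹' {![ij.1, ij.2]} := by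
    ext ω
    simp only [Set.mem_ofPred_eq, Set.mem_iUnion, Set.mem_preimage, Set.mem_singleton_iff,
      mem_antidiagonal, exists_prop]
    constructor
    · intro h
      refine ⟨(C ω 0, C ω 1), h, ?_⟩
      ext i
      fin_cases i <;> rfl
    · rintro ⟨ij, h, hω⟩
      rw [hω]
      exact h
  have hmeas : MeasurableSet {ω | C ω 0 + C ω 1 = k} := by
    rw [hset]
    exact Finset.measurableSet_biUnion _ fun ij _ => hm ij
  have hone : P.real {ω | C ω 0 + C ω 1 = k} = 1 := by
    rw [hset, measureReal_biUnion_finset]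
    · have h1 : ∀ ij ∈ antidiagonal k, P.real (C ⁻¹' {![ij.1, ij.2]}) =
          ∫ ω, p ij (Y ω) ∂P := fun ij hij => by
        have := (condLaw_pull_out hY hC (hlaw ij hij) (g := fun _ => 1) measurable_const
          (integrable_const _)).2
        simp only [one_mul, mul_one] at this
        rw [← this, integral_indicator (hm ij)]
        simp
      rw [Finset.sum_congr rfl h1, ← integral_finsetSum]
      · simp [hsum]
      · intro ij hij
        simpa using (condLaw_pull_out hY hC (hlaw ij hij) (g := fun _ => 1) measurable_const
          (integrable_const _)).1
    · intro ij _ ij' _ hne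
      refine Set.disjoint_left.2 fun ω h1 h2 => hne ?_
      have h3 : (![ij.1, ij.2] : Counts) = ![ij'.1, ij'.2] := h1.symm.trans h2
      have h4 := congrFun h3 0
      have h5 := congrFun h3 1
      exact Prod.ext (by simpa using h4) (by simpa using h5)
    · exact fun ij _ => hm ij
  rw [ae_iff]
  have := (prob_compl_eq_zero_iff (μ := P) hmeas).2 (by
    rw [measureReal_def] at hone
    rw [← ENNReal.toReal_eq_one_iff]
    exact hone)
  exact this

/-- Almost surely the integrand splits over the finitely many count values on the antidiagonal; on
each piece the feature-dependent factor is pulled out of the conditional expectation. -/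
theorem integral_eq_of_condLaw
    (hY : Measurable Y) (hC : Measurable C)
    (hlaw : ∀ ij ∈ antidiagonal k, P⟦C ⁻¹' {![ij.1, ij.2]} |
      MeasurableSpace.comap Y inferInstance⟧ =ᵐ[P] fun ω => p ij (Y ω))
    (hsum : ∀ y, ∑ ij ∈ antidiagonal k, p ij y = 1)
    {g : ℕ × ℕ → 𝒴 → ℝ} (hg : ∀ ij, Measurable (g ij))
    (hgi : ∀ ij, Integrable (fun ω => g ij (Y ω)) P) :
    ∫ ω, g (C ω 0, C ω 1) (Y ω) ∂P =
      ∫ ω, ∑ ij ∈ antidiagonal k, p ij (Y ω) * g ij (Y ω) ∂P := by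
  have h1 : ∀ᵐ ω ∂P, g (C ω 0, C ω 1) (Y ω) = ∑ ij ∈ antidiagonal k,
      g ij (Y ω) * (C ⁻¹' {![ij.1, ij.2]}).indicator (fun _ => (1 : ℝ)) ω := by
    filter_upwards [ae_add_eq_of_condLaw hY hC hlaw hsum] with ω hω
    rw [Finset.sum_eq_single (C ω 0, C ω 1)]
    · have : ω ∈ C ⁻¹' {![C ω 0, C ω 1]} := by
        simp only [Set.mem_preimage, Set.mem_singleton_iff]
        ext i
        fin_cases i <;> rfl
      rw [Set.indicator_of_mem this, mul_one]
    · intro ij _ hne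
      have : ω ∉ C ⁻¹' {![ij.1, ij.2]} := by
        intro h
        have h' : C ω = ![ij.1, ij.2] := h
        apply hne
        rw [h']
        rfl
      rw [Set.indicator_of_notMem this, mul_zero]
    · intro h
      exact absurd (mem_antidiagonal.2 hω) h
  rw [integral_congr_ae h1, integral_finsetSum _ fun ij _ => integrable_indicator_mul hC _ (hgi ij),
    integral_finsetSum _ fun ij hij => (condLaw_pull_out hY hC (hlaw ij hij) (hg ij) (hgi ij)).1]
  exact Finset.sum_congr rfl fun ij hij =>
    (condLaw_pull_out hY hC (hlaw ij hij) (hg ij) (hgi ij)).2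

end ConditionalLaw


/-! ### From votes to logistic samples. -/

section Model

open Real (sigmoid)
open InnerProductSpace (rankOne)

variable {p : ℕ}

/-- The design vector `(1, y)` of a feature vector `y`. -/
noncomputable def design (y : Feature p) : WithLp 2 (ℝ × Feature p) := WithLp.toLp 2 (1, y)

theorem inner_design (b : Coef p) (y : Feature p) :
    inner ℝ (WithLp.toLp 2 b) (design y) = linPred b y := by
  simp [design, linPred, WithLp.prod_inner_apply]

theorem continuous_design : Continuous (design (p := p)) :=
  (WithLp.prod_continuous_toLp 2 ℝ (Feature p)).comp (continuous_const.prodMk continuous_id)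

theorem classProb_eq (b : Coef p) (y : Feature p) :
    classProb b y = ![sigmoid (linPred b y), 1 - sigmoid (linPred b y)] := by
  simp only [classProb, exp_div_one_add_exp]

/-- Passing to proportions of votes treats labels and votes as the same problem with responses in
`[0, 1]`. -/
theorem logLik_eq {k : ℕ} (hk : k ≠ 0) (n : ℕ) (y : ℕ → Feature p) (c : ℕ → Counts) (b : Coef p) :
    logLik k n y c b = k * logisticObjective n (fun j => design (y j)) (fun j => (c j 0 : ℝ) / k)
      (WithLp.toLp 2 b) := by
  have hk' : (k : ℝ) ≠ 0 := by exact_mod_cast hk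
  simp only [logLik, logisticObjective, inner_design, Finset.mul_sum]
  refine Finset.sum_congr rfl fun j _ => ?_
  field_simp

theorem measurable_linPred (β : Coef p) : Measurable (linPred β) :=
  (continuous_const.add (continuous_const.inner continuous_id)).measurable

theorem measurable_sigmoid_linPred (β : Coef p) : Measurable fun y => sigmoid (linPred β y) :=
  continuous_sigmoid.measurable.comp (measurable_linPred β)

theorem integrable_vote_mul {Ω : Type*} [MeasurableSpace Ω] {P : Measure Ω} {β : Coef p}
    {Y : Ω → Feature p} (hY : Measurable Y) (c : ℝ) (e : ℕ) {g : Feature p → ℝ}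
    (hgi : Integrable (fun ω => g (Y ω)) P) :
    Integrable (fun ω => (c - sigmoid (linPred β (Y ω))) ^ e * g (Y ω)) P := by
  refine hgi.bdd_mul (c := (|c| + 1) ^ e) ?_ (ae_of_all _ fun ω => ?_)
  · exact (((measurable_sigmoid_linPred β).comp hY).const_sub c).pow_const e |>.aestronglyMeasurable
  · rw [norm_pow]
    gcongr
    refine (norm_sub_le _ _).trans ?_
    rw [Real.norm_of_nonneg (Real.sigmoid_nonneg _)]
    exact add_le_add le_rfl (Real.sigmoid_le_one _)

variable {Ω : Type*} [MeasurableSpace Ω] {P : Measure Ω} [IsProbabilityMeasure P]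

theorem memLp_design {Y : Ω → Feature p} (hY : MemLp Y 2 P) : MemLp (fun ω => design (Y ω)) 2 P := by
  let A : Feature p →L[ℝ] WithLp 2 (ℝ × Feature p) :=
    ((WithLp.prodContinuousLinearEquiv 2 ℝ ℝ (Feature p)).symm :
      ℝ × Feature p →L[ℝ] WithLp 2 (ℝ × Feature p)) ∘L ContinuousLinearMap.inr ℝ ℝ (Feature p)
  refine ((A.comp_memLp' hY).add (memLp_const (design 0))).ae_eq (ae_of_all _ fun ω => ?_)
  change WithLp.toLp 2 ((0 : ℝ), Y ω) + WithLp.toLp 2 ((1 : ℝ), (0 : Feature p)) =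
    WithLp.toLp 2 (1, Y ω)
  rw [← WithLp.toLp_add]
  simp

/-- A positive definite covariance matrix makes the design vector non-degenerate. -/
theorem design_nondegenerate {Y : Ω → Feature p} (hY : MemLp Y 2 P)
    (hcov : (Matrix.of fun a b : Fin p =>
      covariance (fun ω => Y ω a) (fun ω => Y ω b) P).PosDef)
    (h : WithLp 2 (ℝ × Feature p)) (hh : ∀ᵐ ω ∂P, inner ℝ h (design (Y ω)) = (0 : ℝ)) : h = 0 := by
  obtain ⟨b, rfl⟩ := (WithLp.equiv 2 (ℝ × Feature p)).symm.surjective h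
  change ∀ᵐ ω ∂P, inner ℝ (WithLp.toLp 2 b) (design (Y ω)) = (0 : ℝ) at hh
  simp only [inner_design, linPred] at hh
  have hcoord : ∀ a, MemLp (fun ω => Y ω a) 2 P := fun a =>
    (EuclideanSpace.proj (𝕜 := ℝ) a : Feature p →L[ℝ] ℝ).comp_memLp' hY
  -- The slope part equals `-b.1` almost surely, so it has no variance. Its variance is also the
  -- covariance form at `b.2`, which is positive unless `b.2 = 0`.
  have hvar : Var[fun ω => ∑ a, b.2 a * Y ω a; P] = 0 := by
    have h1 : (fun ω => ∑ a, b.2 a * Y ω a) =ᵐ[P] fun _ => -b.1 := by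
      filter_upwards [hh] with ω hω
      have : (inner ℝ b.2 (Y ω) : ℝ) = ∑ a, b.2 a * Y ω a := by
        simp [PiLp.inner_apply, mul_comm]
      linarith
    rw [variance_congr h1, ← covariance_self aemeasurable_const]
    exact covariance_const_left _
  have hvar2 : Var[fun ω => ∑ a, b.2 a * Y ω a; P] = ∑ a, ∑ a', b.2 a * (b.2 a' *
      covariance (fun ω => Y ω a) (fun ω => Y ω a') P) := by
    rw [variance_fun_sum fun a => (hcoord a).const_mul _]
    simp_rw [covariance_const_mul_left, covariance_const_mul_right]
  have hb2 : b.2 = 0 := by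
    by_contra hne
    have hne' : (WithLp.ofLp b.2 : Fin p → ℝ) ≠ 0 := fun h0 => hne (by ext a; exact congrFun h0 a)
    have hpos := hcov.dotProduct_mulVec_pos hne'
    rw [hvar2] at hvar
    have e : star (WithLp.ofLp b.2 : Fin p → ℝ) ⬝ᵥ ((Matrix.of fun a b : Fin p =>
        covariance (fun ω => Y ω a) (fun ω => Y ω b) P).mulVec (WithLp.ofLp b.2)) =
        ∑ a, ∑ a', b.2 a * (b.2 a' * covariance (fun ω => Y ω a) (fun ω => Y ω a') P) := by
      simp only [dotProduct, Matrix.mulVec, Finset.mul_sum, Matrix.of_apply, Pi.star_apply,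
        star_trivial]
      refine Finset.sum_congr rfl fun a _ => Finset.sum_congr rfl fun a' _ => ?_
      ring
    rw [e, hvar] at hpos
    exact lt_irrefl _ hpos
  have hb1 : b.1 = 0 := by
    obtain ⟨ω, hω⟩ := hh.exists
    simpa [hb2] using hω
  have : b = 0 := Prod.ext hb1 hb2
  rw [this]
  rfl

/-- The conditional law of counts with `k` votes whose proportions of votes for class one have
conditional mean `τ₁(Y; β)` and conditional variance `v τ₁(Y; β) τ₂(Y; β)`. -/
structure VoteLaw (P : Measure Ω) (β : Coef p) (Y : Ω → Feature p) (C : Ω → Counts) (k : ℕ) (v : ℝ)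
    (w : ℕ × ℕ → Feature p → ℝ) : Prop where
  law : ∀ ij ∈ antidiagonal k, P⟦C ⁻¹' {![ij.1, ij.2]} |
      MeasurableSpace.comap Y inferInstance⟧ =ᵐ[P] fun ω => w ij (Y ω)
  sum_eq : ∀ y, ∑ ij ∈ antidiagonal k, w ij y = 1
  mean_eq : ∀ y, ∑ ij ∈ antidiagonal k, w ij y * ((ij.1 : ℝ) / k - sigmoid (linPred β y)) = 0
  var_eq : ∀ y, ∑ ij ∈ antidiagonal k, w ij y * ((ij.1 : ℝ) / k - sigmoid (linPred β y)) ^ 2 =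
    v * (sigmoid (linPred β y) * (1 - sigmoid (linPred β y)))

variable {β : Coef p} {Y : Ω → Feature p} {C : Ω → Counts} {k : ℕ} {v : ℝ}
  {w : ℕ × ℕ → Feature p → ℝ}

namespace VoteLaw

theorem ae_le (hw : VoteLaw P β Y C k v w) (hY : Measurable Y) (hC : Measurable C) :
    ∀ᵐ ω ∂P, (C ω 0 : ℝ) / k ∈ Set.Icc (0 : ℝ) 1 := by
  filter_upwards [ae_add_eq_of_condLaw hY hC hw.law hw.sum_eq] with ω hω
  refine ⟨by positivity, div_le_one_of_le₀ ?_ (by positivity)⟩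
  exact_mod_cast (Nat.le_add_right _ _).trans hω.le

theorem integral_sub_mul (hw : VoteLaw P β Y C k v w) (hY : Measurable Y) (hC : Measurable C)
    {g : Feature p → ℝ} (hg : Measurable g) (hgi : Integrable (fun ω => g (Y ω)) P) :
    ∫ ω, ((C ω 0 : ℝ) / k - sigmoid (linPred β (Y ω))) * g (Y ω) ∂P = 0 := by
  have h := integral_eq_of_condLaw hY hC hw.law hw.sum_eq
    (g := fun ij y => ((ij.1 : ℝ) / k - sigmoid (linPred β y)) * g y)
    (fun ij => ((measurable_sigmoid_linPred β).const_sub _).mul hg)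
    (fun ij => by simpa using integrable_vote_mul hY ((ij.1 : ℝ) / k) 1 hgi)
  rw [h]
  simp_rw [← mul_assoc, ← Finset.sum_mul, hw.mean_eq]
  simp

theorem integral_sub_sq_mul (hw : VoteLaw P β Y C k v w) (hY : Measurable Y) (hC : Measurable C)
    {g : Feature p → ℝ} (hg : Measurable g) (hgi : Integrable (fun ω => g (Y ω)) P) :
    ∫ ω, ((C ω 0 : ℝ) / k - sigmoid (linPred β (Y ω))) ^ 2 * g (Y ω) ∂P =
      v * ∫ ω, sigmoid (linPred β (Y ω)) * (1 - sigmoid (linPred β (Y ω))) * g (Y ω) ∂P := by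
  have h := integral_eq_of_condLaw hY hC hw.law hw.sum_eq
    (g := fun ij y => ((ij.1 : ℝ) / k - sigmoid (linPred β y)) ^ 2 * g y)
    (fun ij => (((measurable_sigmoid_linPred β).const_sub _).pow_const 2).mul hg)
    (fun ij => integrable_vote_mul hY ((ij.1 : ℝ) / k) 2 hgi)
  rw [h]
  simp_rw [← mul_assoc, ← Finset.sum_mul, hw.var_eq]
  rw [← integral_const_mul]
  simp_rw [← mul_assoc]

end VoteLaw

/-- The conditional mean centers the score, tested against each vector `u`; the other fields
transfer from the counts and features. -/
theorem VoteLaw.logisticSample {Y : ℕ → Ω → Feature p} {C : ℕ → Ω → Counts}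
    (hw : VoteLaw P β (Y 0) (C 0) k v w)
    (hY : ∀ j, Measurable (Y j)) (hC : ∀ j, Measurable (C j))
    (hind : iIndepFun (fun j ω => (Y j ω, C j ω)) P)
    (hid : ∀ j, IdentDistrib (fun ω => (Y j ω, C j ω)) (fun ω => (Y 0 ω, C 0 ω)) P P)
    (hL : MemLp (Y 0) 2 P) (hcov : (Matrix.of fun a b : Fin p =>
      covariance (fun ω => Y 0 ω a) (fun ω => Y 0 ω b) P).PosDef) :
    LogisticSample P (WithLp.toLp 2 β) (fun j ω => design (Y j ω))
      (fun j ω => (C j ω 0 : ℝ) / k) where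
  measurable_x j := continuous_design.measurable.comp (hY j)
  measurable_r j := (measurable_of_countable fun c : Counts => (c 0 : ℝ) / k).comp (hC j)
  indep := hind.comp (fun _ y => (design y.1, (y.2 0 : ℝ) / k)) fun _ =>
    (continuous_design.measurable.comp measurable_fst).prodMk
      ((measurable_of_countable fun c : Counts => (c 0 : ℝ) / k).comp measurable_snd)
  identDistrib j := (hid j).comp (u := fun y => (design y.1, (y.2 0 : ℝ) / k))
    ((continuous_design.measurable.comp measurable_fst).prodMk
      ((measurable_of_countable fun c : Counts => (c 0 : ℝ) / k).comp measurable_snd))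
  memLp_x := memLp_design hL
  r_mem := hw.ae_le (hY 0) (hC 0)
  nondegenerate := design_nondegenerate hL hcov
  integral_score := by
    have hi : Integrable (fun ω => ((C 0 ω 0 : ℝ) / k -
        sigmoid (inner ℝ (WithLp.toLp 2 β) (design (Y 0 ω)))) • design (Y 0 ω)) P :=
      (memLp_score_of_mem (β := WithLp.toLp 2 β)
      (continuous_design.measurable.comp (hY 0))
      ((measurable_of_countable fun c : Counts => (c 0 : ℝ) / k).comp (hC 0)) (memLp_design hL)
      (hw.ae_le (hY 0) (hC 0))).integrable one_le_two
    refine ext_inner_left ℝ fun u => ?_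
    rw [inner_zero_right, ← integral_inner hi]
    simp only [real_inner_smul_right, inner_design]
    refine hw.integral_sub_mul (hY 0) (hC 0) (g := fun y => inner ℝ u (design y)) ?_ ?_
    · exact (continuous_const.inner continuous_design).measurable
    · exact ((memLp_design hL).const_inner u).integrable one_le_two

end Model


/-! ### Measurability and minimality of the error rate. -/

section ErrorRate

open Real (sigmoid)

variable {p : ℕ}

theorem measurable_rule : Measurable fun z : Coef p × Feature p => rule z.1 z.2 := by
  have hl : Continuous fun z : Coef p × Feature p => linPred z.1 z.2 := by
    unfold linPred
    fun_prop
  have hs : Measurable fun z : Coef p × Feature p => sigmoid (linPred z.1 z.2) :=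
    (continuous_sigmoid.comp hl).measurable
  unfold rule
  refine Measurable.ite (measurableSet_le ?_ ?_) measurable_const measurable_const
  · simpa [classProb_eq] using hs.const_sub 1
  · simpa [classProb_eq] using hs

theorem measurableSet_ne_single : MeasurableSet {ic : Fin 2 × Counts | ic.2 ≠ Pi.single ic.1 1} :=
  MeasurableSet.of_discrete

theorem measurableSet_misclassified :
    MeasurableSet {z : Coef p × Feature p × Counts | z.2.2 ≠ Pi.single (rule z.1 z.2.1) 1} := by
  have h : Measurable fun z : Coef p × Feature p × Counts => (rule z.1 z.2.1, z.2.2) :=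
    (measurable_rule.comp (measurable_fst.prodMk (measurable_fst.comp measurable_snd))).prodMk
      (measurable_snd.comp measurable_snd)
  exact h measurableSet_ne_single

theorem measurable_rule_apply (b : Coef p) : Measurable fun y : Feature p => rule b y := by
  have h : Measurable fun y : Feature p => (b, y) := measurable_prodMk_left
  have h' := Measurable.comp (measurable_rule (p := p)) h
  exact h'

/-- Joint measurability of the misclassification event in coefficient, feature and label makes the
error rate of a random coefficient a random variable. -/
theorem measurable_errorRate (ν : Measure (Feature p × Counts)) [IsFiniteMeasure ν] :
    Measurable (errorRate ν) :=
  (measurable_measure_prodMk_left (ν := ν) measurableSet_misclassified).ennreal_toReal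

theorem errorRate_mem (ν : Measure (Feature p × Counts)) [IsProbabilityMeasure ν] (b : Coef p) :
    errorRate ν b ∈ Set.Icc (0 : ℝ) 1 :=
  ⟨measureReal_nonneg, measureReal_le_one⟩

/-- The conditional law of a label given the feature in the logistic model with coefficient `β`. -/
noncomputable def labelWeight (β : Coef p) (ij : ℕ × ℕ) (y : Feature p) : ℝ :=
  if ij = (1, 0) then sigmoid (linPred β y) else 1 - sigmoid (linPred β y)

theorem antidiagonal_one : antidiagonal 1 = ({(0, 1), (1, 0)} : Finset (ℕ × ℕ)) := rfl

theorem single_zero_one : (Pi.single 0 1 : Counts) = ![1, 0] := by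
  ext i; fin_cases i <;> rfl

theorem single_one_one : (Pi.single 1 1 : Counts) = ![0, 1] := by
  ext i; fin_cases i <;> rfl

variable {Ω : Type*} [MeasurableSpace Ω] {P : Measure Ω} {m : ℕ} {α₀ : ℝ} {β : Coef p}
  {Y : ℕ → Ω → Feature p} {Z S : ℕ → Ω → Counts}

theorem LabelModel.voteLaw_Z (hmodel : LabelModel P m α₀ β Y Z S) :
    VoteLaw P β (Y 0) (Z 0) 1 1 (labelWeight β) where
  law ij hij := by
    rw [antidiagonal_one, Finset.mem_insert, Finset.mem_singleton] at hij
    rcases hij with rfl | rfl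
    · have h := hmodel.law_Z 0 1
      rw [single_one_one] at h
      simpa [classProb_eq, labelWeight] using h
    · have h := hmodel.law_Z 0 0
      rw [single_zero_one] at h
      simpa [classProb_eq, labelWeight] using h
  sum_eq y := by simp [antidiagonal_one, labelWeight]
  mean_eq y := by
    simp [antidiagonal_one, labelWeight]
    ring
  var_eq y := by
    simp [antidiagonal_one, labelWeight]
    ring

theorem LabelModel.voteLaw_S (hmodel : LabelModel P m α₀ β Y Z S) (hm : m ≠ 0) (hα₀ : 0 < α₀) :
    VoteLaw P β (Y 0) (S 0) m ((m + α₀) / (m * (1 + α₀)))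
      (fun ij y => dirichletMultinomialPMF m
        (α₀ • ![sigmoid (linPred β y), 1 - sigmoid (linPred β y)]) ![ij.1, ij.2]) where
  law ij hij := by
    have h := hmodel.law_S 0 ![ij.1, ij.2]
    simpa only [classProb_eq] using h
  sum_eq y := (dirichletMultinomial_moments hm hα₀ (Real.sigmoid_pos _) (Real.sigmoid_lt_one _)).1
  mean_eq y :=
    (dirichletMultinomial_moments hm hα₀ (Real.sigmoid_pos _) (Real.sigmoid_lt_one _)).2.1
  var_eq y :=
    (dirichletMultinomial_moments hm hα₀ (Real.sigmoid_pos _) (Real.sigmoid_lt_one _)).2.2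

variable [IsProbabilityMeasure P]

theorem errorRate_eq_integral {Y : Ω → Feature p} {Z : Ω → Counts} {v : ℝ} (hY : Measurable Y)
    (hZ : Measurable Z) (hw : VoteLaw P β Y Z 1 v (labelWeight β)) (b : Coef p) :
    errorRate (P.map fun ω => (Y ω, Z ω)) b = ∫ ω, (if rule b (Y ω) = 0 then
      1 - sigmoid (linPred β (Y ω)) else sigmoid (linPred β (Y ω))) ∂P := by
  have hset : MeasurableSet {x : Feature p × Counts | x.2 ≠ Pi.single (rule b x.1) 1} :=
    ((measurable_rule_apply b).comp measurable_fst).prodMk measurable_snd measurableSet_ne_single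
  have hsm : ∀ s : Counts, MeasurableSet {y : Feature p | s ≠ Pi.single (rule b y) 1} := fun s =>
    (measurable_rule_apply b) (MeasurableSet.of_discrete (s := {i | s ≠ Pi.single i 1}))
  rw [errorRate, map_measureReal_apply (hY.prodMk hZ) hset]
  let g : ℕ × ℕ → Feature p → ℝ := fun ij =>
    {y : Feature p | (![ij.1, ij.2] : Counts) ≠ Pi.single (rule b y) 1}.indicator fun _ => 1
  have hg : ∀ ij, Measurable (g ij) := fun ij => measurable_const.indicator (hsm _)
  have h := integral_eq_of_condLaw hY hZ hw.law hw.sum_eq hg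
    (fun ij => ((integrable_const (1 : ℝ)).indicator (hY (hsm ![ij.1, ij.2]))).congr
      (ae_of_all _ fun ω => rfl))
  have e1 : ∫ ω, g (Z ω 0, Z ω 1) (Y ω) ∂P =
      P.real ((fun ω => (Y ω, Z ω)) ⁻¹' {x | x.2 ≠ Pi.single (rule b x.1) 1}) := by
    rw [← integral_indicator_one ((hY.prodMk hZ) hset)]
    refine integral_congr_ae (ae_of_all _ fun ω => ?_)
    have hZω : (![Z ω 0, Z ω 1] : Counts) = Z ω := by
      ext i; fin_cases i <;> rfl
    simp only [g, hZω]
    rfl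
  rw [← e1, h]
  refine integral_congr_ae (ae_of_all _ fun ω => ?_)
  simp only [antidiagonal_one, g, labelWeight]
  rcases Fin.exists_fin_two.1 ⟨rule b (Y ω), rfl⟩ with h0 | h0
  · rw [Finset.sum_pair (by simp)]
    simp [Set.indicator, h0, single_zero_one]
  · rw [Finset.sum_pair (by simp)]
    simp [Set.indicator, h0, single_one_one]

/-- The rule with the true coefficient is a Bayes rule. -/
theorem errorRate_le {Y : Ω → Feature p} {Z : Ω → Counts} {v : ℝ} (hY : Measurable Y)
    (hZ : Measurable Z) (hw : VoteLaw P β Y Z 1 v (labelWeight β)) (b : Coef p) :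
    errorRate (P.map fun ω => (Y ω, Z ω)) β ≤ errorRate (P.map fun ω => (Y ω, Z ω)) b := by
  have hint : ∀ b : Coef p, Integrable (fun ω => if rule b (Y ω) = 0 then
      1 - sigmoid (linPred β (Y ω)) else sigmoid (linPred β (Y ω))) P := fun b => by
    have hr : Measurable fun ω => rule b (Y ω) := (measurable_rule_apply b).comp hY
    have hs : Measurable fun ω => sigmoid (linPred β (Y ω)) :=
      (measurable_sigmoid_linPred β).comp hY
    refine Integrable.of_bound (Measurable.ite (hr (measurableSet_singleton 0)) (hs.const_sub 1)
      hs).aestronglyMeasurable 1 (ae_of_all _ fun ω => ?_)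
    have h0 := Real.sigmoid_nonneg (linPred β (Y ω))
    have h1 := Real.sigmoid_le_one (linPred β (Y ω))
    rw [Real.norm_eq_abs]
    split_ifs <;> exact abs_le.2 ⟨by linarith, by linarith⟩
  rw [errorRate_eq_integral hY hZ hw, errorRate_eq_integral hY hZ hw]
  -- Pointwise in the feature, the rule at `β` incurs the smaller of the two conditional error
  -- probabilities.
  refine integral_mono (hint β) (hint b) fun ω => ?_
  have hβ : rule β (Y ω) = 0 ↔
      1 - sigmoid (linPred β (Y ω)) ≤ sigmoid (linPred β (Y ω)) := by
    simp [rule, classProb_eq]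
  by_cases h : 1 - sigmoid (linPred β (Y ω)) ≤ sigmoid (linPred β (Y ω))
  · simp only [hβ.2 h, if_true]
    split_ifs <;> linarith
  · have h' : rule β (Y ω) ≠ 0 := fun h0 => h (hβ.1 h0)
    simp only [h', if_false]
    split_ifs <;> linarith

end ErrorRate

/-! ### Limits of the scaled excess errors and their ratio. -/

section Efficiency

open Real (sigmoid)
open InnerProductSpace (rankOne)

variable {p : ℕ} {Ω : Type*} [MeasurableSpace Ω] {P : Measure Ω}

theorem IsMaxLikEstimator.ae_maximises {k : ℕ} (hk : k ≠ 0) {Y : ℕ → Ω → Feature p}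
    {C : ℕ → Ω → Counts} {est : ℕ → Ω → Coef p} (hest : IsMaxLikEstimator P k Y C est) (n : ℕ) :
    ∀ᵐ ω ∂P, (∃ b, ∀ b',
      logisticObjective n (fun j => design (Y j ω)) (fun j => (C j ω 0 : ℝ) / k) b' ≤
        logisticObjective n (fun j => design (Y j ω)) (fun j => (C j ω 0 : ℝ) / k) b) →
      ∀ b', logisticObjective n (fun j => design (Y j ω)) (fun j => (C j ω 0 : ℝ) / k) b' ≤
        logisticObjective n (fun j => design (Y j ω)) (fun j => (C j ω 0 : ℝ) / k)
          (WithLp.toLp 2 (est n ω)) := by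
  have hk0 : (0 : ℝ) < k := by exact_mod_cast Nat.pos_of_ne_zero hk
  have key : ∀ ω (b : Coef p),
      (∀ b', logLik k n (fun j => Y j ω) (fun j => C j ω) b' ≤
        logLik k n (fun j => Y j ω) (fun j => C j ω) b) ↔
      ∀ b', logisticObjective n (fun j => design (Y j ω)) (fun j => (C j ω 0 : ℝ) / k) b' ≤
        logisticObjective n (fun j => design (Y j ω)) (fun j => (C j ω 0 : ℝ) / k)
          (WithLp.toLp 2 b) := fun ω b => by
    simp only [logLik_eq hk, mul_le_mul_iff_right₀ hk0]
    exact ⟨fun h b' => h (WithLp.ofLp b'), fun h b' => h _⟩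
  filter_upwards [hest.isMax n] with ω hω hex
  refine (key ω _).1 (hω ?_)
  obtain ⟨b, hb⟩ := hex
  exact ⟨WithLp.ofLp b, (key ω _).2 hb⟩

/-- The rescaled expected excess error rate of a maximum likelihood estimator converges to the
conditional variance factor of the votes times a constant that does not depend on the votes. -/
theorem tendsto_mul_expectedExcessError [IsProbabilityMeasure P] {β : Coef p} {Y : ℕ → Ω → Feature p} {C : ℕ → Ω → Counts}
    {k : ℕ} {v : ℝ} {w : ℕ × ℕ → Feature p → ℝ} (hk : k ≠ 0)
    (hw : VoteLaw P β (Y 0) (C 0) k v w) (hY : ∀ j, Measurable (Y j)) (hC : ∀ j, Measurable (C j))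
    (hs : LogisticSample P (WithLp.toLp 2 β) (fun j ω => design (Y j ω))
      (fun j ω => (C j ω 0 : ℝ) / k))
    {J : WithLp 2 (ℝ × Feature p) ≃L[ℝ] WithLp 2 (ℝ × Feature p)}
    (hJ : (J : WithLp 2 (ℝ × Feature p) →L[ℝ] WithLp 2 (ℝ × Feature p)) =
      ∫ ω, logisticWeight (WithLp.toLp 2 β) (design (Y 0 ω)) •
        rankOne ℝ (design (Y 0 ω)) (design (Y 0 ω)) ∂P)
    {ν : Measure (Feature p × Counts)} [IsProbabilityMeasure ν]
    {q : WithLp 2 (ℝ × Feature p) →L[ℝ] WithLp 2 (ℝ × Feature p) →L[ℝ] ℝ}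
    (hq : (fun h => errorRate ν (WithLp.ofLp (WithLp.toLp 2 β + h)) - errorRate ν β - q h h) =o[𝓝 0]
      fun h => ‖h‖ ^ 2)
    {est : ℕ → Ω → Coef p} (hest : IsMaxLikEstimator P k Y C est) :
    Tendsto (fun n : ℕ => n * expectedExcessError P ν β est n) atTop
      (𝓝 (v * ∫ ω, logisticWeight (WithLp.toLp 2 β) (design (Y 0 ω)) *
        q (J.symm (design (Y 0 ω))) (J.symm (design (Y 0 ω))) ∂P)) := by
  have h := hs.tendsto_mul_integral_sub hJ (f := fun e => errorRate ν (WithLp.ofLp e))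
    (fun e => errorRate_mem ν _) hq (est := fun n ω => WithLp.toLp 2 (est n ω))
    (fun n => ((measurable_errorRate ν).comp (hest.measurable n)).aestronglyMeasurable)
    (hest.ae_maximises hk)
  have hcont : Continuous fun y : Feature p => q (J.symm (design y)) (J.symm (design y)) := by
    have := continuous_design (p := p)
    fun_prop
  have hint : Integrable (fun ω => q (J.symm (design (Y 0 ω))) (J.symm (design (Y 0 ω)))) P := by
    have h2 := ((J.symm : WithLp 2 (ℝ × Feature p) →L[ℝ] WithLp 2 (ℝ × Feature p)).comp_memLp'
      hs.memLp_x).norm.integrable_sq.const_mul ‖q‖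
    refine h2.mono' (hcont.measurable.comp (hY 0)).aestronglyMeasurable (ae_of_all _ fun ω => ?_)
    exact abs_bilin_self_le q _
  have e := hw.integral_sub_sq_mul (hY 0) (hC 0) hcont.measurable hint
  simp only [inner_design] at h
  rw [e] at h
  simpa only [logisticWeight, inner_design, expectedExcessError] using h

end Efficiency

end NoisyLabels

theorem theorem2 {p : ℕ} {Ω : Type*} [MeasurableSpace Ω] (P : Measure Ω) [IsProbabilityMeasure P]
    (m : ℕ) (hm : 1 ≤ m) (α₀ : ℝ) (hα₀ : 0 < α₀) (β : NoisyLabels.Coef p)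
    (Y : ℕ → Ω → NoisyLabels.Feature p) (Z S : ℕ → Ω → NoisyLabels.Counts)
    (hmodel : NoisyLabels.LabelModel P m α₀ β Y Z S)
    (ν : Measure (NoisyLabels.Feature p × NoisyLabels.Counts))
    (hν : ν = P.map (fun ω => (Y 0 ω, Z 0 ω)))
    -- the error rate is twice differentiable at `β`, with a nonzero Hessian there
    (hdiff : ∀ᶠ b in 𝓝 β, DifferentiableAt ℝ (NoisyLabels.errorRate ν) b)
    (hdiff₂ : DifferentiableAt ℝ (fderiv ℝ (NoisyLabels.errorRate ν)) β)
    (hHess : fderiv ℝ (fderiv ℝ (NoisyLabels.errorRate ν)) β ≠ 0)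
    (βG βM : ℕ → Ω → NoisyLabels.Coef p)
    (hG : NoisyLabels.IsMaxLikEstimator P 1 Y Z βG)
    (hM : NoisyLabels.IsMaxLikEstimator P m Y S βM) :
    Tendsto (fun n : ℕ => NoisyLabels.expectedExcessError P ν β βG n /
        NoisyLabels.expectedExcessError P ν β βM n) atTop
      (𝓝 ((m : ℝ) * (1 + α₀) / ((m : ℝ) + α₀))) ∧
    1 ≤ (m : ℝ) * (1 + α₀) / ((m : ℝ) + α₀) ∧
    Tendsto (fun k : ℕ => (k : ℝ) * (1 + α₀) / ((k : ℝ) + α₀)) atTop (𝓝 (1 + α₀)) := by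
  have hm0 : m ≠ 0 := by omega
  have hm1 : (1 : ℝ) ≤ m := by exact_mod_cast hm
  refine ⟨?_, ?_, ?_⟩
  · have hwZ := hmodel.voteLaw_Z
    have hwS := hmodel.voteLaw_S hm0 hα₀
    have hY := hmodel.measurable_Y
    have hprobν : IsProbabilityMeasure ν := by
      rw [hν]
      exact Measure.isProbabilityMeasure_map
        ((hY 0).prodMk (hmodel.measurable_Z 0)).aemeasurable
    have hsZ := hwZ.logisticSample hY hmodel.measurable_Z
      (hmodel.indep.comp (fun _ y => (y.1, y.2.1)) fun _ => by fun_prop)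
      (fun j => (hmodel.identDistrib j).comp (u := fun y => (y.1, y.2.1)) (by fun_prop))
      (hmodel.memLp_Y 0) (hmodel.cov_posDef 0)
    have hsS := hwS.logisticSample hY hmodel.measurable_S
      (hmodel.indep.comp (fun _ y => (y.1, y.2.2)) fun _ => by fun_prop)
      (fun j => (hmodel.identDistrib j).comp (u := fun y => (y.1, y.2.2)) (by fun_prop))
      (hmodel.memLp_Y 0) (hmodel.cov_posDef 0)
    obtain ⟨J, hJ⟩ := NoisyLabels.exists_equiv_integral_rankOne (hsZ.measurable_x 0) hsZ.memLp_x
      hsZ.nondegenerate (NoisyLabels.measurable_logisticWeight (WithLp.toLp 2 β))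
      (NoisyLabels.logisticWeight_mem _) (NoisyLabels.logisticWeight_pos _)
    have hmin : ∀ b, NoisyLabels.errorRate ν β ≤ NoisyLabels.errorRate ν b := fun b => by
      rw [hν]
      exact NoisyLabels.errorRate_le (hY 0) (hmodel.measurable_Z 0) hwZ b
    have hcrit : fderiv ℝ (NoisyLabels.errorRate ν) β = 0 :=
      IsLocalMin.fderiv_eq_zero (Eventually.of_forall hmin)
    have htaylor := NoisyLabels.taylor_two_isLittleO hdiff hdiff₂ hcrit
    set H := fderiv ℝ (fderiv ℝ (NoisyLabels.errorRate ν)) β with hH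
    have hsymm : ∀ v w, H v w = H w v :=
      second_derivative_symmetric_of_eventually (hdiff.mono fun b hb => hb.hasFDerivAt)
        hdiff₂.hasFDerivAt
    -- The Hessian lives on the product with its sup norm, the likelihood analysis on the Euclidean
    -- product; `Φ` carries the expansion across.
    let Φ := WithLp.prodContinuousLinearEquiv 2 ℝ ℝ (NoisyLabels.Feature p)
    let Φ' : WithLp 2 (ℝ × NoisyLabels.Feature p) →L[ℝ] ℝ × NoisyLabels.Feature p := Φ
    let q := ((1 / 2 : ℝ) • H).bilinearComp Φ' Φ'
    have hq : (fun h : WithLp 2 (ℝ × NoisyLabels.Feature p) =>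
        NoisyLabels.errorRate ν (WithLp.ofLp (WithLp.toLp 2 β + h)) -
        NoisyLabels.errorRate ν β - q h h) =o[𝓝 0] fun h => ‖h‖ ^ 2 := by
      have ht : Tendsto Φ' (𝓝 0) (𝓝 0) := by
        simpa using Φ'.continuous.tendsto 0
      exact (htaylor.comp_tendsto ht).trans_isBigO
        ((Φ'.isBigO_id (𝓝 0)).norm_norm.pow 2)
    have hqpos : ∀ e, 0 ≤ q e e := fun e =>
      NoisyLabels.bilin_self_nonneg_of_isMin htaylor hmin (Φ' e)
    let Q := q.bilinearComp (J.symm : WithLp 2 (ℝ × NoisyLabels.Feature p) →L[ℝ] _)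
      (J.symm : WithLp 2 (ℝ × NoisyLabels.Feature p) →L[ℝ] _)
    have hQsymm : ∀ a b, Q a b = Q b a := fun a b => by
      change (1 / 2 : ℝ) * H (Φ (J.symm a)) (Φ (J.symm b)) =
        (1 / 2 : ℝ) * H (Φ (J.symm b)) (Φ (J.symm a))
      rw [hsymm]
    have hQpos : ∀ a, 0 ≤ Q a a := fun a => hqpos _
    set D := ∫ ω, NoisyLabels.logisticWeight (WithLp.toLp 2 β) (NoisyLabels.design (Y 0 ω)) *
        q (J.symm (NoisyLabels.design (Y 0 ω))) (J.symm (NoisyLabels.design (Y 0 ω))) ∂P with hD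
    -- A vanishing integral of a nonnegative function with positive weights forces `Q` to vanish on
    -- almost every design vector. Non-degeneracy then gives `Q = 0`, and bijectivity of `J` and `Φ`
    -- transfers this to `H`.
    have hDne : D ≠ 0 := fun h0 => by
      have hQi : Integrable (fun ω => NoisyLabels.logisticWeight (WithLp.toLp 2 β)
          (NoisyLabels.design (Y 0 ω)) *
          Q (NoisyLabels.design (Y 0 ω)) (NoisyLabels.design (Y 0 ω))) P := by
        have hQc : Continuous fun e => Q e e := by fun_prop
        refine (hsZ.memLp_x.norm.integrable_sq.const_mul ‖Q‖).mono'
          (((NoisyLabels.measurable_logisticWeight _).mul hQc.measurable).comp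
            (hsZ.measurable_x 0)).aestronglyMeasurable (ae_of_all _ fun ω => ?_)
        rw [norm_mul, Real.norm_of_nonneg (NoisyLabels.logisticWeight_mem _ _).1]
        exact (mul_le_of_le_one_left (norm_nonneg _) (NoisyLabels.logisticWeight_mem _ _).2).trans
          (NoisyLabels.abs_bilin_self_le Q _)
      have hae := (integral_eq_zero_iff_of_nonneg (fun ω =>
        mul_nonneg (NoisyLabels.logisticWeight_mem _ _).1 (hQpos _)) hQi).1 h0
      have hQ0 : Q = 0 := by
        refine NoisyLabels.bilin_eq_zero_of_ae_eq_zero hsZ.nondegenerate hQsymm hQpos ?_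
        filter_upwards [hae] with ω hω
        exact (mul_eq_zero.1 hω).resolve_left (NoisyLabels.logisticWeight_pos _ _).ne'
      refine hHess ?_
      refine ContinuousLinearMap.ext fun a => ContinuousLinearMap.ext fun b => ?_
      have h1 : Q (J (Φ.symm a)) (J (Φ.symm b)) = (1 / 2 : ℝ) * H a b := by
        change (1 / 2 : ℝ) * H (Φ (J.symm (J (Φ.symm a)))) (Φ (J.symm (J (Φ.symm b)))) = _
        simp
      rw [hQ0] at h1
      simpa using h1.symm
    have limG := NoisyLabels.tendsto_mul_expectedExcessError one_ne_zero hwZ hY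
      hmodel.measurable_Z hsZ hJ hq hG
    have limM := NoisyLabels.tendsto_mul_expectedExcessError hm0 hwS hY
      hmodel.measurable_S hsS hJ hq hM
    have hv : ((m : ℝ) + α₀) / (m * (1 + α₀)) ≠ 0 := by positivity
    -- Both scaled limits contain the same `D`, which cancels along with the factors `n`, leaving
    -- the reciprocal of the variance factor.
    have hlim := limG.div limM (mul_ne_zero hv hDne)
    have e : (1 * D) / (((m : ℝ) + α₀) / (m * (1 + α₀)) * D) =
        (m : ℝ) * (1 + α₀) / ((m : ℝ) + α₀) := by
      field_simp
    rw [e] at hlim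
    refine hlim.congr' ?_
    filter_upwards [eventually_ne_atTop 0] with n hn
    have hn0 : (n : ℝ) ≠ 0 := by exact_mod_cast hn
    exact mul_div_mul_left _ _ hn0
  · rw [one_le_div (by positivity)]
    nlinarith
  · have h1 : Tendsto (fun k : ℕ => (k : ℝ) / ((k : ℝ) + α₀)) atTop (𝓝 1) :=
      tendsto_natCast_div_add_atTop α₀
    have h2 := h1.mul_const (1 + α₀)
    rw [one_mul] at h2
    refine h2.congr fun k => ?_
    ring
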